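/- **Theorem 5.1 (Probabilistic error analysis of 3C).** *Notation.* For a real matrix $X=[X_1,\dots,X_n]$ let $\|X\|_2$ be the spectral norm, $\|X\|_F$ the Frobenius norm, $\|X\|_g=\max_j\|X_j\|_2$, and $\kappa_2(X)=\sigma_1(X)/\sigma_n(X)$. For $\lambda>0$ and a unit roundoff ${\bf u}$ put $P(\lambda)=1-2\exp\left(-\lambda^2(1-{\bf u})^2/2\right)$ and $Q(\lambda,N)=1-N(1-P(\lambda))$. *Algorithm.* CholeskyQR of $X$ computes $U=X^\top X$, the upper triangular Cholesky factor $V$ of $U$, and $XV^{-1}$ by substitution; Shifted CholeskyQR with shift $s$ does the same with $U+sI$ in place of $U$. The algorithm $[Q_2,V_4]=3C(T)$ computes: $[Q,V]$ by Shifted CholeskyQR of $T$ with shift $s_1$; $[Q_1,V_1]$ by Shifted CholeskyQR of $Q$ with shift $s_2$; $V_2=V_1V$; $[Q_2,V_3]$ by CholeskyQR of $Q_1$; $V_4=V_3V_2$. Here $$s_1=11\lambda(\sqrt m\,n{\bf u}+\sqrt{n+1}\,n{\bf u})\|T\|_g^2,\qquad s_2=11\lambda(\sqrt m\,n{\bf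 u}+\sqrt{n+1}\,n{\bf u})\|Q\|_g^2 .$$ It is run in floating-point arithmetic by the textbook loops (sums and substitutions taken in the natural order): each elementary operation returns the exact result of that operation times $1+\delta$, where the rounding errors $\delta$ of all operations are independent random variables of mean zero with $|\delta|\le{\bf u}$. All of $Q,V,Q_1,V_1,V_2,Q_2,V_3,V_4$ denote computed matrices. A Cholesky factorization runs to completion if all its computed pivots are positive. Put $p_1=\|T\|_g/\|T\|_2$, $p_2=\|Q\|_g/\|Q\|_2$, $p_3=\|Q_1\|_g/\|Q_1\|_2$. *Statement.* Let $T\in\mathbb R^{m\times n}$, $n\ge1$, have rank $n$, let ${\bf u}>0$, $0<\lambda\le10$, $$\max(\lambda\sqrt m\,n{\bf u},\,mn{\bf u})\le\tfrac1{2200},\qquad \max(\lambda\sqrt{n+1}\,n{\bf u},\,n(n+1){\bf u})\le\tfrac1{2200},$$ and let $Q(\lambda,mn^2)>0$. Then, with probability at least $$\Big(Q(\lambda,mn^2)\,Q\big(\lambda,\tfrac{n^3}6+\tfrac{n^2}2+\tfrac n3\big)\,Q\big(\lambda,\tfrac{n(n+1)}2\big)\Big)^3 Q(\lambda,n^3)^2,$$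 the following holds. The first Cholesky factorization runs to completion. If $$\kappa_2(T)\le\frac1{4.89\,\lambda\,p_1p_2\,n\sqrt n\,{\bf u}},$$ then the second one runs to completion too. If, moreover, $Q_1$ satisfies the sufficient condition for CholeskyQR not to break down, $$8\,p_3\,\kappa_2(Q_1)\sqrt{\lambda(\sqrt m\,n{\bf u}+\sqrt{n+1}\,n{\bf u})}\le1,$$ then the third one runs to completion and $$\|Q_2^\top Q_2-I\|_F\le 3645\,p_3^2(\sqrt m+\sqrt{n+1})^3\,n{\bf u},\qquad \|Q_2V_4-T\|_F\le\phi_2(p_1,p_2,p_3)\,\lambda\,n\sqrt n\,{\bf u}\,\|T\|_2,$$ where $\phi_2(p_1,p_2,p_3)=1.67p_1+3.35p_2+3.38p_1p_2+4.08p_3+4.12p_1p_3$. -/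

import Mathlib

open MeasureTheory ProbabilityTheory
open scoped Matrix

noncomputable section

/-! ### Norms and condition number -/

/-- The spectral norm (operator norm for the Euclidean norms). -/
def norm2 {m n : ℕ} (X : Matrix (Fin m) (Fin n) ℝ) : ℝ :=
  (Matrix.instL2OpNormedAddCommGroup : NormedAddCommGroup (Matrix (Fin m) (Fin n) ℝ)).norm X

/-- The Frobenius norm. -/
def normF {m n : ℕ} (X : Matrix (Fin m) (Fin n) ℝ) : ℝ :=
  √(∑ i, ∑ j, X i j ^ 2)

/-- The `g`-norm: the largest Euclidean norm of a column. -/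
def normG {m n : ℕ} (X : Matrix (Fin m) (Fin n) ℝ) : ℝ :=
  ⨆ j : Fin n, √(∑ i, X i j ^ 2)

/-- The `n`-th largest singular value of a matrix with `n` columns
(Mathlib numbers singular values from `0`). -/
def sigmaMin {m n : ℕ} (X : Matrix (Fin m) (Fin n) ℝ) : ℝ :=
  (Matrix.toEuclideanLin X).singularValues (n - 1)

/-- The spectral condition number of a matrix of full column rank. -/
def kappa2 {m n : ℕ} (X : Matrix (Fin m) (Fin n) ℝ) : ℝ :=
  norm2 X / sigmaMin X

/-- The ratio of the `g`-norm and the spectral norm. -/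
def pRatio {m n : ℕ} (X : Matrix (Fin m) (Fin n) ℝ) : ℝ :=
  normG X / norm2 X

/-! ### Probabilities -/

/-- `P(lam) = 1 - 2 exp(-lam² (1 - u)² / 2)`. -/
def probP (u lam : ℝ) : ℝ :=
  1 - 2 * Real.exp (-(lam ^ 2 * (1 - u) ^ 2) / 2)

/-- `Q(lam, N) = 1 - N (1 - P(lam))`. -/
def probQ (u lam N : ℝ) : ℝ :=
  1 - N * (1 - probP u lam)

/-! ### Floating-point operations

Every elementary operation `x op y` (and every square root) is computed as the exact result times
`1 + δ`, with its own rounding error `δ`. -/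

/-- The elementary floating-point operations of the algorithm `3C` on an `m × n` matrix. The three
(Shifted) CholeskyQR steps are numbered `0, 1, 2`, and the products of triangular factors `0, 1`. -/
inductive FlOp (m n : ℕ) : Type
  /-- `k`-th multiplication in the inner product of columns `i` and `j` -/
  | gramMul (step : Fin 3) (i j : Fin n) (k : Fin m)
  /-- addition of the `k`-th product in that inner product (none is needed for `k = 0`) -/
  | gramAdd (step : Fin 3) (i j : Fin n) (k : Fin m)
  /-- addition of the shift to the `i`-th diagonal entry -/
  | shiftAdd (step : Fin 3) (i : Fin n)
  /-- Cholesky, entry `(i, j)`: `k`-th multiplication -/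
  | cholMul (step : Fin 3) (i j k : Fin n)
  /-- Cholesky, entry `(i, j)`: `k`-th subtraction -/
  | cholSub (step : Fin 3) (i j k : Fin n)
  /-- Cholesky, entry `(i, j)`: the final square root (`i = j`) or division (`i < j`) -/
  | cholFin (step : Fin 3) (i j : Fin n)
  /-- triangular solve, entry `(i, j)`: `k`-th multiplication -/
  | solveMul (step : Fin 3) (i : Fin m) (j k : Fin n)
  /-- triangular solve, entry `(i, j)`: `k`-th subtraction -/
  | solveSub (step : Fin 3) (i : Fin m) (j k : Fin n)
  /-- triangular solve, entry `(i, j)`: the final division -/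
  | solveDiv (step : Fin 3) (i : Fin m) (j : Fin n)
  /-- product of triangular factors, entry `(i, j)`: `k`-th multiplication -/
  | prodMul (which : Fin 2) (i j k : Fin n)
  /-- product of triangular factors, entry `(i, j)`: addition of the `k`-th product
  (none is needed for `k = 0`) -/
  | prodAdd (which : Fin 2) (i j k : Fin n)

/-- The probabilistic rounding model: the rounding errors of the individual operations are
independent random variables of mean zero, bounded in absolute value by the unit roundoff. -/
structure IsRoundingModel {Ω ι : Type*} [MeasurableSpace Ω] (P : Measure Ω) (u : ℝ)
    (δ : ι → Ω → ℝ) : Prop where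
  measurable : ∀ a, Measurable (δ a)
  indep : iIndepFun δ P
  mean_zero : ∀ a, ∫ ω, δ a ω ∂P = 0
  bounded : ∀ a, ∀ᵐ ω ∂P, |δ a ω| ≤ u

/-- Computed sum `t 0 + t 1 + ⋯` from left to right; `η k` is the error of adding `t k`. -/
def flSum : (m : ℕ) → (Fin m → ℝ) → (Fin m → ℝ) → ℝ
  | 0, _, _ => 0
  | 1, t, _ => t 0
  | m + 2, t, η =>
    (flSum (m + 1) (fun k => t k.castSucc) (fun k => η k.castSucc) + t (Fin.last (m + 1))) *
      (1 + η (Fin.last (m + 1)))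

/-- Computed value of `c - t 0 - t 1 - ⋯` from left to right; `η k` is the error of
subtracting `t k`. -/
def flSub (c : ℝ) : (m : ℕ) → (Fin m → ℝ) → (Fin m → ℝ) → ℝ
  | 0, _, _ => c
  | m + 1, t, η =>
    (flSub c m (fun k => t k.castSucc) (fun k => η k.castSucc) - t (Fin.last m)) *
      (1 + η (Fin.last m))

section Kernels

variable {m n : ℕ} (δ : FlOp m n → ℝ)

/-- Computed `Xᵀ X`. -/
def flGram (step : Fin 3) (X : Matrix (Fin m) (Fin n) ℝ) : Matrix (Fin n) (Fin n) ℝ :=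
  Matrix.of fun i j =>
    flSum m (fun k => X k i * X k j * (1 + δ (.gramMul step i j k)))
      (fun k => δ (.gramAdd step i j k))

/-- Computed `U + s I`. -/
def flShift (step : Fin 3) (s : ℝ) (U : Matrix (Fin n) (Fin n) ℝ) :
    Matrix (Fin n) (Fin n) ℝ :=
  Matrix.of fun i j => if i = j then (U i j + s) * (1 + δ (.shiftAdd step i)) else U i j

/-- Computed value of `A i j - ∑ k < i, V k i * V k j`, where `V` is the computed Cholesky
factor (only the rows of `V` above row `i` enter). -/
def flCholReduced (step : Fin 3) (A : Matrix (Fin n) (Fin n) ℝ)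
    (V : Matrix (Fin n) (Fin n) ℝ) (i j : Fin n) : ℝ :=
  flSub (A i j) i.1
    (fun k : Fin i.1 =>
      V (k.castLE i.2.le) i * V (k.castLE i.2.le) j *
        (1 + δ (.cholMul step i j (k.castLE i.2.le))))
    (fun k : Fin i.1 => δ (.cholSub step i j (k.castLE i.2.le)))

/-- The first `r` rows of the computed Cholesky factor (the other rows are zero). -/
def flCholRows (step : Fin 3) (A : Matrix (Fin n) (Fin n) ℝ) : ℕ → Matrix (Fin n) (Fin n) ℝ
  | 0 => 0
  | r + 1 =>
    Matrix.of fun i j =>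
      if i.1 = r then
        let W := flCholRows step A r
        let d := √(flCholReduced δ step A W i i) * (1 + δ (.cholFin step i i))
        if j < i then 0
        else if j = i then d
        else flCholReduced δ step A W i j / d * (1 + δ (.cholFin step i j))
      else flCholRows step A r i j

/-- The computed upper triangular Cholesky factor of `A`; only the upper triangle of `A` is
read. -/
def flChol (step : Fin 3) (A : Matrix (Fin n) (Fin n) ℝ) : Matrix (Fin n) (Fin n) ℝ :=
  flCholRows δ step A n

/-- The Cholesky factorization runs to completion: all computed pivots are positive. -/
def CholRuns (step : Fin 3) (A : Matrix (Fin n) (Fin n) ℝ) : Prop :=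
  ∀ i, 0 < flCholReduced δ step A (flChol δ step A) i i

/-- The first `r` columns of the computed solution `Y` of `Y V = X` (the other columns are
zero). -/
def flSolveCols (step : Fin 3) (X : Matrix (Fin m) (Fin n) ℝ) (V : Matrix (Fin n) (Fin n) ℝ) :
    ℕ → Matrix (Fin m) (Fin n) ℝ
  | 0 => 0
  | r + 1 =>
    Matrix.of fun i j =>
      if j.1 = r then
        flSub (X i j) j.1
            (fun k : Fin j.1 =>
              flSolveCols step X V r i (k.castLE j.2.le) * V (k.castLE j.2.le) j *
                (1 + δ (.solveMul step i j (k.castLE j.2.le))))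
            (fun k : Fin j.1 => δ (.solveSub step i j (k.castLE j.2.le))) /
          V j j * (1 + δ (.solveDiv step i j))
      else flSolveCols step X V r i j

/-- Computed `X V⁻¹` for upper triangular `V`: substitution, row by row, in `Y V = X`. -/
def flSolve (step : Fin 3) (X : Matrix (Fin m) (Fin n) ℝ) (V : Matrix (Fin n) (Fin n) ℝ) :
    Matrix (Fin m) (Fin n) ℝ :=
  flSolveCols δ step X V n

/-- Computed product `A B` of `n × n` matrices. -/
def flMul (which : Fin 2) (A B : Matrix (Fin n) (Fin n) ℝ) : Matrix (Fin n) (Fin n) ℝ :=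
  Matrix.of fun i j =>
    flSum n (fun k => A i k * B k j * (1 + δ (.prodMul which i j k)))
      (fun k => δ (.prodAdd which i j k))

/-! ### The algorithms -/

/-- The outcome of one (Shifted) CholeskyQR step: whether its Cholesky factorization runs to
completion, the orthogonal factor and the triangular factor. -/
structure QROutput (m n : ℕ) where
  runs : Prop
  Q : Matrix (Fin m) (Fin n) ℝ
  V : Matrix (Fin n) (Fin n) ℝ

/-- CholeskyQR in floating-point arithmetic. -/
def cholQR (step : Fin 3) (X : Matrix (Fin m) (Fin n) ℝ) : QROutput m n :=
  let U := flGram δ step X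
  let V := flChol δ step U
  { runs := CholRuns δ step U, Q := flSolve δ step X V, V := V }

/-- Shifted CholeskyQR with shift `s` in floating-point arithmetic. -/
def sCholQR (step : Fin 3) (s : ℝ) (X : Matrix (Fin m) (Fin n) ℝ) : QROutput m n :=
  let A := flShift δ step s (flGram δ step X)
  let V := flChol δ step A
  { runs := CholRuns δ step A, Q := flSolve δ step X V, V := V }

/-- All matrices computed by the algorithm `3C`, and whether its three Cholesky factorizations
run to completion. -/
structure Output3C (m n : ℕ) where
  runs₁ : Prop
  Q : Matrix (Fin m) (Fin n) ℝ
  V : Matrix (Fin n) (Fin n) ℝ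
  runs₂ : Prop
  Q₁ : Matrix (Fin m) (Fin n) ℝ
  V₁ : Matrix (Fin n) (Fin n) ℝ
  V₂ : Matrix (Fin n) (Fin n) ℝ
  runs₃ : Prop
  Q₂ : Matrix (Fin m) (Fin n) ℝ
  V₃ : Matrix (Fin n) (Fin n) ℝ
  V₄ : Matrix (Fin n) (Fin n) ℝ

/-- The algorithm `3C` in floating-point arithmetic, with shift `shift T` in the first step and
`shift Q` in the second one, where `Q` is the computed result of the first step. -/
def alg3C (shift : Matrix (Fin m) (Fin n) ℝ → ℝ) (T : Matrix (Fin m) (Fin n) ℝ) :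
    Output3C m n :=
  let a := sCholQR δ 0 (shift T) T
  let b := sCholQR δ 1 (shift a.Q) a.Q
  let V₂ := flMul δ 0 b.V a.V
  let c := cholQR δ 2 b.Q
  { runs₁ := a.runs, Q := a.Q, V := a.V
    runs₂ := b.runs, Q₁ := b.Q, V₁ := b.V, V₂ := V₂
    runs₃ := c.runs, Q₂ := c.Q, V₃ := c.V, V₄ := flMul δ 1 c.V V₂ }

end Kernels

/-- The shift `11 lam (√m n u + √(n+1) n u) ‖X‖_g²`. -/
def shift3C (u lam : ℝ) {m n : ℕ} (X : Matrix (Fin m) (Fin n) ℝ) : ℝ :=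
  11 * lam * (√(m : ℝ) * n * u + √((n : ℝ) + 1) * n * u) * normG X ^ 2

/-- The constant of the residual bound. -/
def phi2 (p₁ p₂ p₃ : ℝ) : ℝ :=
  1.67 * p₁ + 3.35 * p₂ + 3.38 * p₁ * p₂ + 4.08 * p₃ + 4.12 * p₁ * p₃

end

/-!
Every computed sum or substitution is an exact one in which each term is multiplied by a product of
factors `(1 + δ)^{±1}`. The logarithm of such a product is, up to second order, a signed sum of at
most `N` independent, centred rounding errors, with `N = m` for the Gram matrices and `N = n`
otherwise, so by Hoeffding's inequality it exceeds `√5 lam √N u` with probability at most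
`2 exp(-5 lam² / 2)`. There are at most `11 m n²` such products. Since `probQ u lam (m n²) > 0`
forces `exp(-lam² / 2) < 1/2`, the union bound `22 m n² exp(-5 lam² / 2)` is smaller than
`1 - probQ u lam (m n²)`, and hence smaller than one minus the product of probabilities in the claim
(`probQ_prod_le`). Outside the exceptional event all products are within `2.24 lam √N u` of `1`
(`SmallRelErrors`), and the rest of the argument is deterministic.

Put `L = lam (√m + √(n+1)) n u` (`gramError`) and `ε = lam n √n u` (`solveError`), so `2 ε ≤ L`.
The backward error of the Gram matrix and of its Cholesky factorization is at most a third of the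
shift `11 L ‖X‖_g²`. For a nonpositive pivot a vector annihilated by the leading rows of the
computed factor would contradict positive definiteness (`false_of_nonpos_pivot`); so the
factorization runs to completion, and a step computes `V`, `Y` with `Vᵀ V = Xᵀ X + σ I + E` and `Y V = X + F`, where
`E` and `F` are small (`ApproxQR`). The consequences are as follows.

* After a shifted step `‖Y‖₂ ≤ 1.014`, and a lower bound for the singular values of `X` that
  dominates `F` passes to `Y`, relative to the shift. Under the assumption on `κ₂(T)` the singular
  values of `Q` are at least of order `ε p₂ / √L`, and those of `Q₁` are then at least `0.15 ε / L`.
* In the last step, which has no shift, the assumption on `κ₂(Q₁)` lets `Q₁ᵀ Q₁` play the role of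
  the shift. The lower bound `0.15 ε / L` turns its backward errors into the bound for the
  orthogonality, in which `lam ≤ 10` removes the factor `lam`.
* The residual `Q₂ V₄ - T` is a sum of five terms, one for each substitution and each product of
  triangular factors (`normF_residual_le`).
-/

/-! ### Vector and matrix norms -/

/-- The Euclidean norm of a coordinate vector. -/
noncomputable def vecNorm {n : ℕ} (x : Fin n → ℝ) : ℝ := √(∑ i, x i ^ 2)

section Norms

variable {l m n : ℕ}

theorem vecNorm_eq_norm (x : Fin n → ℝ) : vecNorm x = ‖WithLp.toLp 2 x‖ := by
  simp [vecNorm, EuclideanSpace.norm_eq]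

theorem vecNorm_nonneg (x : Fin n → ℝ) : 0 ≤ vecNorm x := Real.sqrt_nonneg _

theorem vecNorm_sq (x : Fin n → ℝ) : vecNorm x ^ 2 = ∑ i, x i ^ 2 :=
  Real.sq_sqrt (Finset.sum_nonneg fun _ _ => sq_nonneg _)

theorem vecNorm_sq_eq_dotProduct (x : Fin n → ℝ) : vecNorm x ^ 2 = x ⬝ᵥ x := by
  rw [vecNorm_sq]
  simp [dotProduct, sq]

theorem vecNorm_add_le (x y : Fin n → ℝ) : vecNorm (x + y) ≤ vecNorm x + vecNorm y := by
  simp only [vecNorm_eq_norm, WithLp.toLp_add]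
  exact norm_add_le _ _

theorem vecNorm_sub_le_vecNorm_add (x y : Fin n → ℝ) :
    vecNorm x - vecNorm y ≤ vecNorm (x + y) := by
  simp only [vecNorm_eq_norm, WithLp.toLp_add]
  have := norm_sub_norm_le (WithLp.toLp 2 x) (-WithLp.toLp 2 y)
  simpa using this

theorem abs_sum_mul_le_vecNorm (x y : Fin n → ℝ) :
    ∑ i, |x i| * |y i| ≤ vecNorm x * vecNorm y := by
  have := Real.sum_mul_le_sqrt_mul_sqrt Finset.univ (fun i => |x i|) (fun i => |y i|)
  simpa [vecNorm] using this

theorem norm2_eq_norm (A : Matrix (Fin m) (Fin n) ℝ) :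
    norm2 A = ‖LinearMap.toContinuousLinearMap (Matrix.toEuclideanLin A)‖ := rfl

theorem norm2_nonneg (A : Matrix (Fin m) (Fin n) ℝ) : 0 ≤ norm2 A := by
  rw [norm2_eq_norm]
  exact norm_nonneg _

theorem vecNorm_mulVec_le (A : Matrix (Fin m) (Fin n) ℝ) (x : Fin n → ℝ) :
    vecNorm (A *ᵥ x) ≤ norm2 A * vecNorm x := by
  rw [norm2_eq_norm, vecNorm_eq_norm, vecNorm_eq_norm]
  exact (LinearMap.toContinuousLinearMap (Matrix.toEuclideanLin A)).le_opNorm (WithLp.toLp 2 x)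

theorem norm2_le_of_forall {A : Matrix (Fin m) (Fin n) ℝ} {c : ℝ} (hc : 0 ≤ c)
    (h : ∀ x, vecNorm (A *ᵥ x) ≤ c * vecNorm x) : norm2 A ≤ c := by
  rw [norm2_eq_norm]
  refine ContinuousLinearMap.opNorm_le_bound _ hc fun x => ?_
  have := h (WithLp.ofLp x)
  rw [vecNorm_eq_norm, vecNorm_eq_norm] at this
  exact this

theorem norm2_mul_le (A : Matrix (Fin l) (Fin m) ℝ) (B : Matrix (Fin m) (Fin n) ℝ) :
    norm2 (A * B) ≤ norm2 A * norm2 B := by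
  refine norm2_le_of_forall (mul_nonneg (norm2_nonneg A) (norm2_nonneg B)) fun x => ?_
  rw [← Matrix.mulVec_mulVec, mul_assoc]
  exact (vecNorm_mulVec_le _ _).trans
    (mul_le_mul_of_nonneg_left (vecNorm_mulVec_le _ _) (norm2_nonneg A))

theorem norm2_add_le (A B : Matrix (Fin m) (Fin n) ℝ) : norm2 (A + B) ≤ norm2 A + norm2 B := by
  refine norm2_le_of_forall (add_nonneg (norm2_nonneg A) (norm2_nonneg B)) fun x => ?_
  rw [Matrix.add_mulVec, add_mul]
  exact (vecNorm_add_le _ _).trans (add_le_add (vecNorm_mulVec_le _ _) (vecNorm_mulVec_le _ _))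

theorem norm2_transpose (A : Matrix (Fin m) (Fin n) ℝ) : norm2 Aᵀ = norm2 A := by
  have := Matrix.l2_opNorm_conjTranspose A
  rwa [Matrix.conjTranspose_eq_transpose_of_trivial] at this

theorem normF_nonneg (A : Matrix (Fin m) (Fin n) ℝ) : 0 ≤ normF A := Real.sqrt_nonneg _

theorem normF_sq (A : Matrix (Fin m) (Fin n) ℝ) : normF A ^ 2 = ∑ i, ∑ j, A i j ^ 2 :=
  Real.sq_sqrt (Finset.sum_nonneg fun _ _ => Finset.sum_nonneg fun _ _ => sq_nonneg _)

theorem normF_sq_eq_sum_row (A : Matrix (Fin m) (Fin n) ℝ) :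
    normF A ^ 2 = ∑ i, vecNorm (A i) ^ 2 := by
  simp only [normF_sq, vecNorm_sq]

theorem normF_transpose (A : Matrix (Fin m) (Fin n) ℝ) : normF Aᵀ = normF A := by
  unfold normF
  rw [Finset.sum_comm]
  rfl

theorem normF_sq_eq_sum_col (A : Matrix (Fin m) (Fin n) ℝ) :
    normF A ^ 2 = ∑ j, vecNorm (Aᵀ j) ^ 2 := by
  rw [← normF_transpose, normF_sq_eq_sum_row]

theorem normF_add_le (A B : Matrix (Fin m) (Fin n) ℝ) : normF (A + B) ≤ normF A + normF B := by
  have key : ∀ A : Matrix (Fin m) (Fin n) ℝ,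
      normF A = ‖(WithLp.toLp 2 (fun p : Fin m × Fin n => A p.1 p.2))‖ := fun A => by
    simp [normF, EuclideanSpace.norm_eq, Fintype.sum_prod_type]
  simp only [key]
  exact norm_add_le (WithLp.toLp 2 (fun p : Fin m × Fin n => A p.1 p.2))
    (WithLp.toLp 2 (fun p : Fin m × Fin n => B p.1 p.2))

theorem normF_neg (A : Matrix (Fin m) (Fin n) ℝ) : normF (-A) = normF A := by
  simp [normF]

theorem normF_le_of_sq_le {A : Matrix (Fin m) (Fin n) ℝ} {c : ℝ} (hc : 0 ≤ c)
    (h : normF A ^ 2 ≤ c ^ 2) : normF A ≤ c :=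
  (abs_le_of_sq_le_sq' h hc).2

theorem normF_le_of_entry_le (A : Matrix (Fin n) (Fin n) ℝ) {c : ℝ} (hc : 0 ≤ c)
    (h : ∀ i j, |A i j| ≤ c) : normF A ≤ n * c := by
  refine normF_le_of_sq_le (by positivity) ?_
  rw [normF_sq]
  calc ∑ i, ∑ j, A i j ^ 2 ≤ ∑ _i : Fin n, ∑ _j : Fin n, c ^ 2 :=
        Finset.sum_le_sum fun i _ => Finset.sum_le_sum fun j _ =>
          sq_le_sq.2 (by rw [abs_of_nonneg hc]; exact h i j)
    _ = (n * c) ^ 2 := by simp; ring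

theorem normF_mul_le_norm2_mul (A : Matrix (Fin l) (Fin m) ℝ) (B : Matrix (Fin m) (Fin n) ℝ) :
    normF (A * B) ≤ norm2 A * normF B := by
  refine normF_le_of_sq_le (mul_nonneg (norm2_nonneg A) (normF_nonneg B)) ?_
  rw [mul_pow, normF_sq_eq_sum_col, normF_sq_eq_sum_col, Finset.mul_sum]
  refine Finset.sum_le_sum fun j _ => ?_
  rw [← mul_pow]
  refine pow_le_pow_left₀ (vecNorm_nonneg _) ?_ 2
  exact vecNorm_mulVec_le A (Bᵀ j)

theorem normF_mul_le_mul_norm2 (A : Matrix (Fin l) (Fin m) ℝ) (B : Matrix (Fin m) (Fin n) ℝ) :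
    normF (A * B) ≤ normF A * norm2 B := by
  have := normF_mul_le_norm2_mul Bᵀ Aᵀ
  rwa [← Matrix.transpose_mul, normF_transpose, normF_transpose, norm2_transpose, mul_comm] at this

theorem norm2_le_normF (A : Matrix (Fin m) (Fin n) ℝ) : norm2 A ≤ normF A := by
  refine norm2_le_of_forall (normF_nonneg A) fun x => ?_
  refine abs_le_of_sq_le_sq' ?_ (mul_nonneg (normF_nonneg A) (vecNorm_nonneg x)) |>.2
  rw [mul_pow, normF_sq_eq_sum_row, vecNorm_sq, Finset.sum_mul]
  refine Finset.sum_le_sum fun i _ => ?_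
  rw [← mul_pow, ← sq_abs]
  refine pow_le_pow_left₀ (abs_nonneg _) ?_ 2
  refine le_trans ?_ (abs_sum_mul_le_vecNorm (A i) x)
  simp only [Matrix.mulVec, dotProduct]
  exact (Finset.abs_sum_le_sum_abs _ _).trans (le_of_eq (by simp only [abs_mul]))

theorem normF_le_of_entry_le_mul {A : Matrix (Fin l) (Fin m) ℝ} {B : Matrix (Fin m) (Fin n) ℝ}
    {E : Matrix (Fin l) (Fin n) ℝ} {g : ℝ} (hg : 0 ≤ g)
    (h : ∀ i j, |E i j| ≤ g * ∑ k, |A i k| * |B k j|) : normF E ≤ g * normF A * normF B := by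
  refine normF_le_of_sq_le (mul_nonneg (mul_nonneg hg (normF_nonneg A)) (normF_nonneg B)) ?_
  rw [mul_pow, mul_pow, normF_sq_eq_sum_row A, normF_sq_eq_sum_col B, mul_assoc, Finset.sum_mul_sum,
    normF_sq, Finset.mul_sum]
  refine Finset.sum_le_sum fun i _ => ?_
  rw [Finset.mul_sum]
  refine Finset.sum_le_sum fun j _ => ?_
  rw [← mul_pow, ← mul_pow, ← sq_abs]
  refine pow_le_pow_left₀ (abs_nonneg _) ((h i j).trans ?_) 2
  exact mul_le_mul_of_nonneg_left (abs_sum_mul_le_vecNorm (A i) (Bᵀ j)) hg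

theorem vecNorm_col_le_normG (A : Matrix (Fin m) (Fin n) ℝ) (j : Fin n) :
    vecNorm (Aᵀ j) ≤ normG A :=
  le_ciSup (f := fun j : Fin n => √(∑ i, A i j ^ 2)) (Set.finite_range _).bddAbove j

theorem normG_nonneg (A : Matrix (Fin m) (Fin n) ℝ) : 0 ≤ normG A :=
  Real.iSup_nonneg fun _ => Real.sqrt_nonneg _

theorem normG_le_norm2 (A : Matrix (Fin m) (Fin n) ℝ) : normG A ≤ norm2 A := by
  refine Real.iSup_le (fun j => ?_) (norm2_nonneg A)
  have := vecNorm_mulVec_le A (Pi.single j 1)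
  have h1 : vecNorm (Pi.single j 1 : Fin n → ℝ) = 1 := by
    simp [vecNorm_eq_norm]
  rw [h1, mul_one, Matrix.mulVec_single_one] at this
  exact this

theorem normF_le_of_vecNorm_col_le {A : Matrix (Fin m) (Fin n) ℝ} {c : ℝ} (hc : 0 ≤ c)
    (h : ∀ j, vecNorm (Aᵀ j) ≤ c) : normF A ≤ √(n : ℝ) * c := by
  refine normF_le_of_sq_le (by positivity) ?_
  rw [normF_sq_eq_sum_col, mul_pow, Real.sq_sqrt (Nat.cast_nonneg n)]
  calc ∑ j, vecNorm (Aᵀ j) ^ 2 ≤ ∑ _j : Fin n, c ^ 2 :=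
        Finset.sum_le_sum fun j _ => pow_le_pow_left₀ (vecNorm_nonneg _) (h j) 2
    _ = n * c ^ 2 := by simp

theorem normF_le_sqrt_mul_normG (A : Matrix (Fin m) (Fin n) ℝ) : normF A ≤ √(n : ℝ) * normG A :=
  normF_le_of_vecNorm_col_le (normG_nonneg A) (vecNorm_col_le_normG A)

theorem eq_zero_of_normG_eq_zero {A : Matrix (Fin m) (Fin n) ℝ} (h : normG A = 0) : A = 0 := by
  have h1 : normF A ≤ 0 := by simpa [h] using normF_le_sqrt_mul_normG A
  have h2 : normF A ^ 2 = 0 := by rw [le_antisymm h1 (normF_nonneg A)]; norm_num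
  rw [normF_sq] at h2
  ext i j
  have h3 := (Finset.sum_eq_zero_iff_of_nonneg (f := fun i => ∑ j, A i j ^ 2)
    fun _ _ => Finset.sum_nonneg fun _ _ => sq_nonneg _).1 h2 i (Finset.mem_univ i)
  have h4 := (Finset.sum_eq_zero_iff_of_nonneg (f := fun j => A i j ^ 2)
    fun _ _ => sq_nonneg _).1 h3 j (Finset.mem_univ j)
  simpa using h4

theorem sigmaMin_mul_vecNorm_le (hn : 1 ≤ n) (A : Matrix (Fin m) (Fin n) ℝ) (x : Fin n → ℝ) :
    sigmaMin A * vecNorm x ≤ vecNorm (A *ᵥ x) := by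
  set S := Matrix.toEuclideanLin A
  have hfr : Module.finrank ℝ (EuclideanSpace ℝ (Fin n)) = n := by simp
  have hS := S.isSymmetric_adjoint_comp_self
  set b := hS.eigenvectorBasis hfr
  set y : EuclideanSpace ℝ (Fin n) := WithLp.toLp 2 x
  have hSy : vecNorm (A *ᵥ x) = ‖S y‖ := vecNorm_eq_norm _
  have hlow : ∀ i, sigmaMin A ^ 2 ≤ hS.eigenvalues hfr i := fun i => by
    rw [← S.sq_singularValues_fin hfr i]
    exact pow_le_pow_left₀ (S.singularValues_nonneg _)
      (S.singularValues_antitone (by have := i.2; omega)) 2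
  have h1 : ‖S y‖ ^ 2 = ∑ i, hS.eigenvalues hfr i * inner ℝ (b i) y ^ 2 := by
    rw [← real_inner_self_eq_norm_sq, ← LinearMap.adjoint_inner_left,
      ← b.sum_inner_mul_inner]
    refine Finset.sum_congr rfl fun i _ => ?_
    have : inner ℝ (LinearMap.adjoint S (S y)) (b i) =
        hS.eigenvalues hfr i * inner ℝ (b i) y := by
      have h := hS y (b i)
      simp only [LinearMap.comp_apply] at h
      rw [h]
      have h2 := hS.apply_eigenvectorBasis hfr i
      simp only [LinearMap.comp_apply] at h2
      rw [h2, real_inner_comm]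
      simp [inner_smul_left, b]
    rw [this]
    ring
  have h2 : ‖y‖ ^ 2 = ∑ i, inner ℝ (b i) y ^ 2 := by
    rw [← b.sum_sq_norm_inner_right y]
    simp
  rw [hSy, vecNorm_eq_norm]
  refine (abs_le_of_sq_le_sq' ?_ (norm_nonneg _)).2
  rw [mul_pow, h1, h2, Finset.mul_sum]
  exact Finset.sum_le_sum fun i _ => mul_le_mul_of_nonneg_right (hlow i) (sq_nonneg _)

theorem sigmaMin_pos_of_rank (hn : 1 ≤ n) {A : Matrix (Fin m) (Fin n) ℝ} (h : A.rank = n) :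
    0 < sigmaMin A := by
  refine (Matrix.toEuclideanLin A).singularValues_pos_iff_lt_finrank_range.2 ?_
  have he : Matrix.toEuclideanLin A =
      Matrix.toLin (PiLp.basisFun 2 ℝ _) (PiLp.basisFun 2 ℝ _) A :=
    LinearEquiv.congr_fun (Matrix.toLpLin_eq_toLin 2 2) A
  rw [he,
    ← Matrix.rank_eq_finrank_range_toLin A (PiLp.basisFun 2 ℝ _) (PiLp.basisFun 2 ℝ _), h]
  omega

theorem sigmaMin_pos_of_forall (hn : 1 ≤ n) {A : Matrix (Fin m) (Fin n) ℝ} {c : ℝ} (hc : 0 < c)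
    (h : ∀ x, c * vecNorm x ≤ vecNorm (A *ᵥ x)) : 0 < sigmaMin A := by
  have hinj : Function.Injective (Matrix.toEuclideanLin A) := by
    rw [injective_iff_map_eq_zero]
    intro y hy
    have h1 := h (WithLp.ofLp y)
    have h2 : vecNorm (A *ᵥ WithLp.ofLp y) = 0 := by
      have : vecNorm (A *ᵥ WithLp.ofLp y) = ‖Matrix.toEuclideanLin A y‖ := vecNorm_eq_norm _
      rw [this, hy, norm_zero]
    rw [h2, vecNorm_eq_norm] at h1
    have h3 : ‖y‖ ≤ 0 := by
      change c * ‖y‖ ≤ 0 at h1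
      exact nonpos_of_mul_nonpos_right h1 hc
    exact norm_le_zero_iff.1 h3
  exact (Matrix.toEuclideanLin A).injective_iff_forall_lt_finrank_singularValues_pos.1 hinj _
    (by rw [finrank_euclideanSpace_fin]; omega)

end Norms

/-! ### Concentration of the accumulated rounding errors -/

namespace IsRoundingModel

variable {Ω ι : Type*} [MeasurableSpace Ω] {P : Measure Ω} [IsProbabilityMeasure P] {u : ℝ}
  {δ : ι → Ω → ℝ}

theorem hasSubgaussianMGF_const_mul (hδ : IsRoundingModel P u δ) (hu : 0 ≤ u) (a : ι) {c : ℝ}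
    (hc : |c| = 1) : HasSubgaussianMGF (fun ω => c * δ a ω) (u.toNNReal ^ 2) P := by
  have h := hasSubgaussianMGF_of_mem_Icc_of_integral_eq_zero (μ := P) (X := fun ω => c * δ a ω)
    (a := -u) (b := u) ((hδ.measurable a).const_mul c).aemeasurable
    ((hδ.bounded a).mono fun ω hω => by
      rw [Set.mem_Icc, ← abs_le, abs_mul, hc, one_mul]
      exact hω)
    (by rw [integral_const_mul, hδ.mean_zero, mul_zero])
  have he : (‖u - -u‖₊ / 2) ^ 2 = u.toNNReal ^ 2 := by
    congr 1
    ext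
    rw [NNReal.coe_div, coe_nnnorm, Real.norm_eq_abs, Real.coe_toNNReal u hu, NNReal.coe_ofNat,
      abs_of_nonneg (by linarith)]
    ring
  rwa [he] at h

/-- Hoeffding's inequality for a signed sum of at most `N` rounding errors: one error `δ a` and
`±` the sum of a family of others. -/
theorem measureReal_lt_abs_add_sum_le (hδ : IsRoundingModel P u δ) (hu : 0 < u) (a : ι) {K : ℕ}
    {f : Fin K → ι} (hf : Function.Injective f) (hfa : ∀ k, f k ≠ a) (S : Finset (Fin K)) {c : ℝ}
    (hc : |c| = 1) {N : ℕ} (hN : S.card + 1 ≤ N) (lam : ℝ) (hlam : 0 < lam) :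
    P.real {ω | √5 * lam * √(N : ℝ) * u < |δ a ω + c * ∑ k ∈ S, δ (f k) ω|} ≤
      2 * Real.exp (-(5 * lam ^ 2) / 2) := by
  classical
  set s : Finset ι := insert a (S.image f) with hs
  set w : ι → ℝ := fun b => if b = a then 1 else c with hw
  have hw1 : ∀ b, |w b| = 1 := fun b => by
    by_cases hb : b = a <;> simp [hw, hb, hc]
  have hind : iIndepFun (fun b ω => w b * δ b ω) P :=
    hδ.indep.comp (fun b x => w b * x) fun b => measurable_const_mul (w b)
  have hsub := HasSubgaussianMGF.sum_of_iIndepFun hind (s := s)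
    fun b _ => hδ.hasSubgaussianMGF_const_mul hu.le b (hw1 b)
  have hnot : a ∉ S.image f := by
    simp only [Finset.mem_image, not_exists, not_and]
    exact fun k _ => hfa k
  have hsum : ∀ ω, ∑ b ∈ s, w b * δ b ω = δ a ω + c * ∑ k ∈ S, δ (f k) ω := fun ω => by
    rw [hs, Finset.sum_insert hnot, Finset.sum_image hf.injOn, Finset.mul_sum]
    simp [hw, hfa]
  simp only [hsum] at hsub
  have hcard : s.card = S.card + 1 := by
    rw [hs, Finset.card_insert_of_notMem hnot, Finset.card_image_of_injective _ hf]
  have hε : 0 ≤ √5 * lam * √(N : ℝ) * u := by positivity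
  have hNpos : (0 : ℝ) < s.card := by rw [hcard]; positivity
  have hNle : (s.card : ℝ) ≤ N := by rw [hcard]; exact_mod_cast hN
  have hexp : Real.exp (-(√5 * lam * √(N : ℝ) * u) ^ 2 /
      (2 * ((∑ _b ∈ s, u.toNNReal ^ 2 : NNReal) : ℝ))) ≤
      Real.exp (-(5 * lam ^ 2) / 2) := by
    rw [Real.exp_le_exp]
    rw [NNReal.coe_sum, Finset.sum_const, nsmul_eq_mul, NNReal.coe_pow, Real.coe_toNNReal u hu.le,
      mul_pow, mul_pow, mul_pow, Real.sq_sqrt (by norm_num), Real.sq_sqrt (by positivity),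
      div_le_div_iff₀ (by positivity) (by norm_num)]
    have : lam ^ 2 * u ^ 2 * s.card ≤ lam ^ 2 * u ^ 2 * N := by gcongr
    nlinarith
  have h1 := (hsub.measure_ge_le hε).trans hexp
  have h2 := (hsub.neg.measure_ge_le hε).trans hexp
  refine le_trans (measureReal_mono (s₂ := {ω | √5 * lam * √(N : ℝ) * u ≤
    δ a ω + c * ∑ k ∈ S, δ (f k) ω} ∪ {ω | √5 * lam * √(N : ℝ) * u ≤
    (-fun ω => δ a ω + c * ∑ k ∈ S, δ (f k) ω) ω}) ?_) ?_
  · intro ω hω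
    rw [Set.mem_ofPred_eq] at hω
    rcases lt_abs.1 hω with h | h
    · exact Or.inl h.le
    · exact Or.inr h.le
  · refine (measureReal_union_le _ _).trans ?_
    linarith

end IsRoundingModel

/-- The indices `l ≥ k`, `l ≠ 0`: the additions through which the `k`-th term of a computed sum
passes. -/
def addsAfter {m : ℕ} (k : Fin m) : Finset (Fin m) := {l | k ≤ l ∧ l.1 ≠ 0}

theorem card_addsAfter_lt {m : ℕ} (k : Fin m) : (addsAfter k).card + 1 ≤ m := by
  have hm : 0 < m := k.pos
  have h : addsAfter k ⊆ Finset.univ.erase ⟨0, hm⟩ := fun l hl => by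
    have := (Finset.mem_filter.1 hl).2.2
    simp only [Finset.mem_erase, Finset.mem_univ, and_true]
    rintro rfl
    exact this rfl
  have := Finset.card_le_card h
  rw [Finset.card_erase_of_mem (Finset.mem_univ _), Finset.card_univ, Fintype.card_fin] at this
  omega

/-- The rounding errors are at most `u`, and those that accumulate in one term of an inner product
or of a substitution add up, with the sign with which they enter, to at most `b m` (inner products
of columns of length `m`) or `b n` (all other kernels). -/
structure SmallErrorSums {m n : ℕ} (u : ℝ) (b : ℕ → ℝ) (d : FlOp m n → ℝ) : Prop where
  abs_le : ∀ a, |d a| ≤ u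
  gram : ∀ s i j k, |d (.gramMul s i j k) + 1 * ∑ l ∈ addsAfter k, d (.gramAdd s i j l)| ≤ b m
  chol : ∀ s i j k, k < i →
    |d (.cholMul s i j k) + -1 * ∑ l ∈ Finset.Iio k, d (.cholSub s i j l)| ≤ b n
  cholFin : ∀ s i j, |d (.cholFin s i j) + 1 * ∑ l ∈ Finset.Iio i, d (.cholSub s i j l)| ≤ b n
  solve : ∀ s i j k, k < j →
    |d (.solveMul s i j k) + -1 * ∑ l ∈ Finset.Iio k, d (.solveSub s i j l)| ≤ b n
  solveDiv : ∀ s i j, |d (.solveDiv s i j) + 1 * ∑ l ∈ Finset.Iio j, d (.solveSub s i j l)| ≤ b n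
  prod : ∀ w i j k, |d (.prodMul w i j k) + 1 * ∑ l ∈ addsAfter k, d (.prodAdd w i j l)| ≤ b n

/-- Indices of the terms of all the inner products and substitutions of the algorithm. -/
abbrev ErrorIndex (m n : ℕ) : Type :=
  ((Fin 3 × Fin n × Fin n × Fin m) ⊕ (Fin 3 × Fin n × Fin n × Fin n)) ⊕
    ((Fin 3 × Fin m × Fin n × Fin n) ⊕ (Fin 2 × Fin n × Fin n × Fin n))

theorem card_errorIndex (m n : ℕ) :
    Fintype.card (ErrorIndex m n) = 6 * (m * n ^ 2) + 5 * n ^ 3 := by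
  simp only [Fintype.card_sum, Fintype.card_prod, Fintype.card_fin]
  ring

/-- The accumulated error of one term. The last term of a substitution (for which the two inner
indices agree) collects the final division or square root in place of a multiplication. -/
def errorSum {m n : ℕ} (d : FlOp m n → ℝ) : ErrorIndex m n → ℝ
  | .inl (.inl (s, i, j, k)) => d (.gramMul s i j k) + 1 * ∑ l ∈ addsAfter k, d (.gramAdd s i j l)
  | .inl (.inr (s, i, j, k)) =>
    if k = i then d (.cholFin s i j) + 1 * ∑ l ∈ Finset.Iio k, d (.cholSub s i j l)
    else d (.cholMul s i j k) + -1 * ∑ l ∈ Finset.Iio k, d (.cholSub s i j l)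
  | .inr (.inl (s, i, j, k)) =>
    if k = j then d (.solveDiv s i j) + 1 * ∑ l ∈ Finset.Iio k, d (.solveSub s i j l)
    else d (.solveMul s i j k) + -1 * ∑ l ∈ Finset.Iio k, d (.solveSub s i j l)
  | .inr (.inr (w, i, j, k)) =>
    d (.prodMul w i j k) + 1 * ∑ l ∈ addsAfter k, d (.prodAdd w i j l)

/-- The number of rounding errors that an accumulated error can contain. -/
def errorLength {m n : ℕ} : ErrorIndex m n → ℕ
  | .inl (.inl _) => m
  | _ => n

theorem smallErrorSums_of_errorSum {m n : ℕ} {u : ℝ} {b : ℕ → ℝ} {d : FlOp m n → ℝ}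
    (h : ∀ a, |d a| ≤ u) (he : ∀ e : ErrorIndex m n, |errorSum d e| ≤ b (errorLength e)) :
    SmallErrorSums u b d where
  abs_le := h
  gram s i j k := he (.inl (.inl (s, i, j, k)))
  chol s i j k hk := by simpa [errorSum, errorLength, hk.ne] using he (.inl (.inr (s, i, j, k)))
  cholFin s i j := by simpa [errorSum, errorLength] using he (.inl (.inr (s, i, j, i)))
  solve s i j k hk := by simpa [errorSum, errorLength, hk.ne] using he (.inr (.inl (s, i, j, k)))
  solveDiv s i j := by simpa [errorSum, errorLength] using he (.inr (.inl (s, i, j, j)))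
  prod w i j k := he (.inr (.inr (w, i, j, k)))

section Probability

variable {Ω : Type*} [MeasurableSpace Ω] {P : Measure Ω} [IsProbabilityMeasure P]
  {m n : ℕ} {u lam : ℝ} {δ : FlOp m n → Ω → ℝ}

theorem measureReal_lt_abs_errorSum_le (hδ : IsRoundingModel P u δ) (hu : 0 < u) (hlam : 0 < lam)
    (e : ErrorIndex m n) :
    P.real {ω | √5 * lam * √(errorLength e : ℝ) * u < |errorSum (fun a => δ a ω) e|} ≤
      2 * Real.exp (-(5 * lam ^ 2) / 2) := by
  have hcard : ∀ {k : Fin n}, (Finset.Iio k).card + 1 ≤ n := fun {k} => by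
    rw [Fin.card_Iio]
    exact k.2
  rcases e with (⟨s, i, j, k⟩ | ⟨s, i, j, k⟩) | (⟨s, i, j, k⟩ | ⟨w, i, j, k⟩)
  · exact hδ.measureReal_lt_abs_add_sum_le hu (.gramMul s i j k) (f := .gramAdd s i j)
      (fun _ _ h => by injection h) (fun _ h => by injection h) (addsAfter k) (by simp)
      (card_addsAfter_lt k) lam hlam
  · by_cases hk : k = i
    · simp only [errorSum, hk, if_true, errorLength]
      exact hδ.measureReal_lt_abs_add_sum_le hu (.cholFin s i j) (f := .cholSub s i j)
        (fun _ _ h => by injection h) (fun _ h => by injection h) (Finset.Iio i) (by simp)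
        hcard lam hlam
    · simp only [errorSum, hk, if_false, errorLength]
      exact hδ.measureReal_lt_abs_add_sum_le hu (.cholMul s i j k) (f := .cholSub s i j)
        (fun _ _ h => by injection h) (fun _ h => by injection h) (Finset.Iio k) (by simp)
        hcard lam hlam
  · by_cases hk : k = j
    · simp only [errorSum, hk, if_true, errorLength]
      exact hδ.measureReal_lt_abs_add_sum_le hu (.solveDiv s i j) (f := .solveSub s i j)
        (fun _ _ h => by injection h) (fun _ h => by injection h) (Finset.Iio j) (by simp)
        hcard lam hlam
    · simp only [errorSum, hk, if_false, errorLength]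
      exact hδ.measureReal_lt_abs_add_sum_le hu (.solveMul s i j k) (f := .solveSub s i j)
        (fun _ _ h => by injection h) (fun _ h => by injection h) (Finset.Iio k) (by simp)
        hcard lam hlam
  · exact hδ.measureReal_lt_abs_add_sum_le hu (.prodMul w i j k) (f := .prodAdd w i j)
      (fun _ _ h => by injection h) (fun _ h => by injection h) (addsAfter k) (by simp)
      (card_addsAfter_lt k) lam hlam

theorem FlOp.countable (m n : ℕ) : Countable (FlOp m n) := by
  let code : FlOp m n → List ℕ
    | .gramMul s i j k => [0, s, i, j, k]
    | .gramAdd s i j k => [1, s, i, j, k]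
    | .shiftAdd s i => [2, s, i]
    | .cholMul s i j k => [3, s, i, j, k]
    | .cholSub s i j k => [4, s, i, j, k]
    | .cholFin s i j => [5, s, i, j]
    | .solveMul s i j k => [6, s, i, j, k]
    | .solveSub s i j k => [7, s, i, j, k]
    | .solveDiv s i j => [8, s, i, j]
    | .prodMul w i j k => [9, w, i, j, k]
    | .prodAdd w i j k => [10, w, i, j, k]
  refine Function.Injective.countable (f := code) fun a b h => ?_
  cases a <;> cases b <;> simp_all [code, Fin.val_inj]

/-- A set that contains the event of small accumulated errors is missed with probability at most
`11 m n² · 2 exp(-5 lam² / 2)`. -/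
theorem one_sub_le_measureReal_of_smallErrorSums (hδ : IsRoundingModel P u δ) (hu : 0 < u)
    (hlam : 0 < lam) (hmn : n ≤ m) {A : Set Ω}
    (hA : ∀ ω, SmallErrorSums u (fun N => √5 * lam * √(N : ℝ) * u) (fun a => δ a ω) → ω ∈ A) :
    1 - 11 * (m * n ^ 2) * (2 * Real.exp (-(5 * lam ^ 2) / 2)) ≤ P.real A := by
  have := FlOp.countable m n
  set bad : ErrorIndex m n → Set Ω := fun e =>
    {ω | √5 * lam * √(errorLength e : ℝ) * u < |errorSum (fun a => δ a ω) e|}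
  have hnull : P.real {ω | ¬ ∀ a, |δ a ω| ≤ u} = 0 := by
    rw [measureReal_def, ae_iff.1 (ae_all_iff.2 hδ.bounded), ENNReal.toReal_zero]
  have hbad : P.real (⋃ e, bad e) ≤ 11 * (m * n ^ 2) * (2 * Real.exp (-(5 * lam ^ 2) / 2)) :=
    calc P.real (⋃ e, bad e) ≤ ∑ e, P.real (bad e) := measureReal_iUnion_fintype_le _
      _ ≤ ∑ _e : ErrorIndex m n, 2 * Real.exp (-(5 * lam ^ 2) / 2) :=
        Finset.sum_le_sum fun e _ => measureReal_lt_abs_errorSum_le hδ hu hlam e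
      _ = (6 * (m * n ^ 2) + 5 * n ^ 3 : ℕ) * (2 * Real.exp (-(5 * lam ^ 2) / 2)) := by
        rw [Finset.sum_const, Finset.card_univ, card_errorIndex, nsmul_eq_mul]
      _ ≤ _ := by
        refine mul_le_mul_of_nonneg_right ?_ (by positivity)
        have h : n ^ 3 ≤ m * n ^ 2 := by
          rw [pow_succ, mul_comm]
          exact Nat.mul_le_mul_right _ hmn
        exact_mod_cast (by omega : 6 * (m * n ^ 2) + 5 * n ^ 3 ≤ 11 * (m * n ^ 2))
  have hcover : (Set.univ : Set Ω) ⊆ A ∪ ({ω | ¬ ∀ a, |δ a ω| ≤ u} ∪ ⋃ e, bad e) := by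
    intro ω _
    by_cases h1 : ∀ a, |δ a ω| ≤ u
    · by_cases h2 : ω ∈ ⋃ e, bad e
      · exact Or.inr (Or.inr h2)
      · refine Or.inl (hA ω (smallErrorSums_of_errorSum h1 fun e => ?_))
        simp only [Set.mem_iUnion, not_exists, bad, Set.mem_ofPred_eq, not_lt] at h2
        exact h2 e
    · exact Or.inr (Or.inl h1)
  have h := measureReal_mono (μ := P) hcover
  have h1 := measureReal_union_le (μ := P) A ({ω | ¬ ∀ a, |δ a ω| ≤ u} ∪ ⋃ e, bad e)
  have h2 := measureReal_union_le (μ := P) {ω | ¬ ∀ a, |δ a ω| ≤ u} (⋃ e, bad e)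
  rw [probReal_univ] at h
  linarith

end Probability

theorem probQ_eq (u lam N : ℝ) :
    probQ u lam N = 1 - N * (2 * Real.exp (-(lam ^ 2 * (1 - u) ^ 2) / 2)) := by
  simp [probQ, probP]

theorem probQ_le_one (u lam : ℝ) {N : ℝ} (hN : 0 ≤ N) : probQ u lam N ≤ 1 := by
  rw [probQ_eq]
  have : 0 ≤ N * (2 * Real.exp (-(lam ^ 2 * (1 - u) ^ 2) / 2)) := by positivity
  linarith

theorem probQ_antitone (u lam : ℝ) : Antitone (probQ u lam) := fun a b h => by
  rw [probQ_eq, probQ_eq]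
  have : a * (2 * Real.exp (-(lam ^ 2 * (1 - u) ^ 2) / 2)) ≤
    b * (2 * Real.exp (-(lam ^ 2 * (1 - u) ^ 2) / 2)) := by gcongr
  linarith

theorem two_lt_exp_of_probQ_pos {u lam N : ℝ} (hN : 1 ≤ N) (hu0 : 0 ≤ u) (hu1 : u ≤ 1)
    (h : 0 < probQ u lam N) : 2 < Real.exp (lam ^ 2 / 2) := by
  rw [probQ_eq] at h
  set e := Real.exp (-(lam ^ 2 * (1 - u) ^ 2) / 2)
  have he : Real.exp (-(lam ^ 2 / 2)) ≤ e := by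
    refine Real.exp_le_exp.2 ?_
    have h1 : (1 - u) ^ 2 ≤ 1 := by nlinarith
    have h2 : lam ^ 2 * (1 - u) ^ 2 ≤ lam ^ 2 * 1 := by gcongr
    linarith
  have h1 : 2 * Real.exp (-(lam ^ 2 / 2)) < 1 := by
    have h2 : 1 * (2 * e) ≤ N * (2 * e) := by gcongr
    linarith
  rw [Real.exp_neg, ← div_eq_mul_inv, div_lt_one (Real.exp_pos _)] at h1
  exact h1

theorem one_le_of_probQ_pos {u lam N : ℝ} (hlam : 0 < lam) (hN : 1 ≤ N) (hu0 : 0 ≤ u) (hu1 : u ≤ 1)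
    (h : 0 < probQ u lam N) : 1 ≤ lam := by
  by_contra! hl
  have h1 := two_lt_exp_of_probQ_pos hN hu0 hu1 h
  have h2 : Real.exp (lam ^ 2 / 2) ≤ Real.exp (1 / 2) := Real.exp_le_exp.2 (by nlinarith)
  have h3 : Real.exp (1 / 2) ^ 2 = Real.exp 1 := by rw [← Real.exp_nat_mul]; norm_num
  nlinarith [Real.exp_one_lt_d9, Real.exp_pos (1 / 2)]

/-- The union bound over all accumulated errors beats the product of the individual
probabilities, already on account of its factor `Q(lam, m n²)`. -/
theorem probQ_prod_le {m n : ℕ} (hn : 1 ≤ n) (hmn : n ≤ m) {u lam : ℝ} (hu0 : 0 ≤ u)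
    (hu1 : u ≤ 1) (h : 0 < probQ u lam (m * n ^ 2)) :
    (probQ u lam (m * n ^ 2) * probQ u lam (n ^ 3 / 6 + n ^ 2 / 2 + n / 3) *
        probQ u lam (n * (n + 1) / 2)) ^ 3 * probQ u lam (n ^ 3) ^ 2 ≤
      1 - 11 * (m * n ^ 2) * (2 * Real.exp (-(5 * lam ^ 2) / 2)) := by
  have hn' : (1 : ℝ) ≤ n := by exact_mod_cast hn
  have hmn' : (n : ℝ) ≤ m := by exact_mod_cast hmn
  have hn2 : (n : ℝ) ≤ n ^ 2 := by nlinarith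
  have hn3 : (n : ℝ) ^ 2 ≤ n ^ 3 := by nlinarith
  have hN3 : (n : ℝ) ^ 3 ≤ m * n ^ 2 := by nlinarith [sq_nonneg (n : ℝ)]
  have hN : (1 : ℝ) ≤ m * n ^ 2 := by nlinarith
  have hpos : ∀ {N : ℝ}, N ≤ m * n ^ 2 → 0 ≤ probQ u lam N := fun hN =>
    h.le.trans (probQ_antitone u lam hN)
  have b1 := hpos (N := n ^ 3 / 6 + n ^ 2 / 2 + n / 3) (by linarith)
  have b2 := hpos (N := n * (n + 1) / 2) (by nlinarith)
  have b3 := hpos (N := n ^ 3) hN3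
  have c0 := probQ_le_one u lam (N := m * n ^ 2) (by positivity)
  have c1 := probQ_le_one u lam (N := n ^ 3 / 6 + n ^ 2 / 2 + n / 3) (by positivity)
  have c2 := probQ_le_one u lam (N := n * (n + 1) / 2) (by positivity)
  have c3 := probQ_le_one u lam (N := n ^ 3) (by positivity)
  set q0 := probQ u lam (m * n ^ 2) with hq0
  set q1 := probQ u lam (n ^ 3 / 6 + n ^ 2 / 2 + n / 3)
  set q2 := probQ u lam (n * (n + 1) / 2)
  set q3 := probQ u lam (n ^ 3)
  have hprod : (q0 * q1 * q2) ^ 3 * q3 ^ 2 ≤ q0 := by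
    have e1 : q0 * q1 * q2 ≤ q0 :=
      mul_le_of_le_one_right (by positivity) c2 |>.trans (mul_le_of_le_one_right h.le c1)
    have e2 : (q0 * q1 * q2) ^ 3 ≤ q0 * q1 * q2 :=
      pow_le_of_le_one (by positivity) (e1.trans c0) (by norm_num)
    exact (mul_le_of_le_one_right (by positivity) (pow_le_one₀ b3 c3)).trans (e2.trans e1)
  refine hprod.trans ?_
  rw [hq0, probQ_eq]
  set x := Real.exp (-(lam ^ 2 / 2)) with hx
  have hx2 : x < 1 / 2 := by
    rw [hx, Real.exp_neg, one_div]
    exact inv_strictAnti₀ (by norm_num) (two_lt_exp_of_probQ_pos hN hu0 hu1 h)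
  have hx0 : 0 < x := Real.exp_pos _
  have he5 : Real.exp (-(5 * lam ^ 2) / 2) = x ^ 5 := by
    rw [hx, ← Real.exp_nat_mul]
    congr 1
    push_cast
    ring
  have hx1 : x ≤ Real.exp (-(lam ^ 2 * (1 - u) ^ 2) / 2) := by
    refine Real.exp_le_exp.2 ?_
    have h1 : (1 - u) ^ 2 ≤ 1 := by nlinarith
    have h2 : lam ^ 2 * (1 - u) ^ 2 ≤ lam ^ 2 * 1 := by gcongr
    linarith
  have hx5 : 11 * x ^ 5 ≤ x := by
    have : x ^ 4 ≤ (1 / 2) ^ 4 := pow_le_pow_left₀ hx0.le hx2.le 4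
    nlinarith
  rw [he5]
  have : (m : ℝ) * n ^ 2 * (2 * (11 * x ^ 5)) ≤
      m * n ^ 2 * (2 * Real.exp (-(lam ^ 2 * (1 - u) ^ 2) / 2)) := by
    gcongr
    exact hx5.trans hx1
  linarith

/-! ### Relative errors of products of rounding factors -/

theorem abs_log_one_add_sub_le {t : ℝ} (ht : |t| ≤ 1 / 2) : |Real.log (1 + t) - t| ≤ 2 * t ^ 2 := by
  obtain ⟨h1, h2⟩ := abs_le.1 ht
  have hpos : 0 < 1 + t := by linarith
  have hup := Real.log_le_sub_one_of_pos hpos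
  have hlo := Real.one_sub_inv_le_log_of_pos hpos
  have : t - 2 * t ^ 2 ≤ 1 - (1 + t)⁻¹ := by
    rw [show 1 - (1 + t)⁻¹ = t / (1 + t) by field_simp; ring, le_div_iff₀ hpos]
    nlinarith [mul_nonneg (sq_nonneg t) (by linarith : 0 ≤ 1 + 2 * t)]
  rw [abs_le]
  constructor <;> nlinarith [sq_nonneg t]

theorem abs_exp_sub_one_le_of_le {y z : ℝ} (hy : |y| ≤ z) (hz : z ≤ 1) :
    |Real.exp y - 1| ≤ z + z ^ 2 := by
  have h := Real.abs_exp_sub_one_sub_id_le (hy.trans hz)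
  have h1 : y ^ 2 ≤ z ^ 2 := by
    rw [← sq_abs]
    exact pow_le_pow_left₀ (abs_nonneg _) hy 2
  calc |Real.exp y - 1| = |(Real.exp y - 1 - y) + y| := by ring_nf
    _ ≤ |Real.exp y - 1 - y| + |y| := abs_add_le _ _
    _ ≤ z + z ^ 2 := by linarith

section Products

variable {K : ℕ} {u x z : ℝ} {a : ℝ} {η : Fin K → ℝ} {S : Finset (Fin K)}

theorem abs_log_add_sum_log_le (hu : u ≤ 1 / 2) (ha : |a| ≤ u) (hη : ∀ l, |η l| ≤ u)
    {c : ℝ} (hc : |c| = 1) (hx : |a + c * ∑ l ∈ S, η l| ≤ x) :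
    |Real.log (1 + a) + c * ∑ l ∈ S, Real.log (1 + η l)| ≤ x + (S.card + 1 : ℕ) * (2 * u ^ 2) := by
  have hb : ∀ {t : ℝ}, |t| ≤ u → |Real.log (1 + t) - t| ≤ 2 * u ^ 2 := fun {t} ht => by
    refine (abs_log_one_add_sub_le (ht.trans hu)).trans ?_
    rw [← sq_abs]
    exact mul_le_mul_of_nonneg_left (pow_le_pow_left₀ (abs_nonneg _) ht 2) (by norm_num)
  have h1 : |c * ∑ l ∈ S, (Real.log (1 + η l) - η l)| ≤ S.card * (2 * u ^ 2) := by
    rw [abs_mul, hc, one_mul]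
    refine (Finset.abs_sum_le_sum_abs _ _).trans ?_
    refine (Finset.sum_le_sum fun l _ => hb (hη l)).trans ?_
    rw [Finset.sum_const, nsmul_eq_mul]
  calc |Real.log (1 + a) + c * ∑ l ∈ S, Real.log (1 + η l)|
      = |(a + c * ∑ l ∈ S, η l) + ((Real.log (1 + a) - a) +
          c * ∑ l ∈ S, (Real.log (1 + η l) - η l))| := by
        rw [Finset.sum_sub_distrib]; ring_nf
    _ ≤ |a + c * ∑ l ∈ S, η l| + (|Real.log (1 + a) - a| +
          |c * ∑ l ∈ S, (Real.log (1 + η l) - η l)|) :=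
        (abs_add_le _ _).trans (add_le_add_right (abs_add_le _ _) _)
    _ ≤ x + (S.card + 1 : ℕ) * (2 * u ^ 2) := by
        have := hb ha
        push_cast
        linarith

theorem one_add_pos_of_abs_le (hu : u ≤ 1 / 2) {t : ℝ} (ht : |t| ≤ u) : 0 < 1 + t := by
  have := (abs_le.1 (ht.trans hu)).1
  linarith

theorem abs_mul_prod_sub_one_le (hu : u ≤ 1 / 2) (ha : |a| ≤ u) (hη : ∀ l, |η l| ≤ u)
    (hx : |a + 1 * ∑ l ∈ S, η l| ≤ x) (hz : x + (S.card + 1 : ℕ) * (2 * u ^ 2) ≤ z) (hz1 : z ≤ 1) :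
    |(1 + a) * ∏ l ∈ S, (1 + η l) - 1| ≤ z + z ^ 2 := by
  have h := (abs_log_add_sum_log_le hu ha hη (abs_one) hx).trans hz
  have he : (1 + a) * ∏ l ∈ S, (1 + η l) =
      Real.exp (Real.log (1 + a) + 1 * ∑ l ∈ S, Real.log (1 + η l)) := by
    rw [one_mul, Real.exp_add, Real.exp_log (one_add_pos_of_abs_le hu ha), Real.exp_sum]
    congr 1
    exact Finset.prod_congr rfl fun l _ => (Real.exp_log (one_add_pos_of_abs_le hu (hη l))).symm
  rw [he]
  exact abs_exp_sub_one_le_of_le h hz1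

theorem abs_inv_mul_prod_sub_one_le (hu : u ≤ 1 / 2) (ha : |a| ≤ u) (hη : ∀ l, |η l| ≤ u)
    (hx : |a + 1 * ∑ l ∈ S, η l| ≤ x) (hz : x + (S.card + 1 : ℕ) * (2 * u ^ 2) ≤ z) (hz1 : z ≤ 1) :
    |((1 + a) * ∏ l ∈ S, (1 + η l))⁻¹ - 1| ≤ z + z ^ 2 := by
  have h := (abs_log_add_sum_log_le hu ha hη (abs_one) hx).trans hz
  have he : ((1 + a) * ∏ l ∈ S, (1 + η l))⁻¹ =
      Real.exp (-(Real.log (1 + a) + 1 * ∑ l ∈ S, Real.log (1 + η l))) := by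
    rw [Real.exp_neg, one_mul, Real.exp_add, Real.exp_log (one_add_pos_of_abs_le hu ha),
      Real.exp_sum]
    congr 2
    exact Finset.prod_congr rfl fun l _ => (Real.exp_log (one_add_pos_of_abs_le hu (hη l))).symm
  rw [he]
  exact abs_exp_sub_one_le_of_le (by rwa [abs_neg]) hz1

theorem abs_mul_prod_inv_sub_one_le (hu : u ≤ 1 / 2) (ha : |a| ≤ u) (hη : ∀ l, |η l| ≤ u)
    (hx : |a + -1 * ∑ l ∈ S, η l| ≤ x) (hz : x + (S.card + 1 : ℕ) * (2 * u ^ 2) ≤ z) (hz1 : z ≤ 1) :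
    |(1 + a) * ∏ l ∈ S, (1 + η l)⁻¹ - 1| ≤ z + z ^ 2 := by
  have h := (abs_log_add_sum_log_le hu ha hη (by simp) hx).trans hz
  have he : (1 + a) * ∏ l ∈ S, (1 + η l)⁻¹ =
      Real.exp (Real.log (1 + a) + -1 * ∑ l ∈ S, Real.log (1 + η l)) := by
    rw [Real.exp_add, Real.exp_log (one_add_pos_of_abs_le hu ha), neg_one_mul,
      ← Finset.sum_neg_distrib, Real.exp_sum]
    congr 1
    refine Finset.prod_congr rfl fun l _ => ?_
    rw [Real.exp_neg, Real.exp_log (one_add_pos_of_abs_le hu (hη l))]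
  rw [he]
  exact abs_exp_sub_one_le_of_le h hz1

end Products

/-- The factors by which the rounding errors change the terms of the inner products (bound `gm`)
and of the other kernels (bound `gn`) are close to `1`. -/
structure SmallRelErrors {m n : ℕ} (u gm gn : ℝ) (d : FlOp m n → ℝ) : Prop where
  abs_le : ∀ a, |d a| ≤ u
  gram : ∀ s i j k,
    |(1 + d (.gramMul s i j k)) * ∏ l ∈ addsAfter k, (1 + d (.gramAdd s i j l)) - 1| ≤ gm
  chol : ∀ s i j k, k < i →
    |(1 + d (.cholMul s i j k)) * ∏ l ∈ Finset.Iio k, (1 + d (.cholSub s i j l))⁻¹ - 1| ≤ gn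
  cholFin : ∀ s i j,
    |((1 + d (.cholFin s i j)) * ∏ l ∈ Finset.Iio i, (1 + d (.cholSub s i j l)))⁻¹ - 1| ≤ gn
  solve : ∀ s i j k, k < j →
    |(1 + d (.solveMul s i j k)) * ∏ l ∈ Finset.Iio k, (1 + d (.solveSub s i j l))⁻¹ - 1| ≤ gn
  solveDiv : ∀ s i j,
    |((1 + d (.solveDiv s i j)) * ∏ l ∈ Finset.Iio j, (1 + d (.solveSub s i j l)))⁻¹ - 1| ≤ gn
  prod : ∀ w i j k,
    |(1 + d (.prodMul w i j k)) * ∏ l ∈ addsAfter k, (1 + d (.prodAdd w i j l)) - 1| ≤ gn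

theorem SmallErrorSums.smallRelErrors {m n : ℕ} {u lam : ℝ} {d : FlOp m n → ℝ}
    (h : SmallErrorSums u (fun N => √5 * lam * √(N : ℝ) * u) d) (hu : 0 ≤ u) (hlam : 1 ≤ lam)
    (hm : lam * √(m : ℝ) * u ≤ 1 / 2200) (hn : lam * √(n : ℝ) * u ≤ 1 / 2200) (hu2 : u ≤ 1 / 2) :
    SmallRelErrors u (2.24 * lam * √(m : ℝ) * u) (2.24 * lam * √(n : ℝ) * u) d := by
  have h5 : √5 ≤ 2.2361 := by
    rw [Real.sqrt_le_left (by norm_num)]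
    norm_num
  -- the quadratic terms in the logarithm and the exponential turn `√5` into `2.24`
  have key : ∀ N : ℕ, lam * √(N : ℝ) * u ≤ 1 / 2200 → ∃ z,
      (∀ c : ℕ, c + 1 ≤ N → √5 * lam * √(N : ℝ) * u + (c + 1 : ℕ) * (2 * u ^ 2) ≤ z) ∧ z ≤ 1 ∧
        z + z ^ 2 ≤ 2.24 * lam * √(N : ℝ) * u := fun N hN => by
    have ht0 : 0 ≤ lam * √(N : ℝ) * u := by positivity
    have h1 : √(N : ℝ) * u ≤ lam * √(N : ℝ) * u := by
      rw [mul_assoc]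
      exact le_mul_of_one_le_left (by positivity) hlam
    have h2 : (N : ℝ) * u ^ 2 ≤ lam * √(N : ℝ) * u * (1 / 2200) := by
      calc (N : ℝ) * u ^ 2 = (√(N : ℝ) * u) * (√(N : ℝ) * u) := by
            rw [mul_mul_mul_comm, Real.mul_self_sqrt (Nat.cast_nonneg N)]; ring
        _ ≤ (lam * √(N : ℝ) * u) * (1 / 2200) := by
            gcongr
            exact h1.trans hN
    have h3 : √5 * (lam * √(N : ℝ) * u) ≤ 2.2361 * (lam * √(N : ℝ) * u) := by gcongr
    set t := lam * √(N : ℝ) * u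
    refine ⟨2.2371 * t, fun c hc => ?_, by linarith, by nlinarith⟩
    have hc' : ((c + 1 : ℕ) : ℝ) ≤ N := by exact_mod_cast hc
    have h4 : ((c + 1 : ℕ) : ℝ) * (2 * u ^ 2) ≤ N * (2 * u ^ 2) := by gcongr
    rw [show √5 * lam * √(N : ℝ) * u = √5 * t by simp only [t]; ring]
    linarith
  obtain ⟨zm, hzm, hzm1, hzm2⟩ := key m hm
  obtain ⟨zn, hzn, hzn1, hzn2⟩ := key n hn
  have hcard : ∀ {k : Fin n}, (Finset.Iio k).card + 1 ≤ n := fun {k} => by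
    rw [Fin.card_Iio]
    exact k.2
  have ha := h.abs_le
  exact
    { abs_le := ha
      gram := fun s i j k => (abs_mul_prod_sub_one_le hu2 (ha _) (fun _ => ha _) (h.gram s i j k)
        (hzm _ (card_addsAfter_lt k)) hzm1).trans hzm2
      chol := fun s i j k hk => (abs_mul_prod_inv_sub_one_le hu2 (ha _) (fun _ => ha _)
        (h.chol s i j k hk) (hzn _ hcard) hzn1).trans hzn2
      cholFin := fun s i j => (abs_inv_mul_prod_sub_one_le hu2 (ha _) (fun _ => ha _)
        (h.cholFin s i j) (hzn _ hcard) hzn1).trans hzn2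
      solve := fun s i j k hk => (abs_mul_prod_inv_sub_one_le hu2 (ha _) (fun _ => ha _)
        (h.solve s i j k hk) (hzn _ hcard) hzn1).trans hzn2
      solveDiv := fun s i j => (abs_inv_mul_prod_sub_one_le hu2 (ha _) (fun _ => ha _)
        (h.solveDiv s i j) (hzn _ hcard) hzn1).trans hzn2
      prod := fun w i j k => (abs_mul_prod_sub_one_le hu2 (ha _) (fun _ => ha _)
        (h.prod w i j k) (hzn _ (card_addsAfter_lt k)) hzn1).trans hzn2 }

/-! ### Backward error of the computed kernels -/

theorem flSum_eq : ∀ (m : ℕ) (t η : Fin m → ℝ),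
    flSum m t η = ∑ k, t k * ∏ l ∈ addsAfter k, (1 + η l)
  | 0, _, _ => by simp [flSum]
  | 1, t, η => by simp [flSum, addsAfter]
  | m + 2, t, η => by
    rw [flSum, flSum_eq (m + 1), Fin.sum_univ_castSucc (n := m + 1), add_mul, Finset.sum_mul]
    congr 1
    · refine Finset.sum_congr rfl fun k _ => ?_
      simp only [addsAfter, Finset.prod_filter]
      rw [Fin.prod_univ_castSucc (n := m + 1)]
      simp [mul_assoc, Fin.le_last]
    · simp only [addsAfter, Finset.prod_filter]
      rw [Fin.prod_univ_castSucc (n := m + 1)]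
      have : ∀ k : Fin (m + 1), ¬ Fin.last (m + 1) ≤ k.castSucc := fun k =>
        not_le.2 (Fin.castSucc_lt_last k)
      simp [this]

theorem flSub_mul_prod_inv (c : ℝ) : ∀ (m : ℕ) (t η : Fin m → ℝ), (∀ l, 1 + η l ≠ 0) →
    flSub c m t η * ∏ l, (1 + η l)⁻¹ = c - ∑ k, t k * ∏ l ∈ Finset.Iio k, (1 + η l)⁻¹
  | 0, _, _, _ => by simp [flSub]
  | m + 1, t, η, h => by
    have ih := flSub_mul_prod_inv c m (fun k => t k.castSucc) (fun k => η k.castSucc) fun _ => h _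
    have hIio : ∀ (k : Fin (m + 1)), ∏ l ∈ Finset.Iio k, (1 + η l)⁻¹ =
        ∏ l : Fin (m + 1), if l < k then (1 + η l)⁻¹ else 1 := fun k => by
      rw [← Finset.prod_filter]
      congr 1
      ext
      simp
    have hIio' : ∀ (k : Fin m), ∏ l ∈ Finset.Iio k, (1 + η l.castSucc)⁻¹ =
        ∏ l : Fin m, if l < k then (1 + η l.castSucc)⁻¹ else 1 := fun k => by
      rw [← Finset.prod_filter]
      congr 1
      ext
      simp
    have h1 : ∀ k : Fin m, ∏ l ∈ Finset.Iio k.castSucc, (1 + η l)⁻¹ =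
        ∏ l ∈ Finset.Iio k, (1 + η l.castSucc)⁻¹ := fun k => by
      rw [hIio, hIio', Fin.prod_univ_castSucc]
      have : ¬ Fin.last m < k.castSucc := not_lt.2 (Fin.le_last _)
      simp [this]
    have h2 : ∏ l ∈ Finset.Iio (Fin.last m), (1 + η l)⁻¹ = ∏ l : Fin m, (1 + η l.castSucc)⁻¹ := by
      rw [hIio, Fin.prod_univ_castSucc]
      simp [Fin.castSucc_lt_last]
    rw [flSub, Fin.prod_univ_castSucc, Fin.sum_univ_castSucc, h2]
    simp only [h1]
    rw [← sub_sub, ← ih]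
    have h0 := h (Fin.last m)
    field_simp

theorem sum_castLE {n : ℕ} (i : Fin n) (f : Fin n → ℝ) :
    ∑ k : Fin i.1, f (k.castLE i.2.le) = ∑ k ∈ Finset.Iio i, f k := by
  refine Finset.sum_bij (fun k _ => k.castLE i.2.le) (fun k _ => ?_) (fun a _ b _ h => ?_)
    (fun k hk => ?_) (fun _ _ => rfl)
  · simp [Fin.lt_def]
  · exact Fin.castLE_injective _ h
  · exact ⟨⟨k.1, Fin.lt_def.1 (Finset.mem_Iio.1 hk)⟩, Finset.mem_univ _, rfl⟩

theorem prod_castLE {n : ℕ} (i : Fin n) (f : Fin n → ℝ) :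
    ∏ k : Fin i.1, f (k.castLE i.2.le) = ∏ k ∈ Finset.Iio i, f k := by
  refine Finset.prod_bij (fun k _ => k.castLE i.2.le) (fun k _ => ?_) (fun a _ b _ h => ?_)
    (fun k hk => ?_) (fun _ _ => rfl)
  · simp [Fin.lt_def]
  · exact Fin.castLE_injective _ h
  · exact ⟨⟨k.1, Fin.lt_def.1 (Finset.mem_Iio.1 hk)⟩, Finset.mem_univ _, rfl⟩

theorem prod_Iio_castLE {n : ℕ} (i : Fin n) (k : Fin i.1) (f : Fin n → ℝ) :
    ∏ l ∈ Finset.Iio k, f (l.castLE i.2.le) = ∏ l ∈ Finset.Iio (k.castLE i.2.le), f l := by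
  refine Finset.prod_bij (fun k _ => k.castLE i.2.le) (fun l hl => ?_) (fun a _ b _ h => ?_)
    (fun l hl => ?_) (fun _ _ => rfl)
  · have hlk : l < k := Finset.mem_Iio.1 hl
    exact Finset.mem_Iio.2 hlk
  · exact Fin.castLE_injective _ h
  · have := Fin.lt_def.1 (Finset.mem_Iio.1 hl)
    exact ⟨⟨l.1, this.trans k.2⟩, Finset.mem_Iio.2 (Fin.lt_def.2 this), rfl⟩

theorem flSub_castLE_mul_prod_inv {n : ℕ} (c : ℝ) (i : Fin n) (t η : Fin n → ℝ)
    (h : ∀ l, 1 + η l ≠ 0) :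
    flSub c i.1 (fun k => t (k.castLE i.2.le)) (fun k => η (k.castLE i.2.le)) *
        ∏ l ∈ Finset.Iio i, (1 + η l)⁻¹ =
      c - ∑ k ∈ Finset.Iio i, t k * ∏ l ∈ Finset.Iio k, (1 + η l)⁻¹ := by
  have := flSub_mul_prod_inv c i.1 (fun k => t (k.castLE i.2.le)) (fun k => η (k.castLE i.2.le))
    fun _ => h _
  rw [prod_castLE i fun l => (1 + η l)⁻¹] at this
  rw [this, ← sum_castLE i]
  congr 1
  exact Finset.sum_congr rfl fun k _ => by rw [prod_Iio_castLE i k fun l => (1 + η l)⁻¹]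

theorem abs_sum_mul_sub_le {ι : Type*} (S : Finset ι) (x y : ι → ℝ) {w : ι → ℝ} {g : ℝ}
    (h : ∀ k ∈ S, |w k - 1| ≤ g) :
    |∑ k ∈ S, x k * y k * w k - ∑ k ∈ S, x k * y k| ≤ g * ∑ k ∈ S, |x k| * |y k| := by
  rw [← Finset.sum_sub_distrib, Finset.mul_sum]
  refine (Finset.abs_sum_le_sum_abs _ _).trans (Finset.sum_le_sum fun k hk => ?_)
  rw [← mul_sub_one, abs_mul, abs_mul, mul_comm]
  exact mul_le_mul_of_nonneg_right (h k hk) (by positivity)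

section Kernels

variable {m n : ℕ} {u gm gn : ℝ} {d : FlOp m n → ℝ}

theorem abs_flGram_sub_le (h : SmallRelErrors u gm gn d) (s : Fin 3) (X : Matrix (Fin m) (Fin n) ℝ)
    (i j : Fin n) :
    |flGram d s X i j - (Xᵀ * X) i j| ≤ gm * ∑ k, |X k i| * |X k j| := by
  have := abs_sum_mul_sub_le Finset.univ (fun k => X k i) (fun k => X k j)
    fun k _ => h.gram s i j k
  simpa only [flGram, Matrix.of_apply, flSum_eq, Matrix.mul_apply, Matrix.transpose_apply,
    mul_assoc] using this

theorem abs_flMul_sub_le (h : SmallRelErrors u gm gn d) (w : Fin 2) (A B : Matrix (Fin n) (Fin n) ℝ)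
    (i j : Fin n) :
    |(flMul d w A B - A * B) i j| ≤ gn * ∑ k, |A i k| * |B k j| := by
  have := abs_sum_mul_sub_le Finset.univ (fun k => A i k) (fun k => B k j)
    fun k _ => h.prod w i j k
  simpa only [flMul, Matrix.sub_apply, Matrix.of_apply, flSum_eq, Matrix.mul_apply,
    mul_assoc] using this

end Kernels

/-! ### Positivity of Cholesky pivots -/

section Pivot

variable {n : ℕ}

theorem dotProduct_transpose_mul_self_mulVec {m : ℕ} (W : Matrix (Fin m) (Fin n) ℝ)
    (x : Fin n → ℝ) : x ⬝ᵥ ((Wᵀ * W) *ᵥ x) = vecNorm (W *ᵥ x) ^ 2 := by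
  rw [vecNorm_sq_eq_dotProduct, ← Matrix.mulVec_mulVec, Matrix.dotProduct_mulVec,
    Matrix.vecMul_transpose]

theorem dotProduct_mulVec_eq_sum (M : Matrix (Fin n) (Fin n) ℝ) (x : Fin n → ℝ) :
    x ⬝ᵥ (M *ᵥ x) = ∑ a, ∑ b, x a * x b * M a b := by
  simp only [dotProduct, Matrix.mulVec, Finset.mul_sum]
  exact Finset.sum_congr rfl fun a _ => Finset.sum_congr rfl fun b _ => by ring

theorem dotProduct_mulVec_le {M W : Matrix (Fin n) (Fin n) ℝ} {x : Fin n → ℝ} {g : ℝ} (hg : 0 ≤ g)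
    (h : ∀ a b, x a ≠ 0 → x b ≠ 0 → |M a b| ≤ g * ∑ k, |W k a| * |W k b|) :
    x ⬝ᵥ (M *ᵥ x) ≤ g * n * ∑ a, x a ^ 2 * ∑ k, W k a ^ 2 := by
  have h1 : x ⬝ᵥ (M *ᵥ x) ≤ ∑ a, ∑ b, g * ∑ k, (|x a| * |W k a|) * (|x b| * |W k b|) := by
    rw [dotProduct_mulVec_eq_sum]
    refine Finset.sum_le_sum fun a _ => Finset.sum_le_sum fun b _ => ?_
    by_cases hab : x a ≠ 0 ∧ x b ≠ 0
    · calc x a * x b * M a b ≤ |x a * x b * M a b| := le_abs_self _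
        _ = |x a| * |x b| * |M a b| := by rw [abs_mul, abs_mul]
        _ ≤ |x a| * |x b| * (g * ∑ k, |W k a| * |W k b|) :=
          mul_le_mul_of_nonneg_left (h a b hab.1 hab.2) (by positivity)
        _ = _ := by
          rw [Finset.mul_sum, Finset.mul_sum, Finset.mul_sum]
          exact Finset.sum_congr rfl fun k _ => by ring
    · have h0 : x a * x b * M a b = 0 := by
        rcases not_and_or.1 hab with h0 | h0 <;> simp [not_not.1 h0]
      rw [h0]
      positivity
  have h2 : ∑ a, ∑ b, g * ∑ k, (|x a| * |W k a|) * (|x b| * |W k b|) =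
      g * ∑ k, (∑ a, |x a| * |W k a|) ^ 2 := by
    simp only [sq, Finset.mul_sum, Finset.sum_mul]
    conv_lhs => rw [Finset.sum_comm]
    conv_rhs => rw [Finset.sum_comm]
    refine Finset.sum_congr rfl fun a _ => ?_
    conv_rhs => rw [Finset.sum_comm]
  have h3 : ∀ k, (∑ a, |x a| * |W k a|) ^ 2 ≤ n * ∑ a, x a ^ 2 * W k a ^ 2 := fun k => by
    have := sq_sum_le_card_mul_sum_sq (s := Finset.univ) (f := fun a => |x a| * |W k a|)
    simpa [mul_pow] using this
  refine h1.trans (h2.le.trans ?_)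
  rw [mul_assoc]
  refine mul_le_mul_of_nonneg_left ?_ hg
  refine (Finset.sum_le_sum fun k _ => h3 k).trans (le_of_eq ?_)
  rw [← Finset.mul_sum, Finset.sum_comm]
  simp only [Finset.mul_sum]

/-- An upper triangular matrix with nonzero diagonal in the rows above `i` and zero rows from `i` on
annihilates a vector that is `1` at `i` and vanishes after `i`. -/
theorem exists_mulVec_eq_zero {W : Matrix (Fin n) (Fin n) ℝ} {i : Fin n}
    (htri : ∀ k j, j < k → W k j = 0) (hdiag : ∀ k < i, W k k ≠ 0) (hrow : ∀ k, i ≤ k → W k = 0) :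
    ∃ x : Fin n → ℝ, x i = 1 ∧ (∀ k, i < k → x k = 0) ∧ W *ᵥ x = 0 := by
  -- complete `W` by rows of the identity matrix to an invertible matrix
  set M : Matrix (Fin n) (Fin n) ℝ := Matrix.of fun k j => if k < i then W k j else
    (1 : Matrix (Fin n) (Fin n) ℝ) k j
  have hM : M.BlockTriangular id := fun k j hjk => by
    by_cases hk : k < i
    · simpa [M, hk] using htri k j hjk
    · simpa [M, hk] using Matrix.one_apply_ne (α := ℝ) (ne_of_gt (show j < k from hjk))
  have hdet : IsUnit M.det := by
    rw [Matrix.det_of_isUpperTriangular hM, isUnit_iff_ne_zero, Finset.prod_ne_zero_iff]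
    intro k _
    by_cases hk : k < i
    · simpa [M, hk] using hdiag k hk
    · simp [M, hk]
  set x := M⁻¹ *ᵥ Pi.single i 1
  have hx : M *ᵥ x = Pi.single i 1 := by
    rw [Matrix.mulVec_mulVec, Matrix.mul_nonsing_inv _ hdet, Matrix.one_mulVec]
  have hlow : ∀ k, ¬ k < i → x k = (Pi.single i 1 : Fin n → ℝ) k := fun k hk => by
    rw [← hx]
    simp [M, Matrix.mulVec, dotProduct, hk, Matrix.one_apply]
  refine ⟨x, by simpa using hlow i (lt_irrefl i), fun k hk => ?_, ?_⟩
  · rw [hlow k hk.not_gt, Pi.single_eq_of_ne hk.ne']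
  · ext k
    by_cases hk : k < i
    · have h1 := congrFun hx k
      rw [Pi.single_eq_of_ne hk.ne] at h1
      simpa [M, Matrix.mulVec, dotProduct, hk] using h1
    · simp [Matrix.mulVec, hrow k (not_lt.1 hk)]

/-- If the leading rows `W` of a perturbed Cholesky factorization of `B` were followed by a
nonpositive pivot `-ρ`, then `B`, raised by `ρ` at that diagonal entry, would be within the rounding
error of `Wᵀ W`, hence nearly singular. This is impossible when the least eigenvalue `μ` of `B`
exceeds the rounding error. The error is compared with the diagonal of the raised matrix, so no
bound on `ρ` is needed. -/
theorem false_of_nonpos_pivot {B W : Matrix (Fin n) (Fin n) ℝ} {i : Fin n} {μ β g ρ : ℝ}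
    (hB : ∀ x : Fin n → ℝ, μ * (x ⬝ᵥ x) ≤ x ⬝ᵥ (B *ᵥ x)) (hβ : ∀ a, B a a ≤ β)
    (htri : ∀ k j, j < k → W k j = 0) (hdiag : ∀ k < i, W k k ≠ 0) (hrow : ∀ k, i ≤ k → W k = 0)
    (hρ : 0 ≤ ρ) (hg : 0 ≤ g) (hg2 : g ≤ 1 / 2)
    (herr : ∀ a ≤ i, ∀ b ≤ i, |(B + ρ • Matrix.single i i (1 : ℝ) - Wᵀ * W) a b| ≤
      g * ∑ k, |W k a| * |W k b|)
    (h1 : g * n * (1 + 2 * g) ≤ 1) (h2 : g * n * (1 + 2 * g) * β < μ) : False := by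
  obtain ⟨x, hxi, hxk, hWx⟩ := exists_mulVec_eq_zero htri hdiag hrow
  have hsupp : ∀ a, x a ≠ 0 → a ≤ i := fun a ha => not_lt.1 fun hi => ha (hxk a hi)
  have hle := dotProduct_mulVec_le (M := B + ρ • Matrix.single i i (1 : ℝ) - Wᵀ * W) hg
    fun a b ha hb => herr a (hsupp a ha) b (hsupp b hb)
  rw [Matrix.sub_mulVec, dotProduct_sub, dotProduct_transpose_mul_self_mulVec, hWx,
    Matrix.add_mulVec, dotProduct_add] at hle
  have hz : vecNorm (0 : Fin n → ℝ) = 0 := by simp [vecNorm]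
  have hsingle : x ⬝ᵥ ((ρ • Matrix.single i i (1 : ℝ)) *ᵥ x) = ρ := by
    rw [Matrix.smul_mulVec, dotProduct_smul, Matrix.single_mulVec]
    simp [dotProduct, Function.update_apply, hxi]
  rw [hz, hsingle] at hle
  have hw : ∀ a ≤ i, ∑ k, W k a ^ 2 ≤ (1 + 2 * g) * (β + if a = i then ρ else 0) := fun a ha => by
    have h3 := (abs_le.1 (herr a ha a ha)).1
    have h4 : ∑ k, |W k a| * |W k a| = ∑ k, W k a ^ 2 :=
      Finset.sum_congr rfl fun k _ => by rw [← sq, sq_abs]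
    have h5 : (Wᵀ * W) a a = ∑ k, W k a ^ 2 := by
      simp [Matrix.mul_apply, sq]
    have h6 : (ρ • Matrix.single i i (1 : ℝ)) a a = if a = i then ρ else 0 := by
      by_cases hai : a = i
      · simp [hai]
      · simp [hai, Ne.symm hai]
    rw [h4, Matrix.sub_apply, Matrix.add_apply, h5, h6] at h3
    have h7 := hβ a
    have h8 : 0 ≤ ∑ k, W k a ^ 2 := Finset.sum_nonneg fun _ _ => sq_nonneg _
    set w := ∑ k, W k a ^ 2
    set r := (if a = i then ρ else 0)
    have h9 : (1 - g) * w ≤ β + r := by linarith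
    have h10 : 0 ≤ w * (g * (1 - 2 * g)) := by
      have : 0 ≤ 1 - 2 * g := by linarith
      positivity
    nlinarith [mul_le_mul_of_nonneg_left h9 (by linarith : 0 ≤ 1 + 2 * g)]
  have hsum : ∑ a, x a ^ 2 * ∑ k, W k a ^ 2 ≤ (1 + 2 * g) * (β * (x ⬝ᵥ x) + ρ) := by
    have : ∀ a, x a ^ 2 * ∑ k, W k a ^ 2 ≤
        (1 + 2 * g) * (β * (x a * x a) + if a = i then ρ else 0) := fun a => by
      by_cases ha : x a = 0
      · have hai : a ≠ i := by
          rintro rfl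
          simp [ha] at hxi
        simp [ha, hai]
      · refine (mul_le_mul_of_nonneg_left (hw a (hsupp a ha)) (sq_nonneg _)).trans (le_of_eq ?_)
        by_cases hai : a = i
        · simp [hai, hxi]
        · simp only [hai, if_false]
          ring
    refine (Finset.sum_le_sum fun a _ => this a).trans (le_of_eq ?_)
    rw [← Finset.mul_sum, Finset.sum_add_distrib, ← Finset.mul_sum]
    simp [dotProduct]
  have hxx : 1 ≤ x ⬝ᵥ x := by
    have := Finset.single_le_sum (f := fun a => x a * x a) (fun a _ => mul_self_nonneg _)
      (Finset.mem_univ i)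
    simpa [hxi, dotProduct] using this
  have hBx := hB x
  have hn : 0 ≤ g * n := by positivity
  have h3 : g * n * ∑ a, x a ^ 2 * ∑ k, W k a ^ 2 ≤
      g * n * ((1 + 2 * g) * (β * (x ⬝ᵥ x) + ρ)) := mul_le_mul_of_nonneg_left hsum hn
  have h4 : g * n * (1 + 2 * g) * β * (x ⬝ᵥ x) < μ * (x ⬝ᵥ x) :=
    mul_lt_mul_of_pos_right h2 (by linarith)
  have h5 : g * n * (1 + 2 * g) * ρ ≤ 1 * ρ := mul_le_mul_of_nonneg_right h1 hρ
  nlinarith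

end Pivot

/-! ### Recursion of the computed Cholesky factor and of the computed substitution -/

section Recursion

variable {m n : ℕ} (d : FlOp m n → ℝ) (s : Fin 3)

theorem flCholReduced_congr {A V W : Matrix (Fin n) (Fin n) ℝ} {i : Fin n}
    (h : ∀ k < i, ∀ j, V k j = W k j) (j : Fin n) :
    flCholReduced d s A V i j = flCholReduced d s A W i j := by
  unfold flCholReduced
  congr 1
  funext k
  have hk : k.castLE i.2.le < i := Fin.lt_def.2 k.2
  rw [h _ hk, h _ hk]

theorem flCholRows_of_lt (A : Matrix (Fin n) (Fin n) ℝ) {r : ℕ} {i : Fin n} (hi : i.1 < r)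
    (j : Fin n) : flCholRows d s A r i j = flCholRows d s A (i.1 + 1) i j := by
  induction r with
  | zero => omega
  | succ r ih =>
    by_cases h : i.1 = r
    · rw [h]
    · rw [← ih (by omega)]
      simp [flCholRows, h]

theorem flCholRows_of_ge (A : Matrix (Fin n) (Fin n) ℝ) {r : ℕ} {i : Fin n} (hi : r ≤ i.1)
    (j : Fin n) : flCholRows d s A r i j = 0 := by
  induction r with
  | zero => rfl
  | succ r ih =>
    rw [← ih (by omega)]
    simp [flCholRows, show ¬ i.1 = r by omega]

theorem flCholRows_eq_flChol (A : Matrix (Fin n) (Fin n) ℝ) {r : ℕ} {i : Fin n} (hi : i.1 < r)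
    (j : Fin n) : flCholRows d s A r i j = flChol d s A i j := by
  rw [flChol, flCholRows_of_lt d s A hi, flCholRows_of_lt d s A i.2]

theorem flChol_apply (A : Matrix (Fin n) (Fin n) ℝ) (i j : Fin n) :
    flChol d s A i j = if j < i then 0 else
      if j = i then √(flCholReduced d s A (flChol d s A) i i) * (1 + d (.cholFin s i i))
      else flCholReduced d s A (flChol d s A) i j /
        (√(flCholReduced d s A (flChol d s A) i i) * (1 + d (.cholFin s i i))) *
        (1 + d (.cholFin s i j)) := by
  have h : ∀ j, flCholReduced d s A (flCholRows d s A i.1) i j =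
      flCholReduced d s A (flChol d s A) i j :=
    flCholReduced_congr d s fun k hk j => flCholRows_eq_flChol d s A (Fin.lt_def.1 hk) j
  rw [← flCholRows_eq_flChol d s A (Nat.lt_succ_self i.1) j]
  simp [flCholRows, h]

theorem flChol_apply_of_lt (A : Matrix (Fin n) (Fin n) ℝ) {i j : Fin n} (h : j < i) :
    flChol d s A i j = 0 := by
  rw [flChol_apply, if_pos h]

theorem flChol_apply_self (A : Matrix (Fin n) (Fin n) ℝ) (i : Fin n) :
    flChol d s A i i =
      √(flCholReduced d s A (flChol d s A) i i) * (1 + d (.cholFin s i i)) := by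
  rw [flChol_apply, if_neg (lt_irrefl i), if_pos rfl]

theorem flChol_apply_of_gt (A : Matrix (Fin n) (Fin n) ℝ) {i j : Fin n} (h : i < j) :
    flChol d s A i j = flCholReduced d s A (flChol d s A) i j / flChol d s A i i *
      (1 + d (.cholFin s i j)) := by
  rw [flChol_apply_self, flChol_apply d s A i j, if_neg h.not_gt, if_neg h.ne']

theorem flSolveCols_of_lt (X : Matrix (Fin m) (Fin n) ℝ) (V : Matrix (Fin n) (Fin n) ℝ) {r : ℕ}
    (i : Fin m) {j : Fin n} (hj : j.1 < r) :
    flSolveCols d s X V r i j = flSolveCols d s X V (j.1 + 1) i j := by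
  induction r with
  | zero => omega
  | succ r ih =>
    by_cases h : j.1 = r
    · rw [h]
    · rw [← ih (by omega)]
      simp [flSolveCols, h]

theorem flSolve_apply (X : Matrix (Fin m) (Fin n) ℝ) (V : Matrix (Fin n) (Fin n) ℝ) (i : Fin m)
    (j : Fin n) :
    flSolve d s X V i j =
      flSub (X i j) j.1
          (fun k : Fin j.1 =>
            flSolve d s X V i (k.castLE j.2.le) * V (k.castLE j.2.le) j *
              (1 + d (.solveMul s i j (k.castLE j.2.le))))
          (fun k : Fin j.1 => d (.solveSub s i j (k.castLE j.2.le))) /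
        V j j * (1 + d (.solveDiv s i j)) := by
  have h : ∀ k : Fin j.1, flSolveCols d s X V j.1 i (k.castLE j.2.le) =
      flSolve d s X V i (k.castLE j.2.le) := fun k => by
    rw [flSolve, flSolveCols_of_lt d s X V i (j := k.castLE j.2.le) k.2,
      flSolveCols_of_lt d s X V i (j := k.castLE j.2.le) (k.castLE j.2.le).2]
  rw [← funext fun k => congrArg (fun z => z * V (k.castLE j.2.le) j *
    (1 + d (.solveMul s i j (k.castLE j.2.le)))) (h k)]
  rw [flSolve, flSolveCols_of_lt d s X V i j.2]
  simp [flSolveCols]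

end Recursion

/-! ### Backward error of the Cholesky factorization and of the substitution -/

section BackwardError

variable {m n : ℕ} {u gm gn : ℝ} {d : FlOp m n → ℝ}

theorem SmallRelErrors.one_add_pos (h : SmallRelErrors u gm gn d) (hu : u ≤ 1 / 2) (a : FlOp m n) :
    0 < 1 + d a :=
  one_add_pos_of_abs_le hu (h.abs_le a)

theorem sum_eq_sum_Iio_add {f : Fin n → ℝ} {i : Fin n} (h : ∀ k, i < k → f k = 0) :
    ∑ k, f k = ∑ k ∈ Finset.Iio i, f k + f i := by
  have h1 : ∑ k ∈ Finset.Iic i, f k = ∑ k, f k :=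
    Finset.sum_subset (Finset.subset_univ _) fun k _ hk => h k (by simpa using hk)
  rw [← h1, ← Finset.Iio_insert, Finset.sum_insert (by simp), add_comm]

theorem abs_sub_inv_le (h : SmallRelErrors u gm gn d) (hu : u ≤ 1 / 1000) (a : FlOp m n) :
    |(1 + d a)⁻¹ - 1| ≤ 1.005 * u := by
  obtain ⟨h1, h2⟩ := abs_le.1 (h.abs_le a)
  have hpos := h.one_add_pos (by linarith) a
  have h3 : (1 + d a)⁻¹ * (1 + d a) = 1 := inv_mul_cancel₀ hpos.ne'
  have h4 : (1 + d a)⁻¹ ≤ 1.005 := by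
    rw [inv_le_comm₀ hpos (by norm_num)]
    norm_num
    linarith
  rw [show (1 + d a)⁻¹ - 1 = -((1 + d a)⁻¹ * d a) by linear_combination h3, abs_neg, abs_mul,
    abs_of_pos (inv_pos.2 hpos)]
  exact mul_le_mul h4 (h.abs_le a) (abs_nonneg _) (by norm_num)

/-- The backward error of a computed pivot; `p` is the pivot up to a positive factor. -/
theorem exists_pivot_eq (h : SmallRelErrors u gm gn d) (hu : u ≤ 1 / 2) (s : Fin 3)
    (A V : Matrix (Fin n) (Fin n) ℝ) (i : Fin n) :
    ∃ p : ℝ, (flCholReduced d s A V i i ≤ 0 → p ≤ 0) ∧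
      |A i i - p - ∑ k ∈ Finset.Iio i, V k i * V k i| ≤
        gn * ∑ k ∈ Finset.Iio i, |V k i| * |V k i| := by
  have hne : ∀ a, 1 + d a ≠ 0 := fun a => (h.one_add_pos hu a).ne'
  have h1 := flSub_castLE_mul_prod_inv (A i i) i
    (fun k => V k i * V k i * (1 + d (.cholMul s i i k))) (fun k => d (.cholSub s i i k))
    fun _ => hne _
  have h2 := abs_sum_mul_sub_le (Finset.Iio i) (fun k => V k i) (fun k => V k i)
    fun k hk => h.chol s i i k (Finset.mem_Iio.1 hk)
  refine ⟨flCholReduced d s A V i i * ∏ l ∈ Finset.Iio i, (1 + d (.cholSub s i i l))⁻¹,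
    fun hr => mul_nonpos_of_nonpos_of_nonneg hr (Finset.prod_nonneg fun l _ =>
      (inv_pos.2 (h.one_add_pos hu _)).le), ?_⟩
  rw [flCholReduced, h1, sub_sub_cancel]
  simpa only [mul_assoc] using h2

/-- Backward error of an entry of the computed Cholesky factor in a row with positive pivot. The
square root enters twice in the square of a diagonal entry, whence the summand `1.01 u`. -/
theorem abs_sub_flChol_le (h : SmallRelErrors u gm gn d) (hu0 : 0 ≤ u) (hu : u ≤ 1 / 1000)
    (hgn : gn ≤ 1 / 700) (s : Fin 3) (A : Matrix (Fin n) (Fin n) ℝ) {i j : Fin n} (hij : i ≤ j)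
    (hp : 0 < flCholReduced d s A (flChol d s A) i i) :
    |A i j - ((flChol d s A)ᵀ * flChol d s A) i j| ≤
      (gn + 1.01 * u) * ∑ k, |flChol d s A k i| * |flChol d s A k j| := by
  set V := flChol d s A with hV
  have hu2 : u ≤ 1 / 2 := by linarith
  have hne : ∀ a, 1 + d a ≠ 0 := fun a => (h.one_add_pos hu2 a).ne'
  have hVi : V i i ≠ 0 := by
    rw [hV, flChol_apply_self]
    exact mul_ne_zero (Real.sqrt_pos.2 hp).ne' (hne _)
  have hzero : ∀ k, i < k → V k i = 0 := fun k hk => flChol_apply_of_lt d s A hk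
  have h1 := flSub_castLE_mul_prod_inv (A i j) i
    (fun k => V k i * V k j * (1 + d (.cholMul s i j k))) (fun k => d (.cholSub s i j k))
    fun _ => hne _
  change flCholReduced d s A V i j * _ = _ at h1
  obtain ⟨w, hw, hwV⟩ : ∃ w : ℝ, |w - 1| ≤ gn + 1.01 * u ∧
      flCholReduced d s A V i j * ∏ l ∈ Finset.Iio i, (1 + d (.cholSub s i j l))⁻¹ =
        V i i * V i j * w := by
    have hfin := h.cholFin s i j
    rw [mul_inv, ← Finset.prod_inv_distrib] at hfin
    set R := ∏ l ∈ Finset.Iio i, (1 + d (.cholSub s i j l))⁻¹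
    rcases hij.lt_or_eq with hlt | rfl
    · refine ⟨(1 + d (.cholFin s i j))⁻¹ * R, hfin.trans (by linarith), ?_⟩
      rw [show V i j = _ from flChol_apply_of_gt d s A hlt, ← hV]
      have := hne (.cholFin s i j)
      field_simp
    · refine ⟨(1 + d (.cholFin s i i))⁻¹ * R * (1 + d (.cholFin s i i))⁻¹, ?_, ?_⟩
      · have h2 := abs_sub_inv_le h hu (.cholFin s i i)
        set x := (1 + d (.cholFin s i i))⁻¹ * R
        set y := (1 + d (.cholFin s i i))⁻¹
        calc |x * y - 1| = |(x - 1) + ((x - 1) * (y - 1) + (y - 1))| := by ring_nf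
          _ ≤ |x - 1| + (|x - 1| * |y - 1| + |y - 1|) := by
            refine (abs_add_le _ _).trans (add_le_add_right ((abs_add_le _ _).trans ?_) _)
            rw [abs_mul]
          _ ≤ gn + (1 / 700 * (1.005 * u) + 1.005 * u) := by
            gcongr
            exact hfin.trans hgn
          _ ≤ gn + 1.01 * u := by linarith
      · have h3 : V i i = √(flCholReduced d s A V i i) * (1 + d (.cholFin s i i)) :=
          flChol_apply_self d s A i
        rw [h3]
        have := hne (.cholFin s i i)
        field_simp
        rw [Real.sq_sqrt hp.le]
        ring
  have hA : A i j = ∑ k ∈ Finset.Iio i, V k i * V k j *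
      ((1 + d (.cholMul s i j k)) * ∏ l ∈ Finset.Iio k, (1 + d (.cholSub s i j l))⁻¹) +
      V i i * V i j * w := by
    rw [← hwV, h1]
    simp only [mul_assoc]
    ring
  have h2 := abs_sum_mul_sub_le (Finset.Iio i) (fun k => V k i) (fun k => V k j)
    fun k hk => h.chol s i j k (Finset.mem_Iio.1 hk)
  have hVV : (Vᵀ * V) i j = ∑ k ∈ Finset.Iio i, V k i * V k j + V i i * V i j := by
    rw [Matrix.mul_apply]
    exact sum_eq_sum_Iio_add (f := fun k => V k i * V k j) fun k hk => by rw [hzero k hk, zero_mul]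
  rw [hA, hVV, sum_eq_sum_Iio_add (f := fun k => |V k i| * |V k j|) fun k hk => by
    rw [hzero k hk, abs_zero, zero_mul]]
  have h3 : |V i i * V i j * w - V i i * V i j| ≤ (gn + 1.01 * u) * (|V i i| * |V i j|) := by
    rw [← mul_sub_one, abs_mul, abs_mul, mul_comm]
    exact mul_le_mul_of_nonneg_right hw (by positivity)
  have h4 : gn * ∑ k ∈ Finset.Iio i, |V k i| * |V k j| ≤
      (gn + 1.01 * u) * ∑ k ∈ Finset.Iio i, |V k i| * |V k j| :=
    mul_le_mul_of_nonneg_right (by linarith) (by positivity)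
  rw [add_sub_add_comm, mul_add]
  exact (abs_add_le _ _).trans (add_le_add (h2.trans h4) h3)

/-- If the matrix to be factorized is sufficiently positive definite, the computed pivots are
positive. Only the upper triangle of `A` is read; `B` is its symmetric completion. -/
theorem flCholReduced_pos (h : SmallRelErrors u gm gn d) (hu0 : 0 ≤ u) (hu : u ≤ 1 / 1000)
    (hgn0 : 0 ≤ gn) (hgn : gn ≤ 1 / 700) (s : Fin 3) {A B : Matrix (Fin n) (Fin n) ℝ} {μ β : ℝ}
    (hBA : ∀ i j, i ≤ j → B i j = A i j) (hBsymm : ∀ i j, B i j = B j i)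
    (hB : ∀ x : Fin n → ℝ, μ * (x ⬝ᵥ x) ≤ x ⬝ᵥ (B *ᵥ x)) (hβ : ∀ a, B a a ≤ β)
    (h1 : (gn + 1.01 * u) * n * (1 + 2 * (gn + 1.01 * u)) ≤ 1)
    (h2 : (gn + 1.01 * u) * n * (1 + 2 * (gn + 1.01 * u)) * β < μ) (i : Fin n) :
    0 < flCholReduced d s A (flChol d s A) i i := by
  induction i using WellFoundedLT.induction with
  | ind i ih =>
  set V := flChol d s A with hV
  set W := flCholRows d s A i.1 with hW
  have hu2 : u ≤ 1 / 2 := by linarith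
  by_contra! hneg
  have hWV : ∀ k < i, ∀ j, W k j = V k j := fun k hk j =>
    flCholRows_eq_flChol d s A (Fin.lt_def.1 hk) j
  have hrow : ∀ k, i ≤ k → W k = 0 := fun k hk =>
    funext fun j => flCholRows_of_ge d s A (Fin.le_def.1 hk) j
  have htri : ∀ k j, j < k → W k j = 0 := fun k j hjk => by
    by_cases hk : k < i
    · rw [hWV k hk]
      exact flChol_apply_of_lt d s A hjk
    · rw [hrow k (not_lt.1 hk)]
      rfl
  have hdiag : ∀ k < i, W k k ≠ 0 := fun k hk => by
    rw [hWV k hk, hV, flChol_apply_self]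
    exact mul_ne_zero (Real.sqrt_pos.2 (ih k hk)).ne' (h.one_add_pos hu2 _).ne'
  obtain ⟨p, hp, hpivot⟩ := exists_pivot_eq h hu2 s A V i
  have hsingle : ∀ a b, a < i → ((-p) • Matrix.single i i (1 : ℝ)) a b = 0 := fun a b ha => by
    simp [ha.ne']
  have hWW : ∀ a < i, ∀ b, ∑ k, W k a * W k b = ∑ k, V k a * V k b := fun a ha b => by
    refine Finset.sum_congr rfl fun k _ => ?_
    by_cases hk : k < i
    · rw [hWV k hk, hWV k hk]
    · rw [hrow k (not_lt.1 hk), hV, flChol_apply_of_lt d s A (ha.trans_le (not_lt.1 hk))]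
      simp
  have hWW' : ∀ a < i, ∀ b, ∑ k, |W k a| * |W k b| = ∑ k, |V k a| * |V k b| := fun a ha b => by
    refine Finset.sum_congr rfl fun k _ => ?_
    by_cases hk : k < i
    · rw [hWV k hk, hWV k hk]
    · rw [hrow k (not_lt.1 hk), hV, flChol_apply_of_lt d s A (ha.trans_le (not_lt.1 hk))]
      simp
  have hupper : ∀ a b, a ≤ b → b ≤ i → |(B + (-p) • Matrix.single i i (1 : ℝ) - Wᵀ * W) a b| ≤
      (gn + 1.01 * u) * ∑ k, |W k a| * |W k b| := fun a b hab hbi => by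
    rw [Matrix.sub_apply, Matrix.add_apply, Matrix.mul_apply]
    simp only [Matrix.transpose_apply]
    rcases (hab.trans hbi).lt_or_eq with ha | rfl
    · rw [hsingle a b ha, hWW a ha, hWW' a ha, add_zero, hBA a b hab]
      exact abs_sub_flChol_le h hu0 hu hgn s A hab (ih a ha)
    · obtain rfl : b = a := le_antisymm hbi hab
      have hz : ∀ k, b < k → W k b = 0 := fun k hk => htri k b hk
      have hb0 : W b b = 0 := by rw [hrow b le_rfl]; rfl
      rw [sum_eq_sum_Iio_add (f := fun k => W k b * W k b) fun k hk => by rw [hz k hk, zero_mul],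
        sum_eq_sum_Iio_add (f := fun k => |W k b| * |W k b|) fun k hk => by
          rw [hz k hk, abs_zero, zero_mul], hb0, hBA b b le_rfl]
      have e1 : ∑ k ∈ Finset.Iio b, W k b * W k b = ∑ k ∈ Finset.Iio b, V k b * V k b :=
        Finset.sum_congr rfl fun k hk => by rw [hWV k (Finset.mem_Iio.1 hk)]
      have e2 : ∑ k ∈ Finset.Iio b, |W k b| * |W k b| = ∑ k ∈ Finset.Iio b, |V k b| * |V k b| :=
        Finset.sum_congr rfl fun k hk => by rw [hWV k (Finset.mem_Iio.1 hk)]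
      have e3 : ((-p) • Matrix.single b b (1 : ℝ)) b b = -p := by simp
      rw [e1, e2, e3, mul_zero, add_zero, abs_zero, mul_zero, add_zero, ← sub_eq_add_neg]
      refine hpivot.trans (mul_le_mul_of_nonneg_right (by linarith) (by positivity))
  refine false_of_nonpos_pivot (W := W) (i := i) (ρ := -p) (g := gn + 1.01 * u) hB hβ htri hdiag
    hrow (by linarith [hp hneg]) (by positivity) (by linarith) (fun a ha b hb => ?_) h1 h2
  rcases le_total a b with hab | hab
  · exact hupper a b hab hb
  · have e1 : (B + (-p) • Matrix.single i i (1 : ℝ) - Wᵀ * W) a b =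
        (B + (-p) • Matrix.single i i (1 : ℝ) - Wᵀ * W) b a := by
      simp only [Matrix.sub_apply, Matrix.add_apply, Matrix.smul_apply, Matrix.mul_apply,
        Matrix.transpose_apply, hBsymm a b, mul_comm, Matrix.single_apply, and_comm]
    rw [e1]
    simp only [mul_comm (|W _ a|)]
    exact hupper b a hab ha

theorem abs_flSolve_mul_sub_le (h : SmallRelErrors u gm gn d) (hu : u ≤ 1 / 2) (s : Fin 3)
    (X : Matrix (Fin m) (Fin n) ℝ) {V : Matrix (Fin n) (Fin n) ℝ} (hV : ∀ k j, j < k → V k j = 0)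
    (hVd : ∀ j, V j j ≠ 0) (i : Fin m) (j : Fin n) :
    |(flSolve d s X V * V - X) i j| ≤ gn * ∑ k, |flSolve d s X V i k| * |V k j| := by
  set Y := flSolve d s X V with hY
  have hne : ∀ a, 1 + d a ≠ 0 := fun a => (h.one_add_pos hu a).ne'
  have h1 := flSub_castLE_mul_prod_inv (X i j) j
    (fun k => Y i k * V k j * (1 + d (.solveMul s i j k))) (fun k => d (.solveSub s i j k))
    fun _ => hne _
  set S := flSub (X i j) j.1 (fun k => Y i (k.castLE j.2.le) * V (k.castLE j.2.le) j *
    (1 + d (.solveMul s i j (k.castLE j.2.le)))) (fun k => d (.solveSub s i j (k.castLE j.2.le)))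
  have hYj : Y i j = S / V j j * (1 + d (.solveDiv s i j)) := flSolve_apply d s X V i j
  have hX : X i j = ∑ k ∈ Finset.Iio j, Y i k * V k j *
      ((1 + d (.solveMul s i j k)) * ∏ l ∈ Finset.Iio k, (1 + d (.solveSub s i j l))⁻¹) +
      Y i j * V j j *
        ((1 + d (.solveDiv s i j)) * ∏ l ∈ Finset.Iio j, (1 + d (.solveSub s i j l)))⁻¹ := by
    have h2 : Y i j * V j j *
        ((1 + d (.solveDiv s i j)) * ∏ l ∈ Finset.Iio j, (1 + d (.solveSub s i j l)))⁻¹ =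
        S * ∏ l ∈ Finset.Iio j, (1 + d (.solveSub s i j l))⁻¹ := by
      rw [hYj, mul_inv, Finset.prod_inv_distrib]
      have := hne (.solveDiv s i j)
      have := hVd j
      field_simp
    rw [h2, h1]
    simp only [mul_assoc]
    ring
  have h2 := abs_sum_mul_sub_le (Finset.Iio j) (fun k => Y i k) (fun k => V k j)
    fun k hk => h.solve s i j k (Finset.mem_Iio.1 hk)
  have h3 := abs_sum_mul_sub_le {j} (fun k => Y i k) (fun k => V k j)
    (w := fun _ => ((1 + d (.solveDiv s i j)) *
      ∏ l ∈ Finset.Iio j, (1 + d (.solveSub s i j l)))⁻¹) fun k _ => h.solveDiv s i j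
  simp only [Finset.sum_singleton] at h3
  rw [Matrix.sub_apply, Matrix.mul_apply,
    sum_eq_sum_Iio_add (f := fun k => Y i k * V k j) fun k hk => by rw [hV k j hk, mul_zero],
    sum_eq_sum_Iio_add (f := fun k => |Y i k| * |V k j|) fun k hk => by
      rw [hV k j hk, abs_zero, mul_zero], abs_sub_comm, hX, add_sub_add_comm, mul_add]
  exact (abs_add_le _ _).trans (add_le_add h2 h3)

end BackwardError

/-! ### One step of (Shifted) CholeskyQR -/

/-- The standing smallness assumptions on the dimensions, the roundoff and the parameter `lam`. -/
structure SmallRoundoff (m n : ℕ) (u lam : ℝ) : Prop where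
  one_le_n : 1 ≤ n
  n_le_m : n ≤ m
  u_pos : 0 < u
  one_le_lam : 1 ≤ lam
  sqrt_m : lam * √(m : ℝ) * n * u ≤ 1 / 2200
  sqrt_n : lam * √((n : ℝ) + 1) * n * u ≤ 1 / 2200

/-- The size `lam (√m + √(n+1)) n u` of the backward error of a Cholesky factorization. -/
noncomputable def gramError (m n : ℕ) (u lam : ℝ) : ℝ :=
  lam * (√(m : ℝ) * n * u + √((n : ℝ) + 1) * n * u)

section Step

variable {m n : ℕ} {u lam : ℝ} {d : FlOp m n → ℝ}

namespace SmallRoundoff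

theorem one_le_cast (h : SmallRoundoff m n u lam) : (1 : ℝ) ≤ n := by exact_mod_cast h.one_le_n

theorem one_le_sqrt_m (h : SmallRoundoff m n u lam) : 1 ≤ √(m : ℝ) :=
  Real.one_le_sqrt.2 (by exact_mod_cast h.one_le_n.trans h.n_le_m)

theorem one_le_sqrt_n (h : SmallRoundoff m n u lam) : 1 ≤ √(n : ℝ) :=
  Real.one_le_sqrt.2 h.one_le_cast

theorem sqrt_n_le (h : SmallRoundoff m n u lam) : √(n : ℝ) ≤ √((n : ℝ) + 1) :=
  Real.sqrt_le_sqrt (by have := h.one_le_cast; linarith)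

theorem sqrt_n_le_sqrt_m (h : SmallRoundoff m n u lam) : √(n : ℝ) ≤ √(m : ℝ) :=
  Real.sqrt_le_sqrt (by exact_mod_cast h.n_le_m)

theorem u_le (h : SmallRoundoff m n u lam) : u ≤ lam * √(m : ℝ) * u := by
  have h1 : 1 ≤ lam * √(m : ℝ) := one_le_mul_of_one_le_of_one_le h.one_le_lam h.one_le_sqrt_m
  exact le_mul_of_one_le_left h.u_pos.le h1

theorem le_mul_n (h : SmallRoundoff m n u lam) {x : ℝ} (hx : 0 ≤ x) : x * u ≤ x * n * u :=
  mul_le_mul_of_nonneg_right (le_mul_of_one_le_right hx h.one_le_cast) h.u_pos.le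

theorem lam_pos (h : SmallRoundoff m n u lam) : 0 < lam := by linarith [h.one_le_lam]

theorem sqrt_m_mul_u (h : SmallRoundoff m n u lam) : lam * √(m : ℝ) * u ≤ 1 / 2200 :=
  (h.le_mul_n (mul_nonneg h.lam_pos.le (Real.sqrt_nonneg _))).trans h.sqrt_m

theorem sqrt_n_mul_u (h : SmallRoundoff m n u lam) : lam * √((n : ℝ) + 1) * u ≤ 1 / 2200 :=
  (h.le_mul_n (mul_nonneg h.lam_pos.le (Real.sqrt_nonneg _))).trans h.sqrt_n

theorem u_le_const (h : SmallRoundoff m n u lam) : u ≤ 1 / 2200 := h.u_le.trans h.sqrt_m_mul_u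

theorem gn_le (h : SmallRoundoff m n u lam) :
    2.24 * lam * √(n : ℝ) * u ≤ 2.24 * (lam * √((n : ℝ) + 1) * u) := by
  have h1 : lam * √(n : ℝ) * u ≤ lam * √((n : ℝ) + 1) * u :=
    mul_le_mul_of_nonneg_right (mul_le_mul_of_nonneg_left h.sqrt_n_le h.lam_pos.le) h.u_pos.le
  linarith

theorem cholError_le (h : SmallRoundoff m n u lam) :
    2.24 * lam * √(n : ℝ) * u + 1.01 * u ≤ 3.25 * (lam * √((n : ℝ) + 1) * u) := by
  have h1 := h.gn_le
  have h2 : 1 ≤ lam * √((n : ℝ) + 1) :=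
    one_le_mul_of_one_le_of_one_le h.one_le_lam (h.one_le_sqrt_n.trans h.sqrt_n_le)
  have h3 : u ≤ lam * √((n : ℝ) + 1) * u := le_mul_of_one_le_left h.u_pos.le h2
  linarith

theorem gramError_eq (m n : ℕ) (u lam : ℝ) :
    gramError m n u lam = lam * √(m : ℝ) * n * u + lam * √((n : ℝ) + 1) * n * u := by
  rw [gramError]
  ring

theorem gramError_pos (h : SmallRoundoff m n u lam) : 0 < gramError m n u lam := by
  have := h.lam_pos
  have := h.u_pos
  have := h.one_le_cast
  have := h.one_le_sqrt_m
  rw [gramError]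
  positivity

theorem gramError_le (h : SmallRoundoff m n u lam) : gramError m n u lam ≤ 1 / 1100 := by
  rw [gramError_eq]
  linarith [h.sqrt_m, h.sqrt_n]

end SmallRoundoff

theorem abs_dotProduct_mulVec_le (M : Matrix (Fin n) (Fin n) ℝ) (x : Fin n → ℝ) :
    |x ⬝ᵥ (M *ᵥ x)| ≤ normF M * vecNorm x ^ 2 := by
  have h1 : |x ⬝ᵥ (M *ᵥ x)| ≤ vecNorm x * vecNorm (M *ᵥ x) := by
    refine le_trans ?_ (abs_sum_mul_le_vecNorm x (M *ᵥ x))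
    simp only [← abs_mul]
    exact Finset.abs_sum_le_sum_abs _ _
  have h2 := (vecNorm_mulVec_le M x).trans
    (mul_le_mul_of_nonneg_right (norm2_le_normF M) (vecNorm_nonneg x))
  nlinarith [mul_le_mul_of_nonneg_left h2 (vecNorm_nonneg x)]

/-- The computed Cholesky factorization of a perturbation `A` of the positive definite matrix
`Xᵀ X + σ I` runs to completion, with a small backward error. -/
theorem chol_step (h : SmallRoundoff m n u lam)
    (hd : SmallRelErrors u (2.24 * lam * √(m : ℝ) * u) (2.24 * lam * √(n : ℝ) * u) d) (s : Fin 3)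
    {X : Matrix (Fin m) (Fin n) ℝ} {σ : ℝ} (hσ : σ ≤ 11 * gramError m n u lam * normG X ^ 2)
    (hX : 0 < normG X)
    (hlow : ∀ x, 11 * gramError m n u lam * normG X ^ 2 * vecNorm x ^ 2 ≤
      vecNorm (X *ᵥ x) ^ 2 + σ * vecNorm x ^ 2)
    {A : Matrix (Fin n) (Fin n) ℝ}
    (hA : ∀ i j, i ≤ j → |A i j - (Xᵀ * X + σ • (1 : Matrix (Fin n) (Fin n) ℝ)) i j| ≤
      3.27 * (lam * √(m : ℝ) * u) * normG X ^ 2) :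
    CholRuns d s A ∧ (∀ j, flChol d s A j j ≠ 0) ∧
      normF ((flChol d s A)ᵀ * flChol d s A - (Xᵀ * X + σ • (1 : Matrix (Fin n) (Fin n) ℝ))) ≤
        11 / 3 * gramError m n u lam * normG X ^ 2 ∧
      ∀ j, vecNorm ((flChol d s A)ᵀ j) ≤ 1.01 * normG X := by
  set α := normG X with hα
  set C := Xᵀ * X + σ • (1 : Matrix (Fin n) (Fin n) ℝ) with hC
  set V := flChol d s A with hV
  set g := 2.24 * lam * √(n : ℝ) * u + 1.01 * u with hg
  have hu := h.u_pos
  have hlam := h.lam_pos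
  have hn1 := h.one_le_cast
  have hu1000 : u ≤ 1 / 1000 := by linarith [h.u_le_const]
  have hgn : 2.24 * lam * √(n : ℝ) * u ≤ 1 / 700 := by linarith [h.gn_le, h.sqrt_n_mul_u]
  have hg0 : 0 ≤ g := by positivity
  have hα2 : 0 < α ^ 2 := by positivity
  have hgle : g ≤ 3.25 * (lam * √((n : ℝ) + 1) * u) := h.cholError_le
  have hLeq := SmallRoundoff.gramError_eq m n u lam
  have hL := h.gramError_le
  have ha1 := h.sqrt_m
  have hb1 := h.sqrt_n
  have hau := h.sqrt_m_mul_u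
  have hbu := h.sqrt_n_mul_u
  set L := gramError m n u lam
  have ha0 : 0 < lam * √(m : ℝ) * n * u := by have := h.one_le_sqrt_m; positivity
  have hb0 : 0 < lam * √((n : ℝ) + 1) * n * u := by positivity
  have hgn' : g * n ≤ 3.25 * (lam * √((n : ℝ) + 1) * n * u) := by
    calc g * n ≤ 3.25 * (lam * √((n : ℝ) + 1) * u) * n := by gcongr
      _ = _ := by ring
  set e := 3.27 * (lam * √(m : ℝ) * u) * α ^ 2 with he
  have he0 : 0 ≤ e := by positivity
  have hne : n * e = 3.27 * (lam * √(m : ℝ) * n * u) * α ^ 2 := by rw [he]; ring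
  set a := lam * √(m : ℝ) * n * u
  set b := lam * √((n : ℝ) + 1) * n * u
  have hCsymm : ∀ i j, C i j = C j i := fun i j => by
    rw [hC]
    simp only [Matrix.add_apply, Matrix.smul_apply, Matrix.mul_apply, Matrix.transpose_apply]
    rw [Matrix.one_apply, Matrix.one_apply]
    simp only [eq_comm (a := i), mul_comm]
  have hVsymm : ∀ i j, (Vᵀ * V) i j = (Vᵀ * V) j i := fun i j => by
    simp only [Matrix.mul_apply, Matrix.transpose_apply, mul_comm]
  -- only the upper triangle of `A` enters
  set B : Matrix (Fin n) (Fin n) ℝ := Matrix.of fun i j => if i ≤ j then A i j else A j i with hB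
  have hBle : ∀ {i j}, i ≤ j → B i j = A i j := fun {i j} hij => by simp [hB, hij]
  have hBsymm : ∀ i j, B i j = B j i := fun i j => by
    rcases lt_trichotomy i j with hij | rfl | hij
    · simp [hB, hij.le, hij.not_ge]
    · rfl
    · simp [hB, hij.le, hij.not_ge]
  have hBC : ∀ i j, |(B - C) i j| ≤ e := fun i j => by
    rw [Matrix.sub_apply]
    rcases le_total i j with hij | hij
    · rw [hBle hij]
      exact hA i j hij
    · rw [hBsymm, hCsymm, hBle hij]
      exact hA j i hij
  have hquad : ∀ x : Fin n → ℝ, (11 * L - 3.27 * a) * α ^ 2 * (x ⬝ᵥ x) ≤ x ⬝ᵥ (B *ᵥ x) :=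
    fun x => by
      have h1 := (abs_le.1 (abs_dotProduct_mulVec_le (B - C) x)).1
      have h2 : normF (B - C) ≤ n * e := normF_le_of_entry_le _ he0 hBC
      have h3 := mul_le_mul_of_nonneg_right h2 (sq_nonneg (vecNorm x))
      have h4 : x ⬝ᵥ (C *ᵥ x) = vecNorm (X *ᵥ x) ^ 2 + σ * vecNorm x ^ 2 := by
        rw [hC, Matrix.add_mulVec, dotProduct_add, dotProduct_transpose_mul_self_mulVec,
          Matrix.smul_mulVec, dotProduct_smul, Matrix.one_mulVec, ← vecNorm_sq_eq_dotProduct,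
          smul_eq_mul]
      rw [Matrix.sub_mulVec, dotProduct_sub, h4] at h1
      have h5 := hlow x
      rw [← vecNorm_sq_eq_dotProduct]
      rw [hne] at h3
      linarith
  have hdiagB : ∀ j, B j j ≤ 1.012 * α ^ 2 := fun j => by
    have h1 := (abs_le.1 (hBC j j)).2
    have h2 : C j j = vecNorm (Xᵀ j) ^ 2 + σ := by
      rw [hC, vecNorm_sq]
      simp [Matrix.mul_apply, sq]
    have h3 : vecNorm (Xᵀ j) ^ 2 ≤ α ^ 2 :=
      pow_le_pow_left₀ (vecNorm_nonneg _) (vecNorm_col_le_normG X j) 2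
    have h4 : e ≤ 3.27 * (1 / 2200) * α ^ 2 := by rw [he]; gcongr
    have h5 : 11 * L * α ^ 2 ≤ 11 * (1 / 1100) * α ^ 2 := by gcongr
    rw [Matrix.sub_apply, h2] at h1
    linarith
  have htri : ∀ k j, j < k → V k j = 0 := fun k j hjk => flChol_apply_of_lt d s A hjk
  have hruns : ∀ i, 0 < flCholReduced d s A V i i := by
    have hgn3 : g * n * (1 + 2 * g) ≤ 3.26 * b := by
      have h1 : 1 + 2 * g ≤ 1.003 := by linarith
      calc g * n * (1 + 2 * g) ≤ 3.25 * b * 1.003 := by gcongr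
        _ ≤ 3.26 * b := by linarith
    refine flCholReduced_pos hd hu.le hu1000 (by positivity) (hgn.trans (by norm_num)) s
      (fun i j hij => hBle hij) hBsymm hquad hdiagB (hgn3.trans (by linarith)) ?_
    calc g * n * (1 + 2 * g) * (1.012 * α ^ 2) ≤ 3.26 * b * (1.012 * α ^ 2) := by gcongr
      _ < (11 * L - 3.27 * a) * α ^ 2 := by
        rw [hLeq]
        nlinarith [mul_pos ha0 hα2, mul_pos hb0 hα2]
  have hdiag : ∀ j, V j j ≠ 0 := fun j => by
    rw [hV, flChol_apply_self]
    exact mul_ne_zero (Real.sqrt_pos.2 (hruns j)).ne' (hd.one_add_pos (by linarith) _).ne'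
  have hback : ∀ i j, |B i j - (Vᵀ * V) i j| ≤ g * ∑ k, |V k i| * |V k j| := fun i j => by
    rcases le_total i j with hij | hij
    · rw [hBle hij]
      exact abs_sub_flChol_le hd hu.le hu1000 (hgn.trans (by norm_num)) s A hij (hruns i)
    · rw [hBsymm, hVsymm, hBle hij]
      simp only [mul_comm (|V _ i|)]
      exact abs_sub_flChol_le hd hu.le hu1000 (hgn.trans (by norm_num)) s A hij (hruns j)
  have hcol : ∀ j, vecNorm (Vᵀ j) ≤ 1.01 * α := fun j => by
    refine (abs_le_of_sq_le_sq' ?_ (by positivity)).2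
    have h1 := (abs_le.1 (hback j j)).1
    have h2 : ∑ k, |V k j| * |V k j| = vecNorm (Vᵀ j) ^ 2 := by
      rw [vecNorm_sq]
      exact Finset.sum_congr rfl fun k _ => by rw [← sq, sq_abs]; rfl
    have h3 : (Vᵀ * V) j j = vecNorm (Vᵀ j) ^ 2 := by
      rw [vecNorm_sq]
      simp [Matrix.mul_apply, sq]
    rw [h2, h3] at h1
    have h4 : g * vecNorm (Vᵀ j) ^ 2 ≤ 3.25 * (1 / 2200) * vecNorm (Vᵀ j) ^ 2 := by
      gcongr
      linarith
    have h5 := hdiagB j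
    linarith
  refine ⟨hruns, hdiag, ?_, hcol⟩
  have hg1 : ∀ i j, |(Vᵀ * V - C) i j| ≤ e + g * (1.01 * α) ^ 2 := fun i j => by
    have h1 : ∑ k, |V k i| * |V k j| ≤ (1.01 * α) ^ 2 := by
      refine (abs_sum_mul_le_vecNorm (Vᵀ i) (Vᵀ j)).trans ?_
      rw [sq]
      exact mul_le_mul (hcol i) (hcol j) (vecNorm_nonneg _) (by positivity)
    calc |(Vᵀ * V - C) i j| = |(B - C) i j - (B i j - (Vᵀ * V) i j)| := by
          simp only [Matrix.sub_apply]; ring_nf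
      _ ≤ |(B - C) i j| + |B i j - (Vᵀ * V) i j| := abs_sub _ _
      _ ≤ e + g * (1.01 * α) ^ 2 :=
        add_le_add (hBC i j) ((hback i j).trans (mul_le_mul_of_nonneg_left h1 hg0))
  refine (normF_le_of_entry_le _ (by positivity) hg1).trans ?_
  have h1 : n * (e + g * (1.01 * α) ^ 2) = n * e + g * n * (1.0201 * α ^ 2) := by ring
  rw [h1, hne, hLeq]
  have h2 : g * n * (1.0201 * α ^ 2) ≤ 3.25 * b * (1.0201 * α ^ 2) := by gcongr
  nlinarith [mul_pos ha0 hα2, mul_pos hb0 hα2]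

end Step

/-- `Y` and the triangular matrix `V` behave like the factors of a QR step applied to `X`: the
Cholesky factor `V` of `Xᵀ X + σ I` and the product `X V⁻¹`, up to small backward errors. -/
structure ApproxQR {m n : ℕ} (u lam σ : ℝ) (X Y : Matrix (Fin m) (Fin n) ℝ)
    (V : Matrix (Fin n) (Fin n) ℝ) : Prop where
  isUnit_det : IsUnit V.det
  gram : normF (Vᵀ * V - (Xᵀ * X + σ • (1 : Matrix (Fin n) (Fin n) ℝ))) ≤
    11 / 3 * gramError m n u lam * normG X ^ 2
  normF_le : normF V ≤ √(n : ℝ) * (1.01 * normG X)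
  solve : normF (Y * V - X) ≤ 2.24 * lam * √(n : ℝ) * u * normF Y * normF V

section Step

variable {m n : ℕ} {u lam : ℝ} {d : FlOp m n → ℝ}

theorem approxQR_of_chol (h : SmallRoundoff m n u lam)
    (hd : SmallRelErrors u (2.24 * lam * √(m : ℝ) * u) (2.24 * lam * √(n : ℝ) * u) d) (s : Fin 3)
    {X : Matrix (Fin m) (Fin n) ℝ} {σ : ℝ} (hσ : σ ≤ 11 * gramError m n u lam * normG X ^ 2)
    (hX : 0 < normG X)
    (hlow : ∀ x, 11 * gramError m n u lam * normG X ^ 2 * vecNorm x ^ 2 ≤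
      vecNorm (X *ᵥ x) ^ 2 + σ * vecNorm x ^ 2)
    {A : Matrix (Fin n) (Fin n) ℝ}
    (hA : ∀ i j, i ≤ j → |A i j - (Xᵀ * X + σ • (1 : Matrix (Fin n) (Fin n) ℝ)) i j| ≤
      3.27 * (lam * √(m : ℝ) * u) * normG X ^ 2) :
    CholRuns d s A ∧ ApproxQR u lam σ X (flSolve d s X (flChol d s A)) (flChol d s A) := by
  obtain ⟨h1, h2, h3, h4⟩ := chol_step h hd s hσ hX hlow hA
  have htri : ∀ k j, j < k → flChol d s A k j = 0 := fun k j hjk => flChol_apply_of_lt d s A hjk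
  have hlam := h.lam_pos
  have hu := h.u_pos
  refine ⟨h1, ⟨?_, h3, normF_le_of_vecNorm_col_le (by positivity) h4, ?_⟩⟩
  · rw [Matrix.det_of_isUpperTriangular fun k j hjk => htri k j hjk, isUnit_iff_ne_zero]
    exact Finset.prod_ne_zero_iff.2 fun j _ => h2 j
  · exact normF_le_of_entry_le_mul (by positivity)
      (abs_flSolve_mul_sub_le hd (by linarith [h.u_le_const]) s X htri h2)

theorem abs_flGram_sub_le_normG (h : SmallRoundoff m n u lam)
    (hd : SmallRelErrors u (2.24 * lam * √(m : ℝ) * u) (2.24 * lam * √(n : ℝ) * u) d) (s : Fin 3)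
    (X : Matrix (Fin m) (Fin n) ℝ) (i j : Fin n) :
    |flGram d s X i j - (Xᵀ * X) i j| ≤ 2.24 * (lam * √(m : ℝ) * u) * normG X ^ 2 := by
  have hlam := h.lam_pos
  have hu := h.u_pos
  refine (abs_flGram_sub_le hd s X i j).trans ?_
  have h1 : ∑ k, |X k i| * |X k j| ≤ normG X ^ 2 := by
    refine (abs_sum_mul_le_vecNorm (Xᵀ i) (Xᵀ j)).trans ?_
    rw [sq]
    exact mul_le_mul (vecNorm_col_le_normG X i) (vecNorm_col_le_normG X j) (vecNorm_nonneg _)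
      (normG_nonneg X)
  rw [show 2.24 * lam * √(m : ℝ) * u = 2.24 * (lam * √(m : ℝ) * u) by ring]
  gcongr

theorem cholQR_spec (h : SmallRoundoff m n u lam)
    (hd : SmallRelErrors u (2.24 * lam * √(m : ℝ) * u) (2.24 * lam * √(n : ℝ) * u) d) (s : Fin 3)
    {X : Matrix (Fin m) (Fin n) ℝ} (hX : 0 < normG X)
    (hlow : ∀ x, 11 * gramError m n u lam * normG X ^ 2 * vecNorm x ^ 2 ≤ vecNorm (X *ᵥ x) ^ 2) :
    (cholQR d s X).runs ∧ ApproxQR u lam 0 X (cholQR d s X).Q (cholQR d s X).V := by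
  have hlam := h.lam_pos
  have hu := h.u_pos
  have hL := h.gramError_pos
  refine approxQR_of_chol h hd s (by positivity) hX (by simpa using hlow) fun i j _ => ?_
  rw [zero_smul, add_zero]
  refine (abs_flGram_sub_le_normG h hd s X i j).trans ?_
  gcongr
  norm_num

theorem sCholQR_spec (h : SmallRoundoff m n u lam)
    (hd : SmallRelErrors u (2.24 * lam * √(m : ℝ) * u) (2.24 * lam * √(n : ℝ) * u) d) (s : Fin 3)
    {X : Matrix (Fin m) (Fin n) ℝ} (hX : 0 < normG X) :
    (sCholQR d s (shift3C u lam X) X).runs ∧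
      ApproxQR u lam (11 * gramError m n u lam * normG X ^ 2) X
        (sCholQR d s (shift3C u lam X) X).Q (sCholQR d s (shift3C u lam X) X).V := by
  have hlam := h.lam_pos
  have hu := h.u_pos
  have hL := h.gramError_pos
  have hL1 := h.gramError_le
  have hσ : shift3C u lam X = 11 * gramError m n u lam * normG X ^ 2 := by
    rw [shift3C, gramError]
    ring
  rw [hσ]
  set L := gramError m n u lam
  set α := normG X
  have hα2 : 0 < α ^ 2 := by positivity
  refine approxQR_of_chol h hd s le_rfl hX
    (fun x => le_add_of_nonneg_left (sq_nonneg _)) fun i j _ => ?_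
  have hgram := abs_flGram_sub_le_normG h hd s X i j
  have hle : 2.24 * (lam * √(m : ℝ) * u) * α ^ 2 ≤ 3.27 * (lam * √(m : ℝ) * u) * α ^ 2 := by
    gcongr
    norm_num
  by_cases hij : i = j
  · subst hij
    have hii : (Xᵀ * X) i i = vecNorm (Xᵀ i) ^ 2 := by
      rw [vecNorm_sq]
      simp [Matrix.mul_apply, sq]
    have hle1 : vecNorm (Xᵀ i) ^ 2 ≤ α ^ 2 :=
      pow_le_pow_left₀ (vecNorm_nonneg _) (vecNorm_col_le_normG X i) 2
    have hau := h.sqrt_m_mul_u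
    have hU : |flGram d s X i i + 11 * L * α ^ 2| ≤ 1.02 * α ^ 2 := by
      have h1 : 2.24 * (lam * √(m : ℝ) * u) * α ^ 2 ≤ 2.24 * (1 / 2200) * α ^ 2 := by gcongr
      have h2 : 11 * L * α ^ 2 ≤ 11 * (1 / 1100) * α ^ 2 := by gcongr
      have h3 : 0 ≤ 11 * L * α ^ 2 := by positivity
      rw [abs_le] at hgram ⊢
      rw [hii] at hgram
      constructor <;> nlinarith [hgram.1, hgram.2, sq_nonneg (vecNorm (Xᵀ i))]
    have hδ := hd.abs_le (.shiftAdd s i)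
    have hmul : |(flGram d s X i i + 11 * L * α ^ 2) * d (.shiftAdd s i)| ≤ 1.02 * α ^ 2 * u := by
      rw [abs_mul]
      exact mul_le_mul hU hδ (abs_nonneg _) (by positivity)
    have hA : flShift d s (11 * L * α ^ 2) (flGram d s X) i i -
        (Xᵀ * X + (11 * L * α ^ 2) • 1 : Matrix (Fin n) (Fin n) ℝ) i i =
        (flGram d s X i i - (Xᵀ * X) i i) +
          (flGram d s X i i + 11 * L * α ^ 2) * d (.shiftAdd s i) := by
      simp [flShift]
      ring
    rw [hA]
    refine (abs_add_le _ _).trans ((add_le_add hgram hmul).trans ?_)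
    have h4 : 1.02 * α ^ 2 * u ≤ 1.02 * α ^ 2 * (lam * √(m : ℝ) * u) := by
      gcongr
      exact h.u_le
    have h5 : 0 ≤ α ^ 2 * (lam * √(m : ℝ) * u) := by positivity
    linarith
  · have hA : flShift d s (11 * L * α ^ 2) (flGram d s X) i j -
        (Xᵀ * X + (11 * L * α ^ 2) • 1 : Matrix (Fin n) (Fin n) ℝ) i j =
        flGram d s X i j - (Xᵀ * X) i j := by
      simp [flShift, hij]
    rw [hA]
    exact hgram.trans hle

end Step

/-! ### Singular values of the computed orthogonal factors -/

/-- The unit `lam n √n u` of the backward errors of substitutions and products. -/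
noncomputable def solveError (n : ℕ) (u lam : ℝ) : ℝ := lam * n * √(n : ℝ) * u

namespace SmallRoundoff

variable {m n : ℕ} {u lam : ℝ}

theorem solveError_pos (h : SmallRoundoff m n u lam) : 0 < solveError n u lam := by
  have := h.lam_pos
  have := h.u_pos
  have := h.one_le_cast
  have := h.one_le_sqrt_n
  rw [solveError]
  positivity

theorem two_mul_solveError_le (h : SmallRoundoff m n u lam) :
    2 * solveError n u lam ≤ gramError m n u lam := by
  have hc : 0 ≤ lam * n * u := by
    have := h.lam_pos
    have := h.u_pos
    positivity
  rw [gramError_eq, solveError]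
  nlinarith [mul_le_mul_of_nonneg_left h.sqrt_n_le hc,
    mul_le_mul_of_nonneg_left h.sqrt_n_le_sqrt_m hc]

theorem solveError_le (h : SmallRoundoff m n u lam) : solveError n u lam ≤ 1 / 2200 := by
  linarith [h.two_mul_solveError_le, h.gramError_le]

theorem solveError_sq_le (h : SmallRoundoff m n u lam) :
    solveError n u lam ^ 2 ≤ gramError m n u lam / 4400 := by
  nlinarith [h.two_mul_solveError_le, h.solveError_le, h.solveError_pos]

end SmallRoundoff

namespace ApproxQR

variable {m n : ℕ} {u lam σ : ℝ} {X Y : Matrix (Fin m) (Fin n) ℝ} {V : Matrix (Fin n) (Fin n) ℝ}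

theorem exists_mulVec_eq (hV : ApproxQR u lam σ X Y V) (x : Fin n → ℝ) : ∃ y, V *ᵥ y = x :=
  ⟨V⁻¹ *ᵥ x, by rw [Matrix.mulVec_mulVec, Matrix.mul_nonsing_inv _ hV.isUnit_det,
    Matrix.one_mulVec]⟩

theorem abs_vecNorm_sq_sub_le (hV : ApproxQR u lam σ X Y V) (y : Fin n → ℝ) :
    |vecNorm (V *ᵥ y) ^ 2 - (vecNorm (X *ᵥ y) ^ 2 + σ * vecNorm y ^ 2)| ≤
      11 / 3 * gramError m n u lam * normG X ^ 2 * vecNorm y ^ 2 := by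
  have h1 := abs_dotProduct_mulVec_le (Vᵀ * V - (Xᵀ * X + σ • (1 : Matrix (Fin n) (Fin n) ℝ))) y
  rw [Matrix.sub_mulVec, dotProduct_sub, Matrix.add_mulVec, dotProduct_add,
    dotProduct_transpose_mul_self_mulVec, dotProduct_transpose_mul_self_mulVec, Matrix.smul_mulVec,
    dotProduct_smul, Matrix.one_mulVec, ← vecNorm_sq_eq_dotProduct, smul_eq_mul] at h1
  exact h1.trans (mul_le_mul_of_nonneg_right hV.gram (sq_nonneg _))

theorem norm2_le (hV : ApproxQR u lam σ X Y V) (h : SmallRoundoff m n u lam)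
    (hσ : σ ≤ 11 * gramError m n u lam * normG X ^ 2) : norm2 V ≤ 1.007 * norm2 X := by
  refine norm2_le_of_forall (by have := norm2_nonneg X; positivity) fun y => ?_
  have hX := norm2_nonneg X
  have hy := vecNorm_nonneg y
  refine (abs_le_of_sq_le_sq' ?_ (by positivity)).2
  have h1 := (abs_le.1 (hV.abs_vecNorm_sq_sub_le y)).2
  have h2 := pow_le_pow_left₀ (vecNorm_nonneg _) (vecNorm_mulVec_le X y) 2
  have h3 : σ * vecNorm y ^ 2 ≤ 11 * gramError m n u lam * normG X ^ 2 * vecNorm y ^ 2 := by gcongr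
  have h4 : gramError m n u lam * normG X ^ 2 * vecNorm y ^ 2 ≤
      1 / 1100 * norm2 X ^ 2 * vecNorm y ^ 2 := by
    have := h.gramError_pos
    have := normG_nonneg X
    gcongr
    · exact h.gramError_le
    · exact normG_le_norm2 X
  have h5 : 0 ≤ norm2 X ^ 2 * vecNorm y ^ 2 := by positivity
  rw [mul_pow, mul_pow]
  rw [mul_pow] at h2
  nlinarith

theorem normF_solve_le (hV : ApproxQR u lam σ X Y V) (h : SmallRoundoff m n u lam) {c : ℝ}
    (hY : normF Y ≤ √(n : ℝ) * c) :
    normF (Y * V - X) ≤ 2.2624 * solveError n u lam * c * normG X := by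
  have hlam := h.lam_pos
  have hu := h.u_pos
  have hs : √(n : ℝ) * √(n : ℝ) = n := Real.mul_self_sqrt (Nat.cast_nonneg n)
  have hc : 0 ≤ √(n : ℝ) * c := (normF_nonneg Y).trans hY
  calc normF (Y * V - X) ≤ 2.24 * lam * √(n : ℝ) * u * normF Y * normF V := hV.solve
    _ ≤ 2.24 * lam * √(n : ℝ) * u * (√(n : ℝ) * c) * (√(n : ℝ) * (1.01 * normG X)) := by
      gcongr
      exacts [normF_nonneg V, hV.normF_le]
    _ = 2.2624 * (lam * (√(n : ℝ) * √(n : ℝ)) * √(n : ℝ) * u) * c * normG X := by ring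
    _ = _ := by rw [hs, solveError]

theorem normF_solve_le_normG (hV : ApproxQR u lam σ X Y V) (h : SmallRoundoff m n u lam) :
    normF (Y * V - X) ≤ 2.2624 * solveError n u lam * normG Y * normG X :=
  hV.normF_solve_le h (normF_le_sqrt_mul_normG Y)

theorem normF_solve_le_norm2 (hV : ApproxQR u lam σ X Y V) (h : SmallRoundoff m n u lam) :
    normF (Y * V - X) ≤ 2.2624 * solveError n u lam * norm2 Y * normG X :=
  hV.normF_solve_le h ((normF_le_sqrt_mul_normG Y).trans
    (mul_le_mul_of_nonneg_left (normG_le_norm2 Y) (Real.sqrt_nonneg _)))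

theorem normG_pos (hV : ApproxQR u lam σ X Y V) (h : SmallRoundoff m n u lam) (hX : 0 < normG X) :
    0 < normG Y := by
  refine (normG_nonneg Y).lt_of_ne fun h0 => ?_
  have h1 := hV.normF_solve_le_normG h
  rw [← h0, mul_zero, zero_mul, eq_zero_of_normG_eq_zero h0.symm, Matrix.zero_mul, zero_sub,
    normF_neg] at h1
  have h2 := (normG_le_norm2 X).trans (norm2_le_normF X)
  linarith

theorem mulVec_mulVec_eq_add (y : Fin n → ℝ) :
    Y *ᵥ (V *ᵥ y) = X *ᵥ y + (Y * V - X) *ᵥ y := by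
  rw [Matrix.sub_mulVec, Matrix.mulVec_mulVec]
  abel

/-- A step with the full shift yields a factor of norm hardly above `1`. -/
theorem norm2_Q_le (hV : ApproxQR u lam (11 * gramError m n u lam * normG X ^ 2) X Y V)
    (h : SmallRoundoff m n u lam) : norm2 Y ≤ 1.014 := by
  have hY := norm2_nonneg Y
  have key : norm2 Y ≤ 1 + 0.013 * norm2 Y := by
    refine norm2_le_of_forall (by positivity) fun x => ?_
    obtain ⟨y, rfl⟩ := hV.exists_mulVec_eq x
    have h1 := (abs_le.1 (hV.abs_vecNorm_sq_sub_le y)).1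
    have hL := h.gramError_pos
    have hε := h.solveError_pos
    have hG := normG_nonneg X
    have hy := vecNorm_nonneg y
    have hx := vecNorm_nonneg (V *ᵥ y)
    have hpos : 0 ≤ gramError m n u lam * normG X ^ 2 * vecNorm y ^ 2 := by positivity
    have h2 : vecNorm (X *ᵥ y) ≤ vecNorm (V *ᵥ y) :=
      (abs_le_of_sq_le_sq' (by linarith) hx).2
    have h3 : 2.2624 * solveError n u lam * normG X * vecNorm y ≤ 0.013 * vecNorm (V *ᵥ y) := by
      refine (abs_le_of_sq_le_sq' ?_ (by positivity)).2
      have h4 : solveError n u lam ^ 2 * (normG X ^ 2 * vecNorm y ^ 2) ≤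
          gramError m n u lam / 4400 * (normG X ^ 2 * vecNorm y ^ 2) :=
        mul_le_mul_of_nonneg_right h.solveError_sq_le (by positivity)
      nlinarith [sq_nonneg (vecNorm (X *ᵥ y))]
    have h5 := (vecNorm_mulVec_le (Y * V - X) y).trans
      (mul_le_mul_of_nonneg_right ((norm2_le_normF _).trans (hV.normF_solve_le_norm2 h)) hy)
    rw [mulVec_mulVec_eq_add (X := X)]
    refine (vecNorm_add_le _ _).trans ?_
    nlinarith [mul_le_mul_of_nonneg_left h3 hY]
  linarith

/-- A lower bound `τ` for `X` that dominates the error of the substitution is inherited by the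
orthogonal factor, relative to the shift. -/
theorem le_vecNorm_mulVec (hV : ApproxQR u lam (11 * gramError m n u lam * normG X ^ 2) X Y V)
    {τ θ : ℝ} (hτ : 0 ≤ τ) (hX : ∀ y, τ * vecNorm y ≤ vecNorm (X *ᵥ y)) (hθ1 : θ ≤ 1)
    (hE : normF (Y * V - X) ≤ θ * τ) (x : Fin n → ℝ) :
    (1 - θ) ^ 2 * τ ^ 2 * vecNorm x ^ 2 ≤
      (τ ^ 2 + 44 / 3 * gramError m n u lam * normG X ^ 2) * vecNorm (Y *ᵥ x) ^ 2 := by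
  obtain ⟨y, rfl⟩ := hV.exists_mulVec_eq x
  have h1 := (abs_le.1 (hV.abs_vecNorm_sq_sub_le y)).2
  have hy := vecNorm_nonneg y
  rcases eq_or_lt_of_le hτ with rfl | hτ
  · have hL : 0 ≤ 44 / 3 * gramError m n u lam * normG X ^ 2 := by
      linarith [(normF_nonneg _).trans hV.gram]
    rw [zero_pow two_ne_zero, mul_zero, zero_mul, zero_add]
    positivity
  have hθ : 0 ≤ θ := nonneg_of_mul_nonneg_left ((normF_nonneg _).trans hE) hτ
  set c := 44 / 3 * gramError m n u lam * normG X ^ 2 with hc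
  have hc0 : 0 ≤ c := by linarith [(normF_nonneg _).trans hV.gram]
  have h2 : (1 - θ) * vecNorm (X *ᵥ y) ≤ vecNorm (Y *ᵥ (V *ᵥ y)) := by
    rw [mulVec_mulVec_eq_add (X := X)]
    refine le_trans ?_ (vecNorm_sub_le_vecNorm_add _ _)
    have h3 := (vecNorm_mulVec_le (Y * V - X) y).trans
      (mul_le_mul_of_nonneg_right ((norm2_le_normF _).trans hE) hy)
    nlinarith [mul_le_mul_of_nonneg_left (hX y) hθ]
  have h4 : τ ^ 2 * vecNorm y ^ 2 ≤ vecNorm (X *ᵥ y) ^ 2 := by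
    rw [← mul_pow]
    exact pow_le_pow_left₀ (by positivity) (hX y) 2
  have h5 : τ ^ 2 * vecNorm (V *ᵥ y) ^ 2 ≤ (τ ^ 2 + c) * vecNorm (X *ᵥ y) ^ 2 := by
    have h6 : vecNorm (V *ᵥ y) ^ 2 ≤ vecNorm (X *ᵥ y) ^ 2 + c * vecNorm y ^ 2 := by
      rw [hc]; linarith
    nlinarith [mul_le_mul_of_nonneg_left h6 (sq_nonneg τ), mul_le_mul_of_nonneg_left h4 hc0]
  have h7 : ((1 - θ) * vecNorm (X *ᵥ y)) ^ 2 ≤ vecNorm (Y *ᵥ (V *ᵥ y)) ^ 2 :=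
    pow_le_pow_left₀ (mul_nonneg (by linarith) (vecNorm_nonneg _)) h2 2
  calc (1 - θ) ^ 2 * τ ^ 2 * vecNorm (V *ᵥ y) ^ 2
      = (1 - θ) ^ 2 * (τ ^ 2 * vecNorm (V *ᵥ y) ^ 2) := by ring
    _ ≤ (1 - θ) ^ 2 * ((τ ^ 2 + c) * vecNorm (X *ᵥ y) ^ 2) := by gcongr
    _ = (τ ^ 2 + c) * ((1 - θ) * vecNorm (X *ᵥ y)) ^ 2 := by ring
    _ ≤ (τ ^ 2 + c) * vecNorm (Y *ᵥ (V *ᵥ y)) ^ 2 := by gcongr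

end ApproxQR

/-! ### The unshifted step -/

namespace ApproxQR

variable {m n : ℕ} {u lam : ℝ} {X Y : Matrix (Fin m) (Fin n) ℝ} {V : Matrix (Fin n) (Fin n) ℝ}
  {τ : ℝ}

theorem vecNorm_sq_ge (hV : ApproxQR u lam 0 X Y V)
    (hX : ∀ y, τ * vecNorm y ≤ vecNorm (X *ᵥ y)) (hτ0 : 0 ≤ τ)
    (hτ : 64 * gramError m n u lam * normG X ^ 2 ≤ τ ^ 2) (y : Fin n → ℝ) :
    0.94 * vecNorm (X *ᵥ y) ^ 2 ≤ vecNorm (V *ᵥ y) ^ 2 := by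
  have h1 := (abs_le.1 (hV.abs_vecNorm_sq_sub_le y)).1
  have h2 : τ ^ 2 * vecNorm y ^ 2 ≤ vecNorm (X *ᵥ y) ^ 2 := by
    rw [← mul_pow]
    exact pow_le_pow_left₀ (mul_nonneg hτ0 (vecNorm_nonneg y)) (hX y) 2
  have h3 := mul_le_mul_of_nonneg_right hτ (sq_nonneg (vecNorm y))
  linarith [sq_nonneg (vecNorm (X *ᵥ y))]

theorem vecNorm_le (hV : ApproxQR u lam 0 X Y V)
    (hX : ∀ y, τ * vecNorm y ≤ vecNorm (X *ᵥ y)) (hτ0 : 0 ≤ τ)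
    (hτ : 64 * gramError m n u lam * normG X ^ 2 ≤ τ ^ 2) (y : Fin n → ℝ) :
    vecNorm (X *ᵥ y) ≤ 1.032 * vecNorm (V *ᵥ y) := by
  have hx := vecNorm_nonneg (V *ᵥ y)
  refine (abs_le_of_sq_le_sq' ?_ (by positivity)).2
  have := hV.vecNorm_sq_ge hX hτ0 hτ y
  nlinarith

theorem solve_vecNorm_le (hV : ApproxQR u lam 0 X Y V) (h : SmallRoundoff m n u lam)
    (hX : ∀ y, τ * vecNorm y ≤ vecNorm (X *ᵥ y)) (hτ0 : 0 < τ)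
    (hτ : 64 * gramError m n u lam * normG X ^ 2 ≤ τ ^ 2) (y : Fin n → ℝ) :
    vecNorm ((Y * V - X) *ᵥ y) ≤ 0.0045 * norm2 Y * vecNorm (V *ᵥ y) := by
  have hy := vecNorm_nonneg y
  have hG := normG_nonneg X
  have hε := h.solveError_pos
  have hL := h.gramError_pos
  have hY := norm2_nonneg Y
  have h1 := (vecNorm_mulVec_le (Y * V - X) y).trans
    (mul_le_mul_of_nonneg_right ((norm2_le_normF _).trans (hV.normF_solve_le_norm2 h)) hy)
  have h2 : 2.2624 * solveError n u lam * normG X ≤ 0.0043 * τ := by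
    refine (abs_le_of_sq_le_sq' ?_ (by positivity)).2
    have := mul_le_mul_of_nonneg_right h.solveError_sq_le (sq_nonneg (normG X))
    nlinarith
  have h3 := mul_le_mul_of_nonneg_right h2 hy
  have h4 : 2.2624 * solveError n u lam * normG X * vecNorm y ≤ 0.0045 * vecNorm (V *ᵥ y) := by
    linarith [hX y, hV.vecNorm_le hX hτ0.le hτ y, vecNorm_nonneg (V *ᵥ y)]
  refine h1.trans ?_
  nlinarith [mul_le_mul_of_nonneg_left h4 hY]

theorem norm2_Q_le_of_unshifted (hV : ApproxQR u lam 0 X Y V) (h : SmallRoundoff m n u lam)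
    (hX : ∀ y, τ * vecNorm y ≤ vecNorm (X *ᵥ y)) (hτ0 : 0 < τ)
    (hτ : 64 * gramError m n u lam * normG X ^ 2 ≤ τ ^ 2) : norm2 Y ≤ 1.04 := by
  have hY := norm2_nonneg Y
  have key : norm2 Y ≤ 1.032 + 0.0045 * norm2 Y := by
    refine norm2_le_of_forall (by positivity) fun x => ?_
    obtain ⟨y, rfl⟩ := hV.exists_mulVec_eq x
    rw [mulVec_mulVec_eq_add (X := X)]
    refine (vecNorm_add_le _ _).trans ?_
    linarith [hV.vecNorm_le hX hτ0.le hτ y, hV.solve_vecNorm_le h hX hτ0 hτ y]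
  linarith

/-- Loss of orthogonality of an unshifted step. While `τ` only has to dominate the backward error,
the bound is governed by any lower bound `ρ` for the singular values of `X`. -/
theorem normF_transpose_mul_self_sub_one_le (hV : ApproxQR u lam 0 X Y V)
    (h : SmallRoundoff m n u lam) (hX : ∀ y, τ * vecNorm y ≤ vecNorm (X *ᵥ y)) (hτ0 : 0 < τ)
    (hτ : 64 * gramError m n u lam * normG X ^ 2 ≤ τ ^ 2) {ρ : ℝ} (hρ0 : 0 < ρ)
    (hρ : ∀ y, ρ * vecNorm y ≤ vecNorm (X *ᵥ y)) :
    normF (Yᵀ * Y - 1) ≤ 4 * gramError m n u lam * (normG X / ρ) ^ 2 +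
      5.1 * solveError n u lam * (normG X / ρ) := by
  have hY := norm2_nonneg Y
  have hY1 := hV.norm2_Q_le_of_unshifted h hX hτ0 hτ
  have hG := normG_nonneg X
  have hε := h.solveError_pos
  have hL := h.gramError_pos
  set L := gramError m n u lam
  set ε := solveError n u lam
  set K := norm2 V⁻¹
  have hK0 : 0 ≤ K := norm2_nonneg _
  have hinv : ∀ x, V *ᵥ (V⁻¹ *ᵥ x) = x := fun x => by
    rw [Matrix.mulVec_mulVec, Matrix.mul_nonsing_inv _ hV.isUnit_det, Matrix.one_mulVec]
  have hK2 : ρ * K ≤ 1.032 := by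
    rw [← le_div_iff₀' hρ0]
    refine norm2_le_of_forall (by positivity) fun x => ?_
    rw [div_mul_eq_mul_div, le_div_iff₀' hρ0]
    have h1 := hV.vecNorm_le hX hτ0.le hτ (V⁻¹ *ᵥ x)
    rw [hinv] at h1
    exact (hρ _).trans h1
  set W := X * V⁻¹ with hW
  set F := (Y * V - X) * V⁻¹ with hF
  have hYWF : Y = W + F := by
    rw [hW, hF, ← Matrix.add_mul, add_sub_cancel, Matrix.mul_assoc,
      Matrix.mul_nonsing_inv _ hV.isUnit_det, Matrix.mul_one]
  have hW1 : norm2 W ≤ 1.032 := norm2_le_of_forall (by norm_num) fun x => by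
    have h1 := hV.vecNorm_le hX hτ0.le hτ (V⁻¹ *ᵥ x)
    rwa [hinv, Matrix.mulVec_mulVec] at h1
  have hF1 : norm2 F ≤ 0.005 := norm2_le_of_forall (by norm_num) fun x => by
    have h1 := hV.solve_vecNorm_le h hX hτ0 hτ (V⁻¹ *ᵥ x)
    rw [hinv, Matrix.mulVec_mulVec] at h1
    nlinarith [vecNorm_nonneg x]
  have hF2 : normF F ≤ 2.43 * ε * (normG X / ρ) := by
    refine (normF_mul_le_mul_norm2 _ _).trans ?_
    have h1 : normF (Y * V - X) ≤ 2.2624 * ε * 1.04 * normG X :=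
      (hV.normF_solve_le_norm2 h).trans (by gcongr)
    have h2 : K ≤ 1.032 / ρ := by rwa [le_div_iff₀' hρ0]
    calc normF (Y * V - X) * K ≤ (2.2624 * ε * 1.04 * normG X) * (1.032 / ρ) :=
          mul_le_mul h1 h2 hK0 (by positivity)
      _ = 2.2624 * 1.04 * 1.032 * (ε * (normG X / ρ)) := by ring
      _ ≤ 2.43 * (ε * (normG X / ρ)) := by gcongr; norm_num
      _ = _ := by ring
  have hE : normF (Vᵀ * V - Xᵀ * X) ≤ 11 / 3 * L * normG X ^ 2 := by
    simpa using hV.gram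
  have hWW : Wᵀ * W - 1 = -((V⁻¹)ᵀ * (Vᵀ * V - Xᵀ * X) * V⁻¹) := by
    have h1 : (V⁻¹)ᵀ * (Vᵀ * V) * V⁻¹ = 1 := by
      rw [← Matrix.mul_assoc, Matrix.mul_assoc, Matrix.mul_nonsing_inv _ hV.isUnit_det,
        Matrix.mul_one, ← Matrix.transpose_mul, Matrix.mul_nonsing_inv _ hV.isUnit_det,
        Matrix.transpose_one]
    rw [Matrix.mul_sub, Matrix.sub_mul, h1, neg_sub, hW, Matrix.transpose_mul]
    simp only [Matrix.mul_assoc]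
  have hWW1 : normF (Wᵀ * W - 1) ≤ 3.91 * L * (normG X / ρ) ^ 2 := by
    rw [hWW, normF_neg]
    refine (normF_mul_le_mul_norm2 _ _).trans ?_
    have h1 := normF_mul_le_norm2_mul (V⁻¹)ᵀ (Vᵀ * V - Xᵀ * X)
    rw [norm2_transpose] at h1
    have h2 : K ≤ 1.032 / ρ := by rwa [le_div_iff₀' hρ0]
    calc normF ((V⁻¹)ᵀ * (Vᵀ * V - Xᵀ * X)) * K ≤ K * (11 / 3 * L * normG X ^ 2) * K := by
          gcongr
          exact h1.trans (by gcongr)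
      _ ≤ (1.032 / ρ) * (11 / 3 * L * normG X ^ 2) * (1.032 / ρ) := by gcongr
      _ = 11 / 3 * 1.032 ^ 2 * (L * (normG X / ρ) ^ 2) := by ring
      _ ≤ 3.91 * (L * (normG X / ρ) ^ 2) := by gcongr; norm_num
      _ = _ := by ring
  have hsplit : Yᵀ * Y - 1 = (Wᵀ * W - 1) + (Wᵀ * F + (Fᵀ * W + Fᵀ * F)) := by
    rw [hYWF, Matrix.transpose_add, Matrix.add_mul, Matrix.mul_add, Matrix.mul_add]
    abel
  have hWF : normF (Wᵀ * F) ≤ 1.032 * normF F :=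
    (normF_mul_le_norm2_mul _ _).trans (by
      rw [norm2_transpose]
      exact mul_le_mul_of_nonneg_right hW1 (normF_nonneg F))
  have hFW : normF (Fᵀ * W) ≤ 1.032 * normF F :=
    (normF_mul_le_mul_norm2 _ _).trans (by
      rw [normF_transpose, mul_comm]
      exact mul_le_mul_of_nonneg_right hW1 (normF_nonneg F))
  have hFF : normF (Fᵀ * F) ≤ 0.005 * normF F :=
    (normF_mul_le_norm2_mul _ _).trans (by
      rw [norm2_transpose]
      exact mul_le_mul_of_nonneg_right hF1 (normF_nonneg F))
  rw [hsplit]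
  have h1 := normF_add_le (Wᵀ * W - 1) (Wᵀ * F + (Fᵀ * W + Fᵀ * F))
  have h2 := normF_add_le (Wᵀ * F) (Fᵀ * W + Fᵀ * F)
  have h3 := normF_add_le (Fᵀ * W) (Fᵀ * F)
  have h4 : 0 ≤ L * (normG X / ρ) ^ 2 := by positivity
  have h5 : 0 ≤ ε * (normG X / ρ) := by positivity
  linarith

end ApproxQR

/-! ### Residual of the algorithm -/

section Residual

variable {m n : ℕ} {u lam : ℝ} {d : FlOp m n → ℝ}

theorem normF_flMul_sub_le (h : SmallRoundoff m n u lam)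
    (hd : SmallRelErrors u (2.24 * lam * √(m : ℝ) * u) (2.24 * lam * √(n : ℝ) * u) d) (w : Fin 2)
    {A B : Matrix (Fin n) (Fin n) ℝ} {a b : ℝ} (hA : normF A ≤ √(n : ℝ) * a)
    (hB : normF B ≤ √(n : ℝ) * b) :
    normF (flMul d w A B - A * B) ≤ 2.24 * solveError n u lam * a * b := by
  have hlam := h.lam_pos
  have hu := h.u_pos
  have hs : √(n : ℝ) * √(n : ℝ) = n := Real.mul_self_sqrt (Nat.cast_nonneg n)
  have ha : 0 ≤ √(n : ℝ) * a := (normF_nonneg A).trans hA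
  calc normF (flMul d w A B - A * B) ≤ 2.24 * lam * √(n : ℝ) * u * normF A * normF B :=
        normF_le_of_entry_le_mul (by positivity) (abs_flMul_sub_le hd w A B)
    _ ≤ 2.24 * lam * √(n : ℝ) * u * (√(n : ℝ) * a) * (√(n : ℝ) * b) := by
      gcongr
      exact normF_nonneg B
    _ = 2.24 * (lam * (√(n : ℝ) * √(n : ℝ)) * √(n : ℝ) * u) * a * b := by ring
    _ = _ := by rw [hs, solveError]

/-- The residual of the product of the computed factors. Each of the three substitutions and of the
two products of triangular factors contributes one term. -/
theorem normF_residual_le (h : SmallRoundoff m n u lam)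
    (hd : SmallRelErrors u (2.24 * lam * √(m : ℝ) * u) (2.24 * lam * √(n : ℝ) * u) d)
    {T Q Q₁ Q₂ : Matrix (Fin m) (Fin n) ℝ} {V V₁ V₃ : Matrix (Fin n) (Fin n) ℝ}
    (hV : ApproxQR u lam (11 * gramError m n u lam * normG T ^ 2) T Q V)
    (hV₁ : ApproxQR u lam (11 * gramError m n u lam * normG Q ^ 2) Q Q₁ V₁)
    (hV₃ : ApproxQR u lam 0 Q₁ Q₂ V₃) (hQ₂ : norm2 Q₂ ≤ 1.04) {p₁ p₂ p₃ : ℝ}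
    (hp₁ : normG T = p₁ * norm2 T) (hp₂ : normG Q = p₂ * norm2 Q) (hp₃ : normG Q₁ = p₃ * norm2 Q₁)
    (hp₁0 : 0 ≤ p₁) (hp₂0 : 0 ≤ p₂) (hp₃0 : 0 ≤ p₃) (hp₂1 : p₂ ≤ 1) :
    normF (Q₂ * flMul d 1 V₃ (flMul d 0 V₁ V) - T) ≤
      phi2 p₁ p₂ p₃ * lam * n * √(n : ℝ) * u * norm2 T := by
  have ht0 := norm2_nonneg T
  have hε := h.solveError_pos
  have hε1 := h.solveError_le
  have hq := hV.norm2_Q_le h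
  have hr := hV₁.norm2_Q_le h
  have hv := hV.norm2_le h le_rfl
  have hv₁ : norm2 V₁ ≤ 1.007 * 1.014 :=
    (hV₁.norm2_le h le_rfl).trans (by gcongr)
  have hG₂ : normG Q ≤ 1.014 * p₂ := by
    rw [hp₂, mul_comm]
    exact mul_le_mul_of_nonneg_right hq hp₂0
  have hG₃ : normG Q₁ ≤ 1.014 * p₃ := by
    rw [hp₃, mul_comm]
    exact mul_le_mul_of_nonneg_right hr hp₃0
  have hs1 := h.one_le_sqrt_n
  set t := norm2 T
  set ε := solveError n u lam with hεdef
  have hFV : normF V ≤ √(n : ℝ) * (1.01 * (p₁ * t)) := by rw [← hp₁]; exact hV.normF_le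
  have hFV₁ : normF V₁ ≤ √(n : ℝ) * (1.01 * (1.014 * p₂)) :=
    hV₁.normF_le.trans (by gcongr)
  have hFV₃ : normF V₃ ≤ √(n : ℝ) * (1.01 * (1.014 * p₃)) :=
    hV₃.normF_le.trans (by gcongr)
  set V₂ := flMul d 0 V₁ V with hV₂
  set V₄ := flMul d 1 V₃ V₂ with hV₄
  have hD₁ : normF (V₂ - V₁ * V) ≤ 2.32 * ε * (p₁ * p₂ * t) := by
    refine (normF_flMul_sub_le h hd 0 hFV₁ hFV).trans ?_
    have : 0 ≤ ε * (p₁ * p₂ * t) := by positivity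
    linarith
  -- the middle factor inherits its norms from `V₁ V`
  have hV₂F : normF V₂ ≤ √(n : ℝ) * (1.034 * (p₁ * t)) := by
    have h1 : V₂ = V₁ * V + (V₂ - V₁ * V) := by abel
    rw [h1]
    refine (normF_add_le _ _).trans ?_
    have h2 : normF (V₁ * V) ≤ 1.007 * 1.014 * (√(n : ℝ) * (1.01 * (p₁ * t))) :=
      (normF_mul_le_norm2_mul _ _).trans
        (mul_le_mul hv₁ hFV (normF_nonneg V) (by norm_num))
    have h3 : 2.32 * ε * (p₁ * p₂ * t) ≤ 2.32 * (1 / 2200) * (p₁ * 1 * t) := by gcongr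
    have h4 : p₁ * t ≤ √(n : ℝ) * (p₁ * t) := le_mul_of_one_le_left (by positivity) hs1
    have h5 : 0 ≤ √(n : ℝ) * (p₁ * t) := by positivity
    linarith
  have hV₂2 : norm2 V₂ ≤ 1.03 * t := by
    have h1 : V₂ = V₁ * V + (V₂ - V₁ * V) := by abel
    rw [h1]
    refine (norm2_add_le _ _).trans ?_
    have h2 : norm2 (V₁ * V) ≤ 1.007 * 1.014 * (1.007 * t) :=
      (norm2_mul_le _ _).trans (mul_le_mul hv₁ hv (norm2_nonneg V) (by norm_num))
    have hp₁1 : p₁ * t ≤ t := by rw [← hp₁]; exact normG_le_norm2 T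
    have h3 : 2.32 * ε * (p₁ * p₂ * t) ≤ 2.32 * (1 / 2200) * t := by
      calc 2.32 * ε * (p₁ * p₂ * t) = 2.32 * ε * (p₂ * (p₁ * t)) := by ring
        _ ≤ 2.32 * (1 / 2200) * (1 * t) := by gcongr
        _ = _ := by ring
    have h4 := norm2_le_normF (V₂ - V₁ * V)
    linarith
  have hE₁ : normF (Q * V - T) ≤ 2.3 * ε * (p₁ * p₂ * t) := by
    refine (hV.normF_solve_le_normG h).trans ?_
    rw [hp₁]
    calc 2.2624 * ε * normG Q * (p₁ * t) ≤ 2.2624 * ε * (1.014 * p₂) * (p₁ * t) := by gcongr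
      _ = 2.2624 * 1.014 * (ε * (p₁ * p₂ * t)) := by ring
      _ ≤ 2.3 * (ε * (p₁ * p₂ * t)) := by gcongr; norm_num
      _ = _ := by ring
  have hE₂ : normF ((Q₁ * V₁ - Q) * V) ≤ 2.35 * ε * (p₂ * t) := by
    refine (normF_mul_le_mul_norm2 _ _).trans ?_
    have h1 : normF (Q₁ * V₁ - Q) ≤ 2.2624 * ε * 1.014 * (1.014 * p₂) :=
      (hV₁.normF_solve_le_norm2 h).trans (by gcongr; exact normG_nonneg Q)
    calc normF (Q₁ * V₁ - Q) * norm2 V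
        ≤ (2.2624 * ε * 1.014 * (1.014 * p₂)) * (1.007 * t) :=
          mul_le_mul h1 hv (norm2_nonneg V) (by positivity)
      _ = 2.2624 * 1.014 * 1.014 * 1.007 * (ε * (p₂ * t)) := by ring
      _ ≤ 2.35 * (ε * (p₂ * t)) := by gcongr; norm_num
      _ = _ := by ring
  have hQD : normF (Q₁ * (V₂ - V₁ * V)) ≤ 2.36 * ε * (p₁ * p₂ * t) := by
    refine (normF_mul_le_norm2_mul _ _).trans ?_
    calc norm2 Q₁ * normF (V₂ - V₁ * V) ≤ 1.014 * (2.32 * ε * (p₁ * p₂ * t)) :=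
          mul_le_mul hr hD₁ (normF_nonneg _) (by norm_num)
      _ ≤ _ := by
        have : 0 ≤ ε * (p₁ * p₂ * t) := by positivity
        linarith
  have hE₃ : normF ((Q₂ * V₃ - Q₁) * V₂) ≤ 2.5 * ε * (p₃ * t) := by
    refine (normF_mul_le_mul_norm2 _ _).trans ?_
    have h1 : normF (Q₂ * V₃ - Q₁) ≤ 2.2624 * ε * 1.04 * (1.014 * p₃) :=
      (hV₃.normF_solve_le_norm2 h).trans (by gcongr; exact normG_nonneg Q₁)
    calc normF (Q₂ * V₃ - Q₁) * norm2 V₂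
        ≤ (2.2624 * ε * 1.04 * (1.014 * p₃)) * (1.03 * t) :=
          mul_le_mul h1 hV₂2 (norm2_nonneg V₂) (by positivity)
      _ = 2.2624 * 1.04 * 1.014 * 1.03 * (ε * (p₃ * t)) := by ring
      _ ≤ 2.5 * (ε * (p₃ * t)) := by gcongr; norm_num
      _ = _ := by ring
  have hD₂ : normF (Q₂ * (V₄ - V₃ * V₂)) ≤ 2.5 * ε * (p₁ * p₃ * t) := by
    refine (normF_mul_le_norm2_mul _ _).trans ?_
    calc norm2 Q₂ * normF (V₄ - V₃ * V₂)
        ≤ 1.04 * (2.24 * ε * (1.01 * (1.014 * p₃)) * (1.034 * (p₁ * t))) :=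
          mul_le_mul hQ₂ (normF_flMul_sub_le h hd 1 hFV₃ hV₂F) (normF_nonneg _) (by norm_num)
      _ = 1.04 * 2.24 * 1.01 * 1.014 * 1.034 * (ε * (p₁ * p₃ * t)) := by ring
      _ ≤ 2.5 * (ε * (p₁ * p₃ * t)) := by gcongr; norm_num
      _ = _ := by ring
  have hsplit : Q₂ * V₄ - T = (Q * V - T) + ((Q₁ * V₁ - Q) * V + (Q₁ * (V₂ - V₁ * V) +
      ((Q₂ * V₃ - Q₁) * V₂ + Q₂ * (V₄ - V₃ * V₂)))) := by
    simp only [Matrix.sub_mul, Matrix.mul_sub, Matrix.mul_assoc]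
    abel
  have a1 := normF_add_le (Q * V - T) ((Q₁ * V₁ - Q) * V + (Q₁ * (V₂ - V₁ * V) +
    ((Q₂ * V₃ - Q₁) * V₂ + Q₂ * (V₄ - V₃ * V₂))))
  have a2 := normF_add_le ((Q₁ * V₁ - Q) * V) (Q₁ * (V₂ - V₁ * V) +
    ((Q₂ * V₃ - Q₁) * V₂ + Q₂ * (V₄ - V₃ * V₂)))
  have a3 := normF_add_le (Q₁ * (V₂ - V₁ * V)) ((Q₂ * V₃ - Q₁) * V₂ + Q₂ * (V₄ - V₃ * V₂))
  have a4 := normF_add_le ((Q₂ * V₃ - Q₁) * V₂) (Q₂ * (V₄ - V₃ * V₂))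
  rw [← hsplit] at a1
  have hphi : phi2 p₁ p₂ p₃ * lam * n * √(n : ℝ) * u * t = phi2 p₁ p₂ p₃ * (ε * t) := by
    rw [hεdef, solveError]
    ring
  rw [hphi, phi2]
  have b0 : 0 ≤ ε * t := by positivity
  have b1 : ε * (p₁ * p₂ * t) ≤ p₁ * (ε * t) := by
    calc ε * (p₁ * p₂ * t) = p₁ * (ε * t) * p₂ := by ring
      _ ≤ p₁ * (ε * t) := mul_le_of_le_one_right (by positivity) hp₂1
  have b2 : 0 ≤ p₂ * (ε * t) := by positivity
  have b3 : 0 ≤ p₃ * (ε * t) := by positivity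
  have b4 : 0 ≤ p₁ * p₃ * (ε * t) := by positivity
  have b5 : 0 ≤ p₁ * p₂ * (ε * t) := by positivity
  nlinarith

end Residual

/-! ### The algorithm -/

section Algorithm

variable {m n : ℕ} {u lam : ℝ} {d : FlOp m n → ℝ}

theorem normG_eq_pRatio_mul (X : Matrix (Fin m) (Fin n) ℝ) : normG X = pRatio X * norm2 X := by
  rcases (norm2_nonneg X).eq_or_lt with h0 | h0
  · rw [← h0, mul_zero]
    exact le_antisymm (h0 ▸ normG_le_norm2 X) (normG_nonneg X)
  · rw [pRatio, div_mul_cancel₀ _ h0.ne']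

theorem pRatio_nonneg (X : Matrix (Fin m) (Fin n) ℝ) : 0 ≤ pRatio X :=
  div_nonneg (normG_nonneg X) (norm2_nonneg X)

theorem pRatio_le_one (X : Matrix (Fin m) (Fin n) ℝ) : pRatio X ≤ 1 :=
  div_le_one_of_le₀ (normG_le_norm2 X) (norm2_nonneg X)

theorem norm2_pos_of_normG_pos {X : Matrix (Fin m) (Fin n) ℝ} (hX : 0 < normG X) : 0 < norm2 X :=
  hX.trans_le (normG_le_norm2 X)

theorem pRatio_pos {X : Matrix (Fin m) (Fin n) ℝ} (hX : 0 < normG X) : 0 < pRatio X :=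
  div_pos hX (norm2_pos_of_normG_pos hX)

theorem one_le_sqrt_mul_pRatio {X : Matrix (Fin m) (Fin n) ℝ} (hX : 0 < normG X) :
    1 ≤ √(n : ℝ) * pRatio X := by
  rw [pRatio, ← mul_div_assoc, one_le_div (norm2_pos_of_normG_pos hX)]
  exact (norm2_le_normF X).trans (normF_le_sqrt_mul_normG X)

/-- Under the assumption on `κ₂(T)`, the error of the first substitution is at most about half of
the least singular value of `T`; the least singular value of `Q` then dominates the error of the
second substitution. -/
theorem le_vecNorm_Q_mulVec (h : SmallRoundoff m n u lam)
    {T Q : Matrix (Fin m) (Fin n) ℝ} {V : Matrix (Fin n) (Fin n) ℝ}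
    (hV : ApproxQR u lam (11 * gramError m n u lam * normG T ^ 2) T Q V) (hT : 0 < normG T)
    (hσ : 0 < sigmaMin T)
    (hκ : kappa2 T ≤ 1 / (4.89 * lam * pRatio T * pRatio Q * n * √(n : ℝ) * u)) (x : Fin n → ℝ) :
    0.45 * (solveError n u lam * pRatio Q) ^ 2 * vecNorm x ^ 2 ≤
      gramError m n u lam * vecNorm (Q *ᵥ x) ^ 2 := by
  have hQ := hV.normG_pos h hT
  have hp₁ := pRatio_pos hT
  have hp₂ := pRatio_pos hQ
  have hp₂1 := pRatio_le_one Q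
  have hε := h.solveError_pos
  have hL := h.gramError_pos
  have hlam := h.lam_pos
  have hu := h.u_pos
  have hn := h.one_le_cast
  have hs := h.one_le_sqrt_n
  have hq := hV.norm2_Q_le h
  have hεL := h.solveError_sq_le
  set τ := 4.89 * solveError n u lam * pRatio Q * normG T with hτ
  have hτσ : τ ≤ sigmaMin T := by
    rw [kappa2, div_le_div_iff₀ hσ (by positivity), one_mul] at hκ
    rw [hτ, normG_eq_pRatio_mul T, solveError]
    linarith
  have hτ0 : 0 ≤ τ := by positivity
  have hlow : ∀ y, τ * vecNorm y ≤ vecNorm (T *ᵥ y) := fun y =>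
    (mul_le_mul_of_nonneg_right hτσ (vecNorm_nonneg y)).trans
      (sigmaMin_mul_vecNorm_le h.one_le_n T y)
  have hE : normF (Q * V - T) ≤ 0.47 * τ := by
    refine (hV.normF_solve_le_normG h).trans ?_
    rw [hτ, normG_eq_pRatio_mul Q]
    have h1 : solveError n u lam * pRatio Q * normG T * norm2 Q ≤
        solveError n u lam * pRatio Q * normG T * 1.014 := by gcongr
    have h2 : 0 ≤ solveError n u lam * pRatio Q * normG T := by positivity
    linarith
  have key := hV.le_vecNorm_mulVec hτ0 hlow (by norm_num) hE x
  set ε := solveError n u lam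
  set L := gramError m n u lam
  set p := pRatio Q
  have hτ2 : τ ^ 2 = 4.89 ^ 2 * (ε * p) ^ 2 * normG T ^ 2 := by rw [hτ]; ring
  have hG : 0 < normG T ^ 2 := by positivity
  have hp2 : p ^ 2 ≤ 1 := pow_le_one₀ hp₂.le hp₂1
  have hεp : (ε * p) ^ 2 ≤ L / 4400 := by
    rw [mul_pow]
    exact (mul_le_of_le_one_right (by positivity) hp2).trans hεL
  have h3 : τ ^ 2 + 44 / 3 * L * normG T ^ 2 ≤ 14.68 * L * normG T ^ 2 := by
    rw [hτ2]
    have : (ε * p) ^ 2 * normG T ^ 2 ≤ L / 4400 * normG T ^ 2 := by gcongr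
    nlinarith [mul_pos hL hG]
  have h4 := key.trans (mul_le_mul_of_nonneg_right h3 (sq_nonneg (vecNorm (Q *ᵥ x))))
  rw [hτ2] at h4
  have h5 : normG T ^ 2 * ((1 - 0.47) ^ 2 * 4.89 ^ 2 * (ε * p) ^ 2 * vecNorm x ^ 2) ≤
      normG T ^ 2 * (14.68 * (L * vecNorm (Q *ᵥ x) ^ 2)) := by linarith
  have h6 := le_of_mul_le_mul_left h5 hG
  have h7 : 0 ≤ (ε * p) ^ 2 * vecNorm x ^ 2 := by positivity
  nlinarith

/-- The second step reduces the condition number to the order of `(√m + √(n+1)) / √n`. -/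
theorem le_vecNorm_Q₁_mulVec (h : SmallRoundoff m n u lam)
    {Q Q₁ : Matrix (Fin m) (Fin n) ℝ} {V₁ : Matrix (Fin n) (Fin n) ℝ}
    (hV₁ : ApproxQR u lam (11 * gramError m n u lam * normG Q ^ 2) Q Q₁ V₁) (hQ : 0 < normG Q)
    (hq : norm2 Q ≤ 1.014)
    (hlow : ∀ x, 0.45 * (solveError n u lam * pRatio Q) ^ 2 * vecNorm x ^ 2 ≤
      gramError m n u lam * vecNorm (Q *ᵥ x) ^ 2) (x : Fin n → ℝ) :
    0.15 * (solveError n u lam / gramError m n u lam) * vecNorm x ≤ vecNorm (Q₁ *ᵥ x) := by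
  have hp := pRatio_pos hQ
  have hε := h.solveError_pos
  have hL := h.gramError_pos
  have hL1 := h.gramError_le
  have h2ε := h.two_mul_solveError_le
  have hr := hV₁.norm2_Q_le h
  set ε := solveError n u lam
  set L := gramError m n u lam
  set p := pRatio Q with hpdef
  -- `τ² = 0.45 (ε p)² / L`
  set τ := √(0.45 / L) * (ε * p) with hτ
  have hτ0 : 0 ≤ τ := by positivity
  have hτ2 : L * τ ^ 2 = 0.45 * (ε * p) ^ 2 := by
    rw [hτ, mul_pow, Real.sq_sqrt (by positivity)]
    field_simp
  have hτlow : ∀ y, τ * vecNorm y ≤ vecNorm (Q *ᵥ y) := fun y => by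
    refine (abs_le_of_sq_le_sq' ?_ (vecNorm_nonneg _)).2
    refine le_of_mul_le_mul_left ?_ hL
    rw [mul_pow, ← mul_assoc, hτ2]
    exact hlow y
  have hG : normG Q = p * norm2 Q := normG_eq_pRatio_mul Q
  have hq0 := norm2_nonneg Q
  have hE : normF (Q₁ * V₁ - Q) ≤ 0.11 * τ := by
    refine (hV₁.normF_solve_le_norm2 h).trans ?_
    have h1 : 2.2624 * ε * norm2 Q₁ * normG Q ≤ 2.2624 * ε * 1.014 * (1.014 * p) := by
      rw [hG, mul_comm p]
      gcongr
    have h2 : 2.3263 * (ε * p) ≤ 0.11 * τ := by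
      refine (abs_le_of_sq_le_sq' ?_ (by positivity)).2
      refine le_of_mul_le_mul_left ?_ hL
      rw [mul_pow 0.11, mul_left_comm L, hτ2, mul_pow]
      have : L * (ε * p) ^ 2 ≤ 1 / 1100 * (ε * p) ^ 2 := by gcongr
      nlinarith [sq_nonneg (ε * p)]
    have h3 : 0 ≤ ε * p := by positivity
    linarith
  have key := hV₁.le_vecNorm_mulVec hτ0 hτlow (by norm_num) hE x
  have hp2 : 0 < p ^ 2 := by positivity
  have hL2 : 0 < L ^ 2 := by positivity
  have hε2 : ε ^ 2 ≤ L ^ 2 / 4 := by nlinarith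
  have h1 : L * (τ ^ 2 + 44 / 3 * L * normG Q ^ 2) ≤ 15.25 * (L ^ 2 * p ^ 2) := by
    have h2 : norm2 Q ^ 2 ≤ 1.014 ^ 2 := pow_le_pow_left₀ hq0 hq 2
    have h3 : L ^ 2 * p ^ 2 * norm2 Q ^ 2 ≤ L ^ 2 * p ^ 2 * 1.014 ^ 2 := by gcongr
    have h4 : ε ^ 2 * p ^ 2 ≤ L ^ 2 / 4 * p ^ 2 := by gcongr
    rw [mul_add, hτ2, hG]
    nlinarith [mul_pos hL2 hp2]
  have h5 : (1 - 0.11) ^ 2 * (0.45 * (ε * p) ^ 2) * vecNorm x ^ 2 ≤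
      15.25 * (L ^ 2 * p ^ 2) * vecNorm (Q₁ *ᵥ x) ^ 2 := by
    have h6 := mul_le_mul_of_nonneg_left key hL.le
    have h7 := mul_le_mul_of_nonneg_right h1 (sq_nonneg (vecNorm (Q₁ *ᵥ x)))
    rw [← hτ2]
    linarith
  have h8 : p ^ 2 * (0.0233 * ε ^ 2 * vecNorm x ^ 2) ≤
      p ^ 2 * (L ^ 2 * vecNorm (Q₁ *ᵥ x) ^ 2) := by
    have h9 : 0 ≤ p ^ 2 * (ε ^ 2 * vecNorm x ^ 2) := by positivity
    nlinarith
  have h10 := le_of_mul_le_mul_left h8 hp2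
  refine (abs_le_of_sq_le_sq' ?_ (vecNorm_nonneg _)).2
  refine le_of_mul_le_mul_left ?_ hL2
  have h11 : L ^ 2 * (0.15 * (ε / L) * vecNorm x) ^ 2 = 0.0225 * (ε ^ 2 * vecNorm x ^ 2) := by
    field_simp
    ring
  rw [h11]
  have h12 : 0 ≤ ε ^ 2 * vecNorm x ^ 2 := by positivity
  linarith

/-- The condition on `κ₂(X)` in terms of the least singular value. -/
theorem gramError_mul_normG_sq_le (h : SmallRoundoff m n u lam) {X : Matrix (Fin m) (Fin n) ℝ}
    (hX : 0 < normG X) (hσ : 0 < sigmaMin X)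
    (hκ : 8 * pRatio X * kappa2 X * √(gramError m n u lam) ≤ 1) :
    64 * gramError m n u lam * normG X ^ 2 ≤ sigmaMin X ^ 2 := by
  have hx := norm2_pos_of_normG_pos hX
  have h1 : 8 * normG X * √(gramError m n u lam) ≤ sigmaMin X := by
    have h2 : 8 * pRatio X * kappa2 X * √(gramError m n u lam) =
        8 * normG X * √(gramError m n u lam) / sigmaMin X := by
      rw [pRatio, kappa2]
      field_simp
    rwa [h2, div_le_one hσ] at hκ
  have h3 := pow_le_pow_left₀ (by positivity) h1 2
  rw [mul_pow, Real.sq_sqrt h.gramError_pos.le] at h3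
  linarith

/-- The loss of orthogonality in terms of the dimensions: `lam ≤ 10` and the bounds for the
singular values of `Q₁` are inserted. -/
theorem orthogonality_bound (h : SmallRoundoff m n u lam) (hlam10 : lam ≤ 10) {p α : ℝ}
    (hp : 0 < p) (hp1 : 1 ≤ √(n : ℝ) * p) (hα0 : 0 ≤ α) (hα : α ≤ 1.014 * p) :
    4 * gramError m n u lam * (α / (0.15 * (solveError n u lam / gramError m n u lam))) ^ 2 +
        5.1 * solveError n u lam * (α / (0.15 * (solveError n u lam / gramError m n u lam))) ≤
      3645 * p ^ 2 * (√(m : ℝ) + √((n : ℝ) + 1)) ^ 3 * n * u := by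
  have hlam := h.lam_pos
  have hu := h.u_pos
  have hn := h.one_le_cast
  have hs := h.one_le_sqrt_n
  have hsn : √(n : ℝ) ^ 2 = n := Real.sq_sqrt (by positivity)
  have hD1 : √(n : ℝ) ≤ √(m : ℝ) + √((n : ℝ) + 1) := by
    linarith [h.sqrt_n_le, Real.sqrt_nonneg (m : ℝ)]
  have hLD : gramError m n u lam = lam * (√(m : ℝ) + √((n : ℝ) + 1)) * n * u := by
    rw [gramError]; ring
  rw [hLD, solveError]
  set D := √(m : ℝ) + √((n : ℝ) + 1)
  set r := √(n : ℝ)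
  have hD : 0 < D := by linarith
  have hr : 0 < r := by linarith
  have h1 : α / (0.15 * (lam * n * r * u / (lam * D * n * u))) = α * D / (0.15 * r) := by
    have : (0 : ℝ) < n := by linarith
    field_simp
  rw [h1]
  have h2 : 4 * (lam * D * n * u) * (α * D / (0.15 * r)) ^ 2 =
      4 / 0.15 ^ 2 * (lam * u * D ^ 3 * α ^ 2) := by
    rw [← hsn]
    field_simp
  have h3 : 5.1 * (lam * n * r * u) * (α * D / (0.15 * r)) = 34 * (lam * u * D * α * n) := by
    field_simp
    ring
  rw [h2, h3]
  have h4 : lam * u * D ^ 3 * α ^ 2 ≤ 10 * u * D ^ 3 * (1.014 * p) ^ 2 * n := by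
    have : lam * u * D ^ 3 * α ^ 2 ≤ 10 * u * D ^ 3 * (1.014 * p) ^ 2 := by gcongr
    exact this.trans (le_mul_of_one_le_right (by positivity) hn)
  have h5 : lam * u * D * α * n ≤ 10 * u * D ^ 3 * (1.014 * p ^ 2) * n := by
    have h6 : p ≤ D ^ 2 * p ^ 2 := by
      have h7 : p ≤ r * p * p := le_mul_of_one_le_left hp.le hp1
      have h8 : r * p * p ≤ D ^ 2 * p ^ 2 := by
        have h9 : r ≤ D ^ 2 := by nlinarith
        calc r * p * p = r * p ^ 2 := by ring
          _ ≤ D ^ 2 * p ^ 2 := by gcongr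
      exact h7.trans h8
    calc lam * u * D * α * n ≤ 10 * u * D * (1.014 * (D ^ 2 * p ^ 2)) * n := by
          gcongr
          exact hα.trans (by gcongr)
      _ = _ := by ring
  have h10 : 0 ≤ p ^ 2 * D ^ 3 * n * u := by positivity
  nlinarith

/-- The conclusions about the algorithm, for every realization of the rounding errors whose
accumulated relative errors are small. -/
theorem alg3C_spec (h : SmallRoundoff m n u lam) (hlam10 : lam ≤ 10)
    (hd : SmallRelErrors u (2.24 * lam * √(m : ℝ) * u) (2.24 * lam * √(n : ℝ) * u) d)
    (T : Matrix (Fin m) (Fin n) ℝ) (hT : T.rank = n) :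
    let R := alg3C d (shift3C u lam) T
    let p₁ := pRatio T
    let p₂ := pRatio R.Q
    let p₃ := pRatio R.Q₁
    R.runs₁ ∧
    (kappa2 T ≤ 1 / (4.89 * lam * p₁ * p₂ * n * √(n : ℝ) * u) →
      R.runs₂ ∧
      (8 * p₃ * kappa2 R.Q₁ * √(lam * (√(m : ℝ) * n * u + √((n : ℝ) + 1) * n * u)) ≤ 1 →
        R.runs₃ ∧
        normF (R.Q₂ᵀ * R.Q₂ - 1) ≤
          3645 * p₃ ^ 2 * (√(m : ℝ) + √((n : ℝ) + 1)) ^ 3 * n * u ∧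
        normF (R.Q₂ * R.V₄ - T) ≤
          phi2 p₁ p₂ p₃ * lam * n * √(n : ℝ) * u * norm2 T)) := by
  intro R p₁ p₂ p₃
  have hσ : 0 < sigmaMin T := sigmaMin_pos_of_rank h.one_le_n hT
  have hTG : 0 < normG T := by
    refine (normG_nonneg T).lt_of_ne fun h0 => ?_
    rw [eq_zero_of_normG_eq_zero h0.symm, Matrix.rank_zero] at hT
    exact absurd h.one_le_n (by omega)
  obtain ⟨hruns₁, hV⟩ := sCholQR_spec h hd 0 hTG
  have hQG := hV.normG_pos h hTG
  obtain ⟨hruns₂, hV₁⟩ := sCholQR_spec h hd 1 hQG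
  have hQ₁G := hV₁.normG_pos h hQG
  refine ⟨hruns₁, fun hκ => ⟨hruns₂, fun hκ₁ => ?_⟩⟩
  have hε := h.solveError_pos
  have hL := h.gramError_pos
  have hlow := le_vecNorm_Q₁_mulVec h hV₁ hQG (hV.norm2_Q_le h)
    (le_vecNorm_Q_mulVec h hV hTG hσ hκ)
  have hρ : 0 < 0.15 * (solveError n u lam / gramError m n u lam) := by positivity
  have hσ₁ : 0 < sigmaMin R.Q₁ := sigmaMin_pos_of_forall h.one_le_n hρ hlow
  have hσL := gramError_mul_normG_sq_le h hQ₁G hσ₁ hκ₁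
  have hσlow := sigmaMin_mul_vecNorm_le h.one_le_n R.Q₁
  obtain ⟨hruns₃, hV₃⟩ := cholQR_spec h hd 2 hQ₁G fun x => by
    have h1 := pow_le_pow_left₀ (mul_nonneg hσ₁.le (vecNorm_nonneg x)) (hσlow x) 2
    rw [mul_pow] at h1
    refine le_trans ?_ h1
    refine mul_le_mul_of_nonneg_right (le_trans ?_ hσL) (sq_nonneg _)
    gcongr
    norm_num
  refine ⟨hruns₃, ?_, ?_⟩
  · refine (hV₃.normF_transpose_mul_self_sub_one_le h hσlow hσ₁ hσL hρ hlow).trans ?_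
    refine orthogonality_bound h hlam10 (pRatio_pos hQ₁G) (one_le_sqrt_mul_pRatio hQ₁G)
      (normG_nonneg _) ?_
    rw [normG_eq_pRatio_mul, mul_comm]
    exact mul_le_mul_of_nonneg_right (hV₁.norm2_Q_le h) (pRatio_nonneg _)
  · exact normF_residual_le h hd hV hV₁ hV₃ (hV₃.norm2_Q_le_of_unshifted h hσlow hσ₁ hσL)
      (normG_eq_pRatio_mul _) (normG_eq_pRatio_mul _) (normG_eq_pRatio_mul _) (pRatio_nonneg _)
      (pRatio_nonneg _) (pRatio_nonneg _) (pRatio_le_one _)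

end Algorithm

theorem theorem5p1 {Ω : Type*} [MeasurableSpace Ω] (P : Measure Ω) [IsProbabilityMeasure P]
    (m n : ℕ) (hn : 1 ≤ n) (T : Matrix (Fin m) (Fin n) ℝ) (hT : T.rank = n)
    (u lam : ℝ) (hu : 0 < u) (hlam : 0 < lam) (hlam10 : lam ≤ 10)
    (hsize₁ : max (lam * √(m : ℝ) * n * u) (m * n * u) ≤ 1 / 2200)
    (hsize₂ : max (lam * √((n : ℝ) + 1) * n * u) (n * (n + 1) * u) ≤ 1 / 2200)
    (hprob : 0 < probQ u lam (m * n ^ 2))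
    (δ : FlOp m n → Ω → ℝ) (hδ : IsRoundingModel P u δ) :
    (probQ u lam (m * n ^ 2) * probQ u lam (n ^ 3 / 6 + n ^ 2 / 2 + n / 3) *
        probQ u lam (n * (n + 1) / 2)) ^ 3 * probQ u lam (n ^ 3) ^ 2 ≤
      P.real {ω |
        let R := alg3C (fun a => δ a ω) (shift3C u lam) T
        let p₁ := pRatio T
        let p₂ := pRatio R.Q
        let p₃ := pRatio R.Q₁
        R.runs₁ ∧
        (kappa2 T ≤ 1 / (4.89 * lam * p₁ * p₂ * n * √(n : ℝ) * u) →
          R.runs₂ ∧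
          (8 * p₃ * kappa2 R.Q₁ * √(lam * (√(m : ℝ) * n * u + √((n : ℝ) + 1) * n * u)) ≤ 1 →
            R.runs₃ ∧
            normF (R.Q₂ᵀ * R.Q₂ - 1) ≤
              3645 * p₃ ^ 2 * (√(m : ℝ) + √((n : ℝ) + 1)) ^ 3 * n * u ∧
            normF (R.Q₂ * R.V₄ - T) ≤
              phi2 p₁ p₂ p₃ * lam * n * √(n : ℝ) * u * norm2 T))} := by
  have hnm : n ≤ m := by
    rw [← hT]
    exact (Matrix.rank_le_card_height T).trans_eq (Fintype.card_fin m)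
  have hn' : (1 : ℝ) ≤ n := by exact_mod_cast hn
  have hm' : (n : ℝ) ≤ m := by exact_mod_cast hnm
  have hN : (1 : ℝ) ≤ m * n ^ 2 := by nlinarith
  have hu1 : u ≤ 1 / 2200 := by
    refine le_trans ?_ ((le_max_right _ _).trans hsize₁)
    exact le_mul_of_one_le_left hu.le (by nlinarith)
  have hlam1 : 1 ≤ lam := one_le_of_probQ_pos hlam hN hu.le (by linarith) hprob
  have h : SmallRoundoff m n u lam :=
    ⟨hn, hnm, hu, hlam1, (le_max_left _ _).trans hsize₁, (le_max_left _ _).trans hsize₂⟩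
  refine (probQ_prod_le hn hnm hu.le (by linarith) hprob).trans ?_
  refine one_sub_le_measureReal_of_smallErrorSums hδ hu hlam hnm fun ω hω => ?_
  have hsn : lam * √(n : ℝ) * u ≤ 1 / 2200 := by
    have := h.gn_le
    linarith [h.sqrt_n_mul_u]
  exact alg3C_spec h hlam10
    (hω.smallRelErrors hu.le hlam1 h.sqrt_m_mul_u hsn (by linarith)) T hT
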